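/- Let $A_0(x_1,x_2)=\frac12(-x_2,x_1)$ on the half-plane $\mathbb R\times\mathbb R_+$, where $\mathbb R_+=(0,\infty)$, and let $H^1_{A_0}$ be the space of $u\in L^2(\mathbb R\times\mathbb R_+)$ (complex-valued) with $(\nabla-iA_0)u\in L^2(\mathbb R\times\mathbb R_+)$ in the sense of distributions. For $\gamma\in\mathbb R$ put $$\Theta(\gamma)=\inf_{u\in H^1_{A_0},\,u\neq0}\frac{\|(\nabla-iA_0)u\|_{L^2(\mathbb R\times\mathbb R_+)}^2+\gamma\int_{\mathbb R}|u(x_1,0)|^2\,dx_1}{\|u\|_{L^2(\mathbb R\times\mathbb R_+)}^2}.$$ For $\gamma,\xi\in\mathbb R$ let $H[\gamma,\xi]=-\frac{d^2}{dt^2}+(t-\xi)^2$ be the self-adjoint operator on $L^2(\mathbb R_+)$ with domain $\{u\in H^2(\mathbb R_+):\ t^2u\in L^2(\mathbb R_+),\ u'(0)=\gamma u(0)\}$, and let $\mu^{(1)}(\gamma,\xi)$ be its lowest eigenvalue. For every $\gamma\in\mathbb R$ the function $\xi\mapsto\mu^{(1)}(\gamma,\xi)$ attains its minimum over $\mathbb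 R$ at a unique point $\xi(\gamma)$, and $H[\gamma,\xi(\gamma)]$ has a unique eigenfunction $\varphi_\gamma$ for the eigenvalue $\Theta(\gamma)$ which is strictly positive on $[0,\infty)$ and satisfies $\|\varphi_\gamma\|_{L^2(\mathbb R_+)}=1$. The maps $\mathbb R\ni\gamma\mapsto\Theta(\gamma)\in\mathbb R$ and $\mathbb R\ni\gamma\mapsto\varphi_\gamma\in L^2(\mathbb R_+)$ are $C^\infty$. Moreover $\varphi_\gamma\in L^\infty(\mathbb R_+)$ for every $\gamma$, and the map $\mathbb R\ni\gamma\mapsto\varphi_\gamma\in L^\infty(\mathbb R_+)$ is locally Lipschitz. -/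

import Mathlib

open MeasureTheory

noncomputable section

/-! ### The half-plane model -/

/-- The open half-plane `ℝ × ℝ₊`. -/
def halfPlane : Set (ℝ × ℝ) := {x | 0 < x.2}

/-- Lebesgue measure on the half-plane. -/
abbrev halfPlaneMeasure : Measure (ℝ × ℝ) := volume.restrict halfPlane

/-- First component of the magnetic potential `A₀(x₁, x₂) = (-x₂, x₁) / 2`. -/
def magA1 (x : ℝ × ℝ) : ℝ := -x.2 / 2

/-- Second component of the magnetic potential `A₀(x₁, x₂) = (-x₂, x₁) / 2`. -/
def magA2 (x : ℝ × ℝ) : ℝ := x.1 / 2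

/-- `u` belongs to the magnetic Sobolev space `H¹_{A₀}(ℝ × ℝ₊)` and `(p₁, p₂)` is its distributional
magnetic gradient `(∇ - i A₀) u`: all three functions are square integrable on the half-plane, and
`∂ⱼ u = pⱼ + i (A₀)ⱼ u` holds against every test function supported in the open half-plane. -/
structure HasMagneticGradient (u p₁ p₂ : ℝ × ℝ → ℂ) : Prop where
  memLp : MemLp u 2 halfPlaneMeasure
  memLp_fst : MemLp p₁ 2 halfPlaneMeasure
  memLp_snd : MemLp p₂ 2 halfPlaneMeasure
  weak_fst : ∀ ψ : ℝ × ℝ → ℂ, ContDiff ℝ ((⊤ : ℕ∞) : WithTop ℕ∞) ψ → HasCompactSupport ψ →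
    tsupport ψ ⊆ halfPlane →
    ∫ x in halfPlane, u x * fderiv ℝ ψ x (1, 0) =
      - ∫ x in halfPlane, (p₁ x + Complex.I * (magA1 x : ℂ) * u x) * ψ x
  weak_snd : ∀ ψ : ℝ × ℝ → ℂ, ContDiff ℝ ((⊤ : ℕ∞) : WithTop ℕ∞) ψ → HasCompactSupport ψ →
    tsupport ψ ⊆ halfPlane →
    ∫ x in halfPlane, u x * fderiv ℝ ψ x (0, 1) =
      - ∫ x in halfPlane, (p₂ x + Complex.I * (magA2 x : ℂ) * u x) * ψ x

/-- `g` is the boundary trace `x₁ ↦ u (x₁, 0)` of a function `u ∈ H¹_{A₀}(ℝ × ℝ₊)` with second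
magnetic derivative `p₂`, as determined by Green's formula against test functions which need not
vanish on the boundary. (The trace of a function of this space is always square integrable.) -/
structure IsBoundaryTrace (u p₂ : ℝ × ℝ → ℂ) (g : ℝ → ℂ) : Prop where
  memLp : MemLp g 2 volume
  green : ∀ ψ : ℝ × ℝ → ℂ, ContDiff ℝ ((⊤ : ℕ∞) : WithTop ℕ∞) ψ → HasCompactSupport ψ →
    ∫ x in halfPlane, u x * fderiv ℝ ψ x (0, 1) =
      - (∫ x in halfPlane, (p₂ x + Complex.I * (magA2 x : ℂ) * u x) * ψ x)
      - ∫ s : ℝ, g s * ψ (s, 0)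

/-- The bottom of the spectrum of the half-plane model: the infimum over nonzero
`u ∈ H¹_{A₀}(ℝ × ℝ₊)` of
`(‖(∇ - i A₀) u‖² + γ ∫ |u (x₁, 0)|² dx₁) / ‖u‖²`. -/
def Theta (γ : ℝ) : ℝ :=
  sInf {r : ℝ | ∃ (u p₁ p₂ : ℝ × ℝ → ℂ) (g : ℝ → ℂ),
    HasMagneticGradient u p₁ p₂ ∧ IsBoundaryTrace u p₂ g ∧
    ¬ (u =ᵐ[halfPlaneMeasure] 0) ∧
    r = ((∫ x in halfPlane, (‖p₁ x‖ ^ 2 + ‖p₂ x‖ ^ 2)) + γ * ∫ s : ℝ, ‖g s‖ ^ 2) /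
      ∫ x in halfPlane, ‖u x‖ ^ 2}

/-! ### The one-dimensional operators -/

/-- Lebesgue measure on `ℝ₊ = (0, ∞)`. -/
abbrev halfLineMeasure : Measure ℝ := volume.restrict (Set.Ioi 0)

/-- `u` is (the continuous representative on `[0, ∞)` of) an element of `H¹(ℝ₊)`, with weak
derivative `v`. -/
structure HasSobolevDeriv (u v : ℝ → ℂ) : Prop where
  memLp : MemLp u 2 halfLineMeasure
  memLp_deriv : MemLp v 2 halfLineMeasure
  eq_integral : ∀ t : ℝ, 0 ≤ t → u t = u 0 + ∫ s in (0 : ℝ)..t, v s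

/-- `u` belongs to the domain `{u ∈ B²(ℝ₊) : u'(0) = γ u(0)}` of `H[γ, ξ]`, where
`B²(ℝ₊) = {u ∈ H²(ℝ₊) : t² u ∈ L²(ℝ₊)}`; here `u' = u₁` and `u'' = u₂`. -/
structure InRobinDomain (γ : ℝ) (u u₁ u₂ : ℝ → ℂ) : Prop where
  deriv_one : HasSobolevDeriv u u₁
  deriv_two : HasSobolevDeriv u₁ u₂
  weight : MemLp (fun t : ℝ => (t : ℂ) ^ 2 * u t) 2 halfLineMeasure
  robin : u₁ 0 = (γ : ℂ) * u 0

/-- `u` lies in the domain of `H[γ, ξ] = -d²/dt² + (t - ξ)²` and `H[γ, ξ] u = lam u`. -/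
def SolvesEigenEquation (γ ξ lam : ℝ) (u : ℝ → ℂ) : Prop :=
  ∃ u₁ u₂ : ℝ → ℂ, InRobinDomain γ u u₁ u₂ ∧
    ∀ᵐ t ∂halfLineMeasure, -u₂ t + ((t : ℂ) - (ξ : ℂ)) ^ 2 * u t = (lam : ℂ) * u t

/-- `lam` is an eigenvalue of the self-adjoint operator `H[γ, ξ]`. -/
def IsRobinEigenvalue (γ ξ lam : ℝ) : Prop :=
  ∃ u : ℝ → ℂ, SolvesEigenEquation γ ξ lam u ∧ ¬ (u =ᵐ[halfLineMeasure] 0)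

/-- The first (lowest) eigenvalue `μ⁽¹⁾(γ, ξ)` of `H[γ, ξ]`. -/
def firstEigenvalue (γ ξ : ℝ) : ℝ := sInf {lam : ℝ | IsRobinEigenvalue γ ξ lam}

/-- `f ∈ L²(ℝ₊)` is a strictly positive, `L²`-normalized eigenfunction of `H[γ, ξ]` for the
eigenvalue `lam` (positivity is that of the continuous representative on `[0, ∞)`). -/
def IsPositiveNormalizedEigenfunction (γ ξ lam : ℝ) (f : Lp ℂ 2 halfLineMeasure) : Prop :=
  ‖f‖ = 1 ∧ ∃ u : ℝ → ℂ, f =ᵐ[halfLineMeasure] u ∧ SolvesEigenEquation γ ξ lam u ∧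
    ∀ t : ℝ, 0 ≤ t → 0 < (u t).re ∧ (u t).im = 0

end

/-! Put s = -ξ and write an eigenvalue as 1 - 2a. For a > 0 a decaying solution of -u'' + (t + s)² u
= (1 - 2a) u is u(t) = exp(-(t + s)²/2) I(t + s, a), where I(s, a) = ∫₀^∞ exp(-2sx - x²) x^(a-1) dx
(`cylI`) is positive and smooth in (s, a). If R = `cylR` is the logarithmic derivative of exp(-s²/2)
I(s, a), the Robin condition becomes R(s, a) = γ, and R solves the Riccati equation ∂ₛR = s² + 2a -
1 - R² (`cylD`).

R decreases strictly in a, because ∂ₐ of the mean of x under the weight is a covariance of x and log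
x (`exists_hasDerivAt_cylR_right`). For fixed a, s ↦ R(s, a) has a single critical point, which lies
at s < 0 and is a strict global maximum (`exists_cylD_eq_zero`, `cylR_lt_of_ne`). Minimizing the
eigenvalue over ξ therefore amounts to solving R = γ, ∂ₛR = 0 (`IsCrit`), equivalently (R, s² + 2a)
= (γ, 1 + γ²). The Jacobian there is triangular with nonzero entries ∂ₐR and 2s, so the inverse
function theorem makes the critical pair smooth in γ (`IsCrit.exists_local_inverse`,
`contDiff_critPair`).

All lower bounds come from one completion of the square, with R and w evaluated along t: w'² + (t -
ξ)² w² - (1 - 2a) w² = (w' - R w)² + (R w²)', where R = R(t - ξ, a). If R(-ξ, a) ≤ γ, integration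
bounds the Robin form below by 1 - 2a (`energy_ge_of_primitive`). The variant for solutions bounds
the eigenvalues, and in the case of equality gives u' = R u, hence simplicity
(`ground_state_rigidity`). Since the first eigenvalue is a real infimum, the set of eigenvalues must
also be shown nonempty for all (γ, ξ); this needs the continuation of I/Γ to a ≤ 0
(`exists_isRobinEigenvalue`).

For the half-plane, a cutoff in x₁, a gauge change and a Fourier series in x₁ reduce the form to
half-line problems with various ξ. At the critical pair γ is the maximum of R(·, a), so one constant
1 - 2a serves every mode (`localized_energy_ge`). Wide Gaussians times the ground state show that
the constant is sharp (`add_mem_rayleighSet`), whence `Theta_eq_critPair`.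

Finally φ_γ is a normalized parabolic cylinder function at the critical pair. Its smoothness in L²
and in L^∞ follows from a family of kernels closed under parameter derivatives and dominated by
multiples of exp(-t) (`exists_Lp_family`, `abs_cylFun_le`). -/

noncomputable section

open Set Filter Topology

/-! ### Smoothness of families closed under partial derivatives -/

/-- The linear map on the parameter plane with partial derivatives `x` and `y`. -/
def pairDeriv {E : Type*} [NormedAddCommGroup E] [NormedSpace ℝ E] (x y : E) : ℝ × ℝ →L[ℝ] E :=
  (ContinuousLinearMap.fst ℝ ℝ ℝ).smulRight x + (ContinuousLinearMap.snd ℝ ℝ ℝ).smulRight y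

section family

variable {E : Type*} [NormedAddCommGroup E] [NormedSpace ℝ E]

lemma pairDeriv_apply (x y : E) (h : ℝ × ℝ) : pairDeriv x y h = h.1 • x + h.2 • y := rfl

lemma pairDeriv_sub (x y x' y' : E) :
    pairDeriv x y - pairDeriv x' y' = pairDeriv (x - x') (y - y') := by
  ext <;> simp [pairDeriv_apply]

lemma norm_pairDeriv_le (x y : E) : ‖pairDeriv x y‖ ≤ ‖x‖ + ‖y‖ := by
  refine ContinuousLinearMap.opNorm_le_bound _ (by positivity) fun h => ?_
  rw [pairDeriv_apply, add_mul]
  refine (norm_add_le _ _).trans (add_le_add ?_ ?_)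
  · rw [norm_smul, mul_comm]
    exact mul_le_mul_of_nonneg_left (norm_fst_le h) (norm_nonneg _)
  · rw [norm_smul, mul_comm]
    exact mul_le_mul_of_nonneg_left (norm_snd_le h) (norm_nonneg _)

/-- A family of functions closed under partial derivatives consists of smooth functions. -/
theorem contDiffOn_of_family {Ω : Set (ℝ × ℝ)} (hΩ : IsOpen Ω) (F : ℕ → ℕ → ℝ × ℝ → E)
    (hF : ∀ i j, ∀ p ∈ Ω, HasFDerivAt (F i j) (pairDeriv (F (i + 1) j p) (F i (j + 1) p)) p)
    (i j : ℕ) : ContDiffOn ℝ ((⊤ : ℕ∞) : WithTop ℕ∞) (F i j) Ω := by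
  have key : ∀ n : ℕ, ∀ i j, ContDiffOn ℝ (n : WithTop ℕ∞) (F i j) Ω := by
    intro n
    induction n with
    | zero =>
      intro i j
      exact contDiffOn_zero.2 fun p hp => (hF i j p hp).continuousAt.continuousWithinAt
    | succ n ih =>
      intro i j
      have : ((n + 1 : ℕ) : WithTop ℕ∞) = (n : WithTop ℕ∞) + 1 := by push_cast; rfl
      rw [this, contDiffOn_succ_iff_hasFDerivWithinAt_of_uniqueDiffOn hΩ.uniqueDiffOn]
      refine ⟨by simp, fun p => pairDeriv (F (i + 1) j p) (F i (j + 1) p), ?_,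
        fun p hp => (hF i j p hp).hasFDerivWithinAt⟩
      exact (contDiffOn_const.smulRight (ih _ _)).add (contDiffOn_const.smulRight (ih _ _))
  exact contDiffOn_infty.2 fun n => key n i j

/-- Two applications of the mean value inequality: each first partial moves by at most 2G times the
distance, so the derivative moves by at most 4G times it. A quadratic remainder with an explicit
constant can be applied pointwise in x and then turned into a bound of L^q norms. -/
theorem norm_sub_sub_pairDeriv_le {Ω : Set (ℝ × ℝ)} (f : ℕ → ℕ → ℝ × ℝ → E)
    (hf : ∀ i j, ∀ p ∈ Ω, HasFDerivAt (f i j) (pairDeriv (f (i + 1) j p) (f i (j + 1) p)) p)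
    {p : ℝ × ℝ} {ε : ℝ} (hε : Metric.ball p ε ⊆ Ω) {i j : ℕ} {G : ℝ}
    (h20 : ∀ y ∈ Metric.ball p ε, ‖f (i + 2) j y‖ ≤ G)
    (h11 : ∀ y ∈ Metric.ball p ε, ‖f (i + 1) (j + 1) y‖ ≤ G)
    (h02 : ∀ y ∈ Metric.ball p ε, ‖f i (j + 2) y‖ ≤ G)
    {y : ℝ × ℝ} (hy : y ∈ Metric.ball p ε) :
    ‖f i j y - f i j p - pairDeriv (f (i + 1) j p) (f i (j + 1) p) (y - p)‖
      ≤ 4 * G * ‖y - p‖ * ‖y - p‖ := by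
  have hp : p ∈ Metric.ball p ε := Metric.mem_ball_self (Metric.pos_of_mem_ball hy)
  have first : ∀ i j, (∀ y ∈ Metric.ball p ε, ‖f (i + 1) j y‖ ≤ G) →
      (∀ y ∈ Metric.ball p ε, ‖f i (j + 1) y‖ ≤ G) → ∀ z ∈ Metric.ball p ε,
      ‖f i j z - f i j p‖ ≤ 2 * G * ‖z - p‖ := by
    intro i j h1 h2 z hz
    refine (convex_ball p ε).norm_image_sub_le_of_norm_hasFDerivWithin_le
      (fun w hw => (hf i j w (hε hw)).hasFDerivWithinAt) (fun w hw => ?_) hp hz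
    refine (norm_pairDeriv_le _ _).trans ?_
    linarith [h1 w hw, h2 w hw]
  have hsub : Metric.closedBall p ‖y - p‖ ⊆ Metric.ball p ε := by
    refine Metric.closedBall_subset_ball ?_
    simpa [dist_eq_norm] using hy
  have hG : 0 ≤ G := (norm_nonneg _).trans (h20 p hp)
  refine (convex_closedBall p ‖y - p‖).norm_image_sub_le_of_norm_hasFDerivWithin_le'
    (fun w hw => (hf i j w (hε (hsub hw))).hasFDerivWithinAt) (fun w hw => ?_)
    (Metric.mem_closedBall_self (norm_nonneg _)) (by simp [dist_eq_norm])
  rw [pairDeriv_sub]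
  refine (norm_pairDeriv_le _ _).trans ?_
  have h1 := first (i + 1) j h20 h11 w (hsub hw)
  have h2 := first i (j + 1) h11 h02 w (hsub hw)
  have h3 : ‖w - p‖ ≤ ‖y - p‖ := by simpa [dist_eq_norm] using hw
  have h4 := mul_le_mul_of_nonneg_left h3 hG
  linarith

/-- A family closed under pointwise partial derivatives, locally dominated in `L^q`, defines a
family of `L^q`-valued functions closed under partial derivatives. -/
theorem exists_Lp_family {α : Type*} {m : MeasurableSpace α} {μ : Measure α} {q : ENNReal}
    [Fact (1 ≤ q)] {Ω : Set (ℝ × ℝ)} (hΩ : IsOpen Ω) (f : ℕ → ℕ → ℝ × ℝ → α → E)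
    (hmeas : ∀ i j, ∀ p ∈ Ω, AEStronglyMeasurable (f i j p) μ)
    (hder : ∀ᵐ x ∂μ, ∀ i j, ∀ p ∈ Ω, HasFDerivAt (fun p => f i j p x)
      (pairDeriv (f (i + 1) j p x) (f i (j + 1) p x)) p)
    (hbd : ∀ p ∈ Ω, ∃ ε > 0, ∀ i j, ∃ g : α → ℝ, MemLp g q μ ∧
      ∀ᵐ x ∂μ, ∀ p' ∈ Metric.ball p ε, ‖f i j p' x‖ ≤ g x) :
    ∃ F : ℕ → ℕ → ℝ × ℝ → Lp E q μ, (∀ i j, ∀ p ∈ Ω, F i j p =ᵐ[μ] f i j p) ∧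
      ∀ i j, ∀ p ∈ Ω, HasFDerivAt (F i j) (pairDeriv (F (i + 1) j p) (F i (j + 1) p)) p := by
  classical
  have hmem : ∀ i j, ∀ p ∈ Ω, MemLp (f i j p) q μ := by
    intro i j p hp
    obtain ⟨ε, hε, h⟩ := hbd p hp
    obtain ⟨g, hg, hfg⟩ := h i j
    refine hg.mono' (hmeas i j p hp) ?_
    filter_upwards [hfg] with x hx using hx p (Metric.mem_ball_self hε)
  let F : ℕ → ℕ → ℝ × ℝ → Lp E q μ := fun i j p =>
    if h : MemLp (f i j p) q μ then h.toLp else 0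
  have hFf : ∀ i j, ∀ p ∈ Ω, F i j p =ᵐ[μ] f i j p := by
    intro i j p hp
    simp only [F, dif_pos (hmem i j p hp)]
    exact MemLp.coeFn_toLp _
  refine ⟨F, hFf, fun i j p hp => ?_⟩
  obtain ⟨ε₁, hε₁, h⟩ := hbd p hp
  obtain ⟨ε₂, hε₂, hball⟩ := Metric.isOpen_iff.1 hΩ p hp
  obtain ⟨g1, hg1, h1⟩ := h (i + 2) j
  obtain ⟨g2, hg2, h2⟩ := h (i + 1) (j + 1)
  obtain ⟨g3, hg3, h3⟩ := h i (j + 2)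
  set ε := min ε₁ ε₂ with hεdef
  have hε : 0 < ε := lt_min hε₁ hε₂
  have hsub₁ : Metric.ball p ε ⊆ Metric.ball p ε₁ := Metric.ball_subset_ball (min_le_left _ _)
  have hsubΩ : Metric.ball p ε ⊆ Ω := (Metric.ball_subset_ball (min_le_right _ _)).trans hball
  -- One function dominates the three second partials; 4 is the constant of the Taylor remainder.
  let G : α → ℝ := fun x => 4 * (‖g1 x‖ + ‖g2 x‖ + ‖g3 x‖)
  have hG : MemLp G q μ := ((hg1.norm.add hg2.norm).add hg3.norm).const_mul 4
  set KL : Lp ℝ q μ := hG.toLp with hKL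
  have bound : ∀ y ∈ Metric.ball p ε,
      ‖F i j y - F i j p - pairDeriv (F (i + 1) j p) (F i (j + 1) p) (y - p)‖
        ≤ ‖KL‖ * ‖y - p‖ * ‖y - p‖ := by
    intro y hy
    have : ‖KL‖ * ‖y - p‖ * ‖y - p‖ = ‖(‖y - p‖ * ‖y - p‖) • KL‖ := by
      rw [norm_smul, Real.norm_of_nonneg (by positivity)]; ring
    rw [this]
    refine Lp.norm_le_norm_of_ae_le ?_
    rw [pairDeriv_apply]
    filter_upwards [hder, h1, h2, h3, Lp.coeFn_smul (‖y - p‖ * ‖y - p‖) KL, hG.coeFn_toLp,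
      Lp.coeFn_sub (F i j y - F i j p)
        ((y - p).1 • F (i + 1) j p + (y - p).2 • F i (j + 1) p),
      Lp.coeFn_sub (F i j y) (F i j p),
      Lp.coeFn_add ((y - p).1 • F (i + 1) j p) ((y - p).2 • F i (j + 1) p),
      Lp.coeFn_smul (y - p).1 (F (i + 1) j p), Lp.coeFn_smul (y - p).2 (F i (j + 1) p),
      hFf i j y (hsubΩ hy), hFf i j p hp, hFf (i + 1) j p hp, hFf i (j + 1) p hp]
      with x hx h1x h2x h3x e1 e2 e3 e4 e5 e6 e7 e8 e9 e10 e11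
    rw [e1, e3, Pi.sub_apply, e4, e5, Pi.sub_apply, Pi.add_apply, e6, e7, Pi.smul_apply,
      Pi.smul_apply, Pi.smul_apply, e8, e9, e10, e11, hKL, e2, norm_smul,
      Real.norm_of_nonneg (by positivity : 0 ≤ ‖y - p‖ * ‖y - p‖)]
    have := norm_sub_sub_pairDeriv_le (fun i j p => f i j p x) hx hsubΩ
      (i := i) (j := j) (G := ‖g1 x‖ + ‖g2 x‖ + ‖g3 x‖)
      (fun z hz => ((h1x z (hsub₁ hz)).trans (le_abs_self _)).trans (by
        rw [← Real.norm_eq_abs]; linarith [norm_nonneg (g2 x), norm_nonneg (g3 x)]))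
      (fun z hz => ((h2x z (hsub₁ hz)).trans (le_abs_self _)).trans (by
        rw [← Real.norm_eq_abs]; linarith [norm_nonneg (g1 x), norm_nonneg (g3 x)]))
      (fun z hz => ((h3x z (hsub₁ hz)).trans (le_abs_self _)).trans (by
        rw [← Real.norm_eq_abs]; linarith [norm_nonneg (g2 x), norm_nonneg (g1 x)])) hy
    rw [pairDeriv_apply] at this
    refine this.trans ?_
    have h0 : 0 ≤ G x := by positivity
    rw [Real.norm_of_nonneg h0]
    simp only [G]
    apply le_of_eq
    ring
  rw [hasFDerivAt_iff_isLittleO]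
  refine Asymptotics.IsBigO.trans_isLittleO (g := fun y => ‖y - p‖ * ‖y - p‖) ?_ ?_
  · refine Asymptotics.IsBigO.of_bound ‖KL‖ ?_
    filter_upwards [Metric.ball_mem_nhds p hε] with y hy
    rw [Real.norm_of_nonneg (by positivity), ← mul_assoc]
    exact bound y hy
  · have h0 : Tendsto (fun y : ℝ × ℝ => ‖y - p‖) (𝓝 p) (𝓝 0) := by
      have : Continuous fun y : ℝ × ℝ => ‖y - p‖ := by fun_prop
      simpa using this.tendsto p
    have := (Asymptotics.isLittleO_one_iff ℝ).2 h0
    have h1 := this.mul_isBigO (Asymptotics.isBigO_refl (fun y : ℝ × ℝ => ‖y - p‖) (𝓝 p))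
    simp only [one_mul] at h1
    exact h1.trans_isBigO (Asymptotics.isBigO_norm_left.2 (Asymptotics.isBigO_refl _ _))

end family

/-! ### The parabolic cylinder kernel -/

/-- The admissible parameters. -/
def upperParams : Set (ℝ × ℝ) := {p | 0 < p.2}

lemma isOpen_upperParams : IsOpen upperParams := isOpen_lt continuous_const continuous_snd

/-- The integrand of the parabolic cylinder function and of its parameter derivatives. -/
def cylKernel (i j : ℕ) (p : ℝ × ℝ) (t x : ℝ) : ℝ :=
  (-(t + 2 * x)) ^ i * (Real.log x) ^ j *
    Real.exp (-t ^ 2 / 2 - t * p.1 - 2 * (t + p.1) * x - x ^ 2 + (p.2 - 1) * Real.log x)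

/-- The exponent is affine in the parameters with slopes -(t + 2x) and log x, so powers of these two
factors already close the family. -/
lemma hasFDerivAt_cylKernel (i j : ℕ) (p : ℝ × ℝ) (t x : ℝ) :
    HasFDerivAt (fun p => cylKernel i j p t x)
      (pairDeriv (cylKernel (i + 1) j p t x) (cylKernel i (j + 1) p t x)) p := by
  have h1 : HasFDerivAt (fun p : ℝ × ℝ => p.1) (ContinuousLinearMap.fst ℝ ℝ ℝ) p := hasFDerivAt_fst
  have h2 : HasFDerivAt (fun p : ℝ × ℝ => p.2) (ContinuousLinearMap.snd ℝ ℝ ℝ) p := hasFDerivAt_snd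
  have h3 : HasFDerivAt (fun p : ℝ × ℝ => -t ^ 2 / 2 - t * p.1 - 2 * (t + p.1) * x - x ^ 2 +
      (p.2 - 1) * Real.log x) (pairDeriv (-(t + 2 * x)) (Real.log x)) p := by
    have := (((((h1.const_mul t).const_sub (-t ^ 2 / 2)).sub
      (((h1.const_add t).const_mul 2).mul_const x)).sub_const (x ^ 2)).add
        ((h2.sub_const 1).mul_const (Real.log x)))
    refine this.congr_fderiv ?_
    ext <;> simp [pairDeriv_apply] <;> ring
  refine ((h3.exp).const_mul ((-(t + 2 * x)) ^ i * (Real.log x) ^ j)).congr_fderiv ?_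
  ext <;> simp [pairDeriv_apply, cylKernel] <;> ring

lemma measurable_cylKernel (i j : ℕ) (p : ℝ × ℝ) :
    Measurable (fun z : ℝ × ℝ => cylKernel i j p z.1 z.2) := by
  unfold cylKernel
  fun_prop

/-- The dominating function of the kernels. -/
def cylDom (lo hi x : ℝ) : ℝ := Real.exp (-x) * x ^ (lo - 1) + Real.exp (-x) * x ^ (hi - 1)

lemma integrableOn_cylDom {lo hi : ℝ} (hlo : 0 < lo) (hhi : 0 < hi) :
    IntegrableOn (cylDom lo hi) (Ioi 0) :=
  (Real.GammaIntegral_convergent hlo).add (Real.GammaIntegral_convergent hhi)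

lemma exp_mul_log_le {lo hi c x : ℝ} (h1 : lo ≤ c) (h2 : c ≤ hi) (hx : 0 < x) :
    Real.exp (c * Real.log x) ≤ x ^ lo + x ^ hi := by
  rw [Real.rpow_def_of_pos hx, Real.rpow_def_of_pos hx]
  rcases le_total 0 (Real.log x) with h | h
  · have : Real.exp (c * Real.log x) ≤ Real.exp (Real.log x * hi) := Real.exp_le_exp.2 (by nlinarith)
    linarith [Real.exp_pos (Real.log x * lo)]
  · have : Real.exp (c * Real.log x) ≤ Real.exp (Real.log x * lo) := Real.exp_le_exp.2 (by nlinarith)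
    linarith [Real.exp_pos (Real.log x * hi)]

lemma pow_le_factorial_mul_exp {δ y : ℝ} (hδ : 0 < δ) (hy : 0 ≤ y) (n : ℕ) :
    y ^ n ≤ n.factorial / δ ^ n * Real.exp (δ * y) := by
  have h := Real.pow_div_factorial_le_exp (δ * y) (by positivity) n
  rw [mul_pow, div_le_iff₀ (by positivity)] at h
  rw [div_mul_eq_mul_div, le_div_iff₀ (by positivity)]
  linarith

/-- The powers are absorbed into exponentials: (t + 2x)^i into exp(t + 2x), beaten by the Gaussian,
and |log x|^j into exp(a/4 · |log x|). On the chosen ball the second parameter is at least a/2, so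
after this loss of a/4 the exponent `lo = a / 4` is still positive and the bound integrable at 0. -/
theorem abs_cylKernel_le {p : ℝ × ℝ} (hp : p ∈ upperParams) :
    ∃ ε > 0, ∃ lo > 0, ∃ hi > 0, Metric.ball p ε ⊆ upperParams ∧ ∀ i j : ℕ, ∃ K : ℝ, ∀ t x : ℝ,
      0 ≤ t → 0 < x → ∀ p' ∈ Metric.ball p ε,
        |cylKernel i j p' t x| ≤ K * Real.exp (-t) * cylDom lo hi x := by
  obtain ⟨s, a⟩ := p
  have ha : 0 < a := hp
  set S := |s| + 1 with hS
  have hball : ∀ p' ∈ Metric.ball (s, a) (min 1 (a / 2)),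
      |p'.1| ≤ S ∧ a / 2 ≤ p'.2 ∧ p'.2 ≤ a + 1 := by
    intro p' hp'
    rw [Metric.mem_ball, Prod.dist_eq, max_lt_iff, lt_min_iff, lt_min_iff, Real.dist_eq,
      Real.dist_eq] at hp'
    obtain ⟨⟨h1, -⟩, h3, h4⟩ := hp'
    refine ⟨?_, by linarith [abs_lt.1 h4], by linarith [abs_lt.1 h3]⟩
    have : |p'.1| ≤ |p'.1 - s| + |s| := by simpa using abs_add_le (p'.1 - s) s
    linarith
  refine ⟨min 1 (a / 2), lt_min one_pos (by positivity), a / 4, by positivity, a + 1 + a / 4,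
    by positivity, fun p' hp' => ?_, fun i j => ?_⟩
  · have := (hball p' hp').2.1
    show 0 < p'.2
    linarith
  -- The exponent of the constant adds the maxima of (S + 2)t - t²/2 and (2S + 3)x - x², which bound
  -- what remains once exp(-t) and exp(-x) are split off.
  refine ⟨i.factorial / 1 ^ i * (j.factorial / (a / 4) ^ j) *
    Real.exp ((S + 2) ^ 2 / 2 + (2 * S + 3) ^ 2 / 4), fun t x ht hx p' hp' => ?_⟩
  obtain ⟨h1, h2, h3⟩ := hball p' hp'
  have e1 : |(-(t + 2 * x)) ^ i| ≤ i.factorial / 1 ^ i * Real.exp (1 * (t + 2 * x)) := by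
    rw [abs_pow, abs_neg, abs_of_nonneg (by positivity)]
    exact pow_le_factorial_mul_exp one_pos (by positivity) i
  have e2 : |Real.log x ^ j| ≤ j.factorial / (a / 4) ^ j * Real.exp (a / 4 * |Real.log x|) := by
    rw [abs_pow]
    exact pow_le_factorial_mul_exp (by positivity) (abs_nonneg _) j
  have e3 : Real.exp (a / 4 * |Real.log x|) * Real.exp ((p'.2 - 1) * Real.log x) ≤
      x ^ (a / 4 - 1) + x ^ (a + 1 + a / 4 - 1) := by
    rw [← Real.exp_add]
    rcases le_total 0 (Real.log x) with h | h
    · rw [abs_of_nonneg h, ← add_mul]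
      exact exp_mul_log_le (by linarith) (by linarith) hx
    · rw [abs_of_nonpos h, show a / 4 * -Real.log x + (p'.2 - 1) * Real.log x =
        (-(a / 4) + (p'.2 - 1)) * Real.log x by ring]
      exact exp_mul_log_le (by linarith) (by linarith) hx
  have e4 : Real.exp (1 * (t + 2 * x)) *
      Real.exp (-t ^ 2 / 2 - t * p'.1 - 2 * (t + p'.1) * x - x ^ 2) ≤
      Real.exp ((S + 2) ^ 2 / 2 + (2 * S + 3) ^ 2 / 4) * Real.exp (-t) * Real.exp (-x) := by
    rw [← Real.exp_add, ← Real.exp_add, ← Real.exp_add, Real.exp_le_exp]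
    have := (abs_le.1 h1).1
    nlinarith [sq_nonneg (t - (S + 2)), sq_nonneg (x - (2 * S + 3) / 2), mul_nonneg ht hx.le,
      mul_nonneg ht (by linarith : 0 ≤ p'.1 + S), mul_nonneg hx.le (by linarith : 0 ≤ p'.1 + S)]
  have e5 : cylKernel i j p' t x = (-(t + 2 * x)) ^ i * Real.log x ^ j *
      (Real.exp (-t ^ 2 / 2 - t * p'.1 - 2 * (t + p'.1) * x - x ^ 2) *
        Real.exp ((p'.2 - 1) * Real.log x)) := by
    rw [cylKernel, Real.exp_add]
  rw [e5, abs_mul, abs_mul, abs_of_pos (by positivity : 0 < Real.exp (-t ^ 2 / 2 - t * p'.1 -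
    2 * (t + p'.1) * x - x ^ 2) * Real.exp ((p'.2 - 1) * Real.log x))]
  calc _ ≤ (i.factorial / 1 ^ i * Real.exp (1 * (t + 2 * x))) *
        (j.factorial / (a / 4) ^ j * Real.exp (a / 4 * |Real.log x|)) *
        (Real.exp (-t ^ 2 / 2 - t * p'.1 - 2 * (t + p'.1) * x - x ^ 2) *
        Real.exp ((p'.2 - 1) * Real.log x)) := by gcongr
    _ = i.factorial / 1 ^ i * (j.factorial / (a / 4) ^ j) *
        ((Real.exp (1 * (t + 2 * x)) *
          Real.exp (-t ^ 2 / 2 - t * p'.1 - 2 * (t + p'.1) * x - x ^ 2)) *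
        (Real.exp (a / 4 * |Real.log x|) * Real.exp ((p'.2 - 1) * Real.log x))) := by ring
    _ ≤ i.factorial / 1 ^ i * (j.factorial / (a / 4) ^ j) *
        ((Real.exp ((S + 2) ^ 2 / 2 + (2 * S + 3) ^ 2 / 4) * Real.exp (-t) * Real.exp (-x)) *
        (x ^ (a / 4 - 1) + x ^ (a + 1 + a / 4 - 1))) := by gcongr
    _ = _ := by rw [cylDom]; ring

/-- The parabolic cylinder function (up to a factor) and its parameter derivatives. -/
def cylFun (i j : ℕ) (p : ℝ × ℝ) (t : ℝ) : ℝ := ∫ x in Ioi (0 : ℝ), cylKernel i j p t x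

lemma integrableOn_cylKernel (i j : ℕ) {p : ℝ × ℝ} (hp : p ∈ upperParams) {t : ℝ} (ht : 0 ≤ t) :
    IntegrableOn (cylKernel i j p t) (Ioi 0) := by
  obtain ⟨ε, hε, lo, hlo, hi, hhi, -, h⟩ := abs_cylKernel_le hp
  obtain ⟨K, hK⟩ := h i j
  refine ((integrableOn_cylDom hlo hhi).const_mul (K * Real.exp (-t))).mono'
    ((measurable_cylKernel i j p).comp (measurable_const.prodMk measurable_id)).aestronglyMeasurable
    ?_
  filter_upwards [ae_restrict_mem measurableSet_Ioi] with x hx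
  exact hK t x ht hx p (Metric.mem_ball_self hε)

/-- Differentiation under the integral sign is the case q = 1 of `exists_Lp_family`, composed with
the integral as a continuous linear functional. -/
theorem hasFDerivAt_cylFun (i j : ℕ) {p : ℝ × ℝ} (hp : p ∈ upperParams) {t : ℝ} (ht : 0 ≤ t) :
    HasFDerivAt (fun p => cylFun i j p t)
      (pairDeriv (cylFun (i + 1) j p t) (cylFun i (j + 1) p t)) p := by
  have : Fact ((1 : ENNReal) ≤ 1) := ⟨le_rfl⟩
  obtain ⟨F, hF, hF'⟩ := exists_Lp_family (q := 1) (μ := volume.restrict (Ioi (0 : ℝ)))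
    isOpen_upperParams (fun i j p x => cylKernel i j p t x)
    (fun i j p _ => ((measurable_cylKernel i j p).comp
      (measurable_const.prodMk measurable_id)).aestronglyMeasurable)
    (Eventually.of_forall fun x i j p _ => hasFDerivAt_cylKernel i j p t x) (by
      intro p hp
      obtain ⟨ε, hε, lo, hlo, hi, hhi, -, h⟩ := abs_cylKernel_le hp
      refine ⟨ε, hε, fun i j => ?_⟩
      obtain ⟨K, hK⟩ := h i j
      refine ⟨fun x => K * Real.exp (-t) * cylDom lo hi x, memLp_one_iff_integrable.2
        ((integrableOn_cylDom hlo hhi).const_mul _), ?_⟩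
      filter_upwards [ae_restrict_mem measurableSet_Ioi] with x hx p' hp'
      exact hK t x ht hx p' hp')
  have key : ∀ i j, ∀ p ∈ upperParams, L1.integralCLM (F i j p) = cylFun i j p t := by
    intro i j p hp
    rw [← L1.integral_eq, L1.integral_eq_integral]
    exact integral_congr_ae (hF i j p hp)
  have h := (L1.integralCLM (E := ℝ) (μ := volume.restrict (Ioi (0 : ℝ)))).hasFDerivAt.comp p
    (hF' i j p hp)
  have h2 : HasFDerivAt (fun p => cylFun i j p t) _ p := h.congr_of_eventuallyEq (by
    filter_upwards [isOpen_upperParams.mem_nhds hp] with p' hp'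
    exact (key i j p' hp').symm)
  refine h2.congr_fderiv ?_
  ext <;> simp [pairDeriv_apply, key _ _ p hp]

/-- A bound that is locally uniform in the parameters and exponentially small in t serves both q = 2
and q = ∞. -/
theorem abs_cylFun_le {p : ℝ × ℝ} (hp : p ∈ upperParams) :
    ∃ ε > 0, Metric.ball p ε ⊆ upperParams ∧ ∀ i j : ℕ, ∃ K : ℝ, ∀ t : ℝ,
      0 ≤ t → ∀ p' ∈ Metric.ball p ε, |cylFun i j p' t| ≤ K * Real.exp (-t) := by
  obtain ⟨ε, hε, lo, hlo, hi, hhi, hsub, h⟩ := abs_cylKernel_le hp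
  refine ⟨ε, hε, hsub, fun i j => ?_⟩
  obtain ⟨K, hK⟩ := h i j
  refine ⟨K * ∫ x in Ioi (0 : ℝ), cylDom lo hi x, fun t ht p' hp' => ?_⟩
  rw [mul_right_comm, ← integral_const_mul, ← Real.norm_eq_abs]
  refine norm_integral_le_of_norm_le ((integrableOn_cylDom hlo hhi).const_mul _) ?_
  filter_upwards [ae_restrict_mem measurableSet_Ioi] with x hx
  exact hK t x ht hx p' hp'

theorem contDiffOn_cylFun (i j : ℕ) {t : ℝ} (ht : 0 ≤ t) :
    ContDiffOn ℝ ((⊤ : ℕ∞) : WithTop ℕ∞) (fun p => cylFun i j p t) upperParams :=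
  contDiffOn_of_family isOpen_upperParams (fun i j p => cylFun i j p t)
    (fun i j _ hp => hasFDerivAt_cylFun i j hp ht) i j

lemma memLp_exp_neg (q : ENNReal) (hq : q = 2 ∨ q = ⊤) :
    MemLp (fun t : ℝ => Real.exp (-t)) q halfLineMeasure := by
  have hm : AEStronglyMeasurable (fun t : ℝ => Real.exp (-t)) halfLineMeasure :=
    (by fun_prop : Continuous fun t : ℝ => Real.exp (-t)).aestronglyMeasurable
  rcases hq with rfl | rfl
  · rw [memLp_two_iff_integrable_sq hm]
    have : (fun t : ℝ => Real.exp (-t) ^ 2) = fun t => Real.exp (-2 * t) := by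
      ext t; rw [← Real.exp_nat_mul]; congr 1; push_cast; ring
    rw [this]
    exact exp_neg_integrableOn_Ioi 0 two_pos
  · refine memLp_top_of_bound hm 1 ?_
    filter_upwards [ae_restrict_mem measurableSet_Ioi] with x hx
    have : (0 : ℝ) < x := hx
    rw [Real.norm_of_nonneg (Real.exp_pos _).le]
    exact Real.exp_le_one_iff.2 (by linarith)

lemma aestronglyMeasurable_cylFun (i j : ℕ) (p : ℝ × ℝ) (μ : Measure ℝ) :
    AEStronglyMeasurable (fun t => cylFun i j p t) μ := by
  have h := (measurable_cylKernel i j p).stronglyMeasurable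
  exact (h.integral_prod_right (ν := volume.restrict (Ioi (0 : ℝ)))).aestronglyMeasurable

/-- The parabolic cylinder functions depend smoothly on the parameters, in `L²` and in `L^∞`. -/
theorem exists_contDiffOn_Lp (q : ENNReal) [Fact (1 ≤ q)] (hq : q = 2 ∨ q = ⊤) :
    ∃ F : ℝ × ℝ → Lp ℂ q halfLineMeasure,
      (∀ p ∈ upperParams, F p =ᵐ[halfLineMeasure] fun t => ((cylFun 0 0 p t : ℝ) : ℂ)) ∧
      ContDiffOn ℝ ((⊤ : ℕ∞) : WithTop ℕ∞) F upperParams := by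
  obtain ⟨F, hF, hF'⟩ := exists_Lp_family (q := q) (μ := halfLineMeasure)
    isOpen_upperParams (fun i j p t => ((cylFun i j p t : ℝ) : ℂ))
    (fun i j p _ => Complex.continuous_ofReal.comp_aestronglyMeasurable
      (aestronglyMeasurable_cylFun i j p _))
    (by
      filter_upwards [ae_restrict_mem measurableSet_Ioi] with t ht i j p hp
      have := Complex.ofRealCLM.hasFDerivAt.comp p (hasFDerivAt_cylFun i j hp (le_of_lt ht))
      refine this.congr_fderiv ?_
      ext <;> simp [pairDeriv_apply])
    (by
      intro p hp
      obtain ⟨ε, hε, -, h⟩ := abs_cylFun_le hp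
      refine ⟨ε, hε, fun i j => ?_⟩
      obtain ⟨K, hK⟩ := h i j
      refine ⟨fun t => K * Real.exp (-t), (memLp_exp_neg q hq).const_mul K, ?_⟩
      filter_upwards [ae_restrict_mem measurableSet_Ioi] with t ht p' hp'
      rw [Complex.norm_real]
      exact hK t (le_of_lt ht) p' hp')
  exact ⟨F 0 0, hF 0 0, contDiffOn_of_family isOpen_upperParams F hF' 0 0⟩

/-! ### The parabolic cylinder function and its logarithmic derivative -/

/-- `cylI s a = ∫₀^∞ exp (-2 s x - x²) x ^ (a - 1) dx`. -/
def cylI (s a : ℝ) : ℝ := cylFun 0 0 (s, a) 0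

/-- The weight in the integral defining `cylI`. -/
def cylW (s a x : ℝ) : ℝ := Real.exp (-2 * s * x - x ^ 2) * x ^ (a - 1)

lemma cylKernel_zero_eq (i j : ℕ) (s a : ℝ) {x : ℝ} (hx : 0 < x) :
    cylKernel i j (s, a) 0 x = (-(2 * x)) ^ i * Real.log x ^ j * cylW s a x := by
  rw [cylKernel, cylW, Real.rpow_def_of_pos hx, ← Real.exp_add]
  congr 2 <;> simp
  ring

lemma cylFun_zero_eq (i j : ℕ) (s a : ℝ) :
    cylFun i j (s, a) 0 = ∫ x in Ioi (0 : ℝ), (-(2 * x)) ^ i * Real.log x ^ j * cylW s a x :=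
  setIntegral_congr_fun measurableSet_Ioi fun _ hx => cylKernel_zero_eq i j s a hx

lemma cylI_eq (s a : ℝ) : cylI s a = ∫ x in Ioi (0 : ℝ), cylW s a x := by
  simp [cylI, cylFun_zero_eq]

lemma integrableOn_cylW_mul (i j : ℕ) (s : ℝ) {a : ℝ} (ha : 0 < a) :
    IntegrableOn (fun x => (-(2 * x)) ^ i * Real.log x ^ j * cylW s a x) (Ioi 0) :=
  (integrableOn_cylKernel i j (p := (s, a)) ha le_rfl).congr_fun
    (fun _ hx => cylKernel_zero_eq i j s a hx) measurableSet_Ioi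

lemma integrableOn_cylW (s : ℝ) {a : ℝ} (ha : 0 < a) : IntegrableOn (cylW s a) (Ioi 0) := by
  simpa using integrableOn_cylW_mul 0 0 s ha

lemma integrableOn_log_mul_cylW (s : ℝ) {a : ℝ} (ha : 0 < a) :
    IntegrableOn (fun x => Real.log x * cylW s a x) (Ioi 0) := by
  simpa using integrableOn_cylW_mul 0 1 s ha

lemma cylW_pos (s a : ℝ) {x : ℝ} (hx : 0 < x) : 0 < cylW s a x :=
  mul_pos (Real.exp_pos _) (Real.rpow_pos_of_pos hx _)

lemma cylW_add_one (s a : ℝ) {x : ℝ} (hx : 0 < x) : cylW s (a + 1) x = x * cylW s a x := by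
  rw [cylW, cylW, show a + 1 - 1 = a - 1 + 1 by ring, Real.rpow_add_one hx.ne']
  ring

lemma cylI_pos (s : ℝ) {a : ℝ} (ha : 0 < a) : 0 < cylI s a := by
  rw [cylI_eq, setIntegral_pos_iff_support_of_nonneg_ae]
  · have : Function.support (cylW s a) ∩ Ioi 0 = Ioi 0 :=
      inter_eq_right.2 fun x hx => (cylW_pos s a hx).ne'
    rw [this]; simp
  · filter_upwards [ae_restrict_mem measurableSet_Ioi] with x hx using (cylW_pos s a hx).le
  · exact integrableOn_cylW s ha

lemma cylFun_one_zero (s a : ℝ) : cylFun 1 0 (s, a) 0 = -2 * cylI s (a + 1) := by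
  rw [cylFun_zero_eq, cylI_eq, ← integral_const_mul]
  refine setIntegral_congr_fun measurableSet_Ioi fun x hx => ?_
  simp only [cylW_add_one s a hx]
  ring

lemma hasDerivAt_cylI_left (s : ℝ) {a : ℝ} (ha : 0 < a) :
    HasDerivAt (fun s => cylI s a) (-2 * cylI s (a + 1)) s := by
  have h := hasFDerivAt_cylFun 0 0 (p := (s, a)) ha le_rfl
  have h2 : HasDerivAt (fun s : ℝ => (s, a)) ((1 : ℝ), (0 : ℝ)) s :=
    (hasDerivAt_id s).prodMk (hasDerivAt_const s a)
  refine (h.comp_hasDerivAt s h2).congr_deriv ?_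
  simp [pairDeriv_apply, cylFun_one_zero]

lemma hasDerivAt_cylI_right (s : ℝ) {a : ℝ} (ha : 0 < a) :
    HasDerivAt (fun a => cylI s a) (∫ x in Ioi (0 : ℝ), Real.log x * cylW s a x) a := by
  have h := hasFDerivAt_cylFun 0 0 (p := (s, a)) ha le_rfl
  have h2 : HasDerivAt (fun a : ℝ => (s, a)) ((0 : ℝ), (1 : ℝ)) a :=
    (hasDerivAt_const a s).prodMk (hasDerivAt_id a)
  refine (h.comp_hasDerivAt a h2).congr_deriv ?_
  simp [pairDeriv_apply, cylFun_zero_eq]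

lemma contDiffOn_cylI :
    ContDiffOn ℝ ((⊤ : ℕ∞) : WithTop ℕ∞) (fun p : ℝ × ℝ => cylI p.1 p.2) upperParams :=
  contDiffOn_cylFun 0 0 le_rfl

lemma continuous_cylI_left {a : ℝ} (ha : 0 < a) : Continuous fun s => cylI s a :=
  continuous_iff_continuousAt.2 fun s => (hasDerivAt_cylI_left s ha).continuousAt

/-- Integrate the derivative of exp(-2sx - x²) x^a over the half-line. The boundary term 0^a is 1 at
a = 0 and vanishes otherwise; the case a = 0 later starts the continuation to a ≤ 0. -/
theorem cylI_recurrence (s : ℝ) {a : ℝ} (ha : 0 ≤ a) :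
    a * cylI s a + 0 ^ a = 2 * s * cylI s (a + 1) + 2 * cylI s (a + 2) := by
  set f : ℝ → ℝ := fun x => Real.exp (-2 * s * x - x ^ 2) * x ^ a with hf
  set f' : ℝ → ℝ := fun x => a * cylW s a x - 2 * s * cylW s (a + 1) x - 2 * cylW s (a + 2) x
    with hf'
  have hfW : f = cylW s (a + 1) := by ext x; simp [hf, cylW]
  have hd : ∀ x ∈ Ioi (0 : ℝ), HasDerivAt f (f' x) x := by
    intro x hx
    have h1 : HasDerivAt (fun x : ℝ => -2 * s * x - x ^ 2) (-2 * s - 2 * x) x :=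
      (((hasDerivAt_id x).const_mul (-2 * s)).sub (hasDerivAt_pow 2 x)).congr_deriv (by simp)
    have h2 := h1.exp.mul (Real.hasDerivAt_rpow_const (p := a) (Or.inl (ne_of_gt hx)))
    refine h2.congr_deriv ?_
    have e1 : cylW s (a + 1) x = Real.exp (-2 * s * x - x ^ 2) * x ^ a := by simp [cylW]
    simp only [hf']
    rw [show a + 2 = a + 1 + 1 by ring, cylW_add_one s (a + 1) hx, e1, cylW]
    ring
  -- For a = 0 the weight is not integrable at 0, but its coefficient vanishes.
  have i0 : IntegrableOn (fun x => a * cylW s a x) (Ioi 0) := by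
    rcases ha.eq_or_lt with rfl | h
    · simp
    · exact (integrableOn_cylW s h).const_mul a
  have i1 := (integrableOn_cylW s (by linarith : 0 < a + 1)).const_mul (2 * s)
  have i2 := (integrableOn_cylW s (by linarith : 0 < a + 2)).const_mul 2
  have i01 : IntegrableOn (fun x => a * cylW s a x - 2 * s * cylW s (a + 1) x) (Ioi 0) := i0.sub i1
  have hint : IntegrableOn f' (Ioi 0) := i01.sub i2
  have htend : Tendsto f atTop (𝓝 0) :=
    tendsto_zero_of_hasDerivAt_of_integrableOn_Ioi hd hint
      (hfW ▸ integrableOn_cylW s (by linarith))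
  have hcont : ContinuousWithinAt f (Ici 0) 0 := by
    refine ContinuousAt.continuousWithinAt ?_
    refine ContinuousAt.mul (by fun_prop) ?_
    exact Real.continuousAt_rpow_const _ _ (Or.inr ha)
  have := integral_Ioi_of_hasDerivAt_of_tendsto hcont hd hint htend
  simp only [hf'] at this
  rw [integral_sub i01 i2, integral_sub i0 i1, integral_const_mul, integral_const_mul,
    integral_const_mul, ← cylI_eq, ← cylI_eq, ← cylI_eq] at this
  simp [hf] at this
  linarith

lemma cylI_recurrence_of_pos (s : ℝ) {a : ℝ} (ha : 0 < a) :
    a * cylI s a = 2 * s * cylI s (a + 1) + 2 * cylI s (a + 2) := by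
  simpa [Real.zero_rpow ha.ne'] using cylI_recurrence s ha.le

lemma cylI_recurrence_zero (s : ℝ) : 2 * s * cylI s 1 + 2 * cylI s 2 = 1 := by
  simpa using (cylI_recurrence s le_rfl).symm

/-- Cauchy–Schwarz for the moments of the weight: integrate the square of I(s, a) x - I(s, a + 1).
-/
lemma cylI_sq_le (s : ℝ) {a : ℝ} (ha : 0 < a) :
    cylI s (a + 1) ^ 2 ≤ cylI s a * cylI s (a + 2) := by
  have h0 := cylI_pos s ha
  have hnn : 0 ≤ ∫ x in Ioi (0 : ℝ), (cylI s a * cylI s a * cylW s (a + 2) x -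
      2 * cylI s a * cylI s (a + 1) * cylW s (a + 1) x +
      cylI s (a + 1) ^ 2 * cylW s a x) := by
    refine setIntegral_nonneg measurableSet_Ioi fun x hx => ?_
    rw [show a + 2 = a + 1 + 1 by ring, cylW_add_one s (a + 1) hx, cylW_add_one s a hx]
    have := mul_nonneg (sq_nonneg (cylI s a * x - cylI s (a + 1))) (cylW_pos s a hx).le
    linarith
  have i0 := (integrableOn_cylW s ha).const_mul (cylI s (a + 1) ^ 2)
  have i1 := (integrableOn_cylW s (by linarith : 0 < a + 1)).const_mul
    (2 * cylI s a * cylI s (a + 1))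
  have i2 := (integrableOn_cylW s (by linarith : 0 < a + 2)).const_mul (cylI s a * cylI s a)
  have i21 : IntegrableOn (fun x => cylI s a * cylI s a * cylW s (a + 2) x -
      2 * cylI s a * cylI s (a + 1) * cylW s (a + 1) x) (Ioi 0) := i2.sub i1
  rw [integral_add i21 i0, integral_sub i2 i1, integral_const_mul, integral_const_mul,
    integral_const_mul, ← cylI_eq, ← cylI_eq, ← cylI_eq] at hnn
  have : 0 ≤ cylI s a * (cylI s a * cylI s (a + 2) - cylI s (a + 1) ^ 2) := by linarith
  linarith [nonneg_of_mul_nonneg_right this h0]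

/-- The quotient `cylI s (a + 1) / cylI s a`. -/
def cylQ (s a : ℝ) : ℝ := cylI s (a + 1) / cylI s a

/-- The logarithmic derivative of the parabolic cylinder function `exp (-s² / 2) * cylI s a`. -/
def cylR (s a : ℝ) : ℝ := -s - 2 * cylQ s a

/-- The derivative of `cylR` in the first variable. -/
def cylD (s a : ℝ) : ℝ := s ^ 2 + 2 * a - 1 - cylR s a ^ 2

lemma cylQ_pos (s : ℝ) {a : ℝ} (ha : 0 < a) : 0 < cylQ s a :=
  div_pos (cylI_pos s (by linarith)) (cylI_pos s ha)

/-- The recurrence eliminates I(s, a + 2) from the quotient rule and leaves a Riccati equation. -/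
lemma hasDerivAt_cylQ_left (s : ℝ) {a : ℝ} (ha : 0 < a) :
    HasDerivAt (fun s => cylQ s a) (-a + 2 * s * cylQ s a + 2 * cylQ s a ^ 2) s := by
  have h := (hasDerivAt_cylI_left s (by linarith : 0 < a + 1)).div (hasDerivAt_cylI_left s ha)
    (cylI_pos s ha).ne'
  refine h.congr_deriv ?_
  have h1 := cylI_recurrence_of_pos s ha
  have h2 : cylI s (a + 1 + 1) = (a * cylI s a - 2 * s * cylI s (a + 1)) / 2 := by
    rw [show a + 1 + 1 = a + 2 by ring]; linarith
  have h0 := (cylI_pos s ha).ne'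
  rw [h2, cylQ]
  field_simp
  ring

/-- `cylQ` is the mean of x under the normalized weight, and its s-derivative is minus twice the
variance. -/
lemma cylQ_antitone {a : ℝ} (ha : 0 < a) : Antitone fun s => cylQ s a := by
  refine antitone_of_deriv_nonpos (fun s => (hasDerivAt_cylQ_left s ha).differentiableAt) fun s => ?_
  rw [(hasDerivAt_cylQ_left s ha).deriv]
  have h1 := cylI_recurrence_of_pos s ha
  have h2 := cylI_sq_le s ha
  have h0 := cylI_pos s ha
  have h3 : cylQ s a * cylI s a = cylI s (a + 1) := div_mul_cancel₀ _ h0.ne'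
  rw [← h3] at h1 h2
  have h4 : cylI s (a + 2) = cylI s a * (a - 2 * s * cylQ s a) / 2 := by linarith
  rw [h4] at h2
  have h5 : cylI s a ^ 2 * (-a + 2 * s * cylQ s a + 2 * cylQ s a ^ 2) ≤ 0 := by nlinarith
  exact nonpos_of_mul_nonpos_right h5 (by positivity)

lemma hasDerivAt_cylR_left (s : ℝ) {a : ℝ} (ha : 0 < a) :
    HasDerivAt (fun s => cylR s a) (cylD s a) s := by
  refine (((hasDerivAt_id s).neg).sub ((hasDerivAt_cylQ_left s ha).const_mul 2)).congr_deriv ?_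
  rw [cylD, cylR]
  ring

/-- Chebyshev's correlation argument: ∂ₐ`cylQ` is the covariance of x and log x. Subtracting log m,
with m the mean of x, does not change it, and then the integrand (x - m)(log x - log m) is
nonnegative because both factors have the same sign. -/
theorem exists_hasDerivAt_cylR_right (s : ℝ) {a : ℝ} (ha : 0 < a) :
    ∃ c < 0, HasDerivAt (fun a => cylR s a) c a := by
  have ha1 : 0 < a + 1 := by linarith
  have h0 := cylI_pos s ha
  set m := cylQ s a with hm
  have hmpos : 0 < m := cylQ_pos s ha
  have hmI : m * cylI s a = cylI s (a + 1) := div_mul_cancel₀ _ h0.ne'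
  set l1 := ∫ x in Ioi (0 : ℝ), Real.log x * cylW s (a + 1) x with hl1
  set l0 := ∫ x in Ioi (0 : ℝ), Real.log x * cylW s a x with hl0
  have hW : ∀ x : ℝ, 0 < x → (x - m) * (Real.log x - Real.log m) * cylW s a x =
      (Real.log x * cylW s (a + 1) x - m * (Real.log x * cylW s a x)) -
        (Real.log m * cylW s (a + 1) x - Real.log m * m * cylW s a x) := by
    intro x hx
    rw [cylW_add_one s a hx]; ring
  have i1 := integrableOn_log_mul_cylW s ha1
  have i2 := (integrableOn_log_mul_cylW s ha).const_mul m
  have i3 := (integrableOn_cylW s ha1).const_mul (Real.log m)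
  have i4 := (integrableOn_cylW s ha).const_mul (Real.log m * m)
  have hpos : 0 < ∫ x in Ioi (0 : ℝ), (x - m) * (Real.log x - Real.log m) * cylW s a x := by
    rw [setIntegral_pos_iff_support_of_nonneg_ae]
    · have : Ioi m ⊆ Function.support (fun x => (x - m) * (Real.log x - Real.log m) * cylW s a x)
          ∩ Ioi 0 := by
        intro x hx
        have hx0 : 0 < x := hmpos.trans hx
        refine ⟨?_, hx0⟩
        have h1 : 0 < x - m := sub_pos.2 hx
        have h2 : 0 < Real.log x - Real.log m := sub_pos.2 (Real.log_lt_log hmpos hx)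
        exact (mul_pos (mul_pos h1 h2) (cylW_pos s a hx0)).ne'
      exact lt_of_lt_of_le (by simp) (measure_mono this)
    · filter_upwards [ae_restrict_mem measurableSet_Ioi] with x hx
      refine mul_nonneg ?_ (cylW_pos s a hx).le
      rcases le_total x m with h | h
      · exact mul_nonneg_of_nonpos_of_nonpos (sub_nonpos.2 h)
          (sub_nonpos.2 (Real.log_le_log hx h))
      · exact mul_nonneg (sub_nonneg.2 h) (sub_nonneg.2 (Real.log_le_log hmpos h))
    · exact ((i1.sub i2).sub (i3.sub i4)).congr_fun (fun x hx => (hW x hx).symm) measurableSet_Ioi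
  have i12 : IntegrableOn (fun x => Real.log x * cylW s (a + 1) x - m * (Real.log x * cylW s a x))
      (Ioi 0) := i1.sub i2
  have i34 : IntegrableOn (fun x => Real.log m * cylW s (a + 1) x - Real.log m * m * cylW s a x)
      (Ioi 0) := i3.sub i4
  rw [setIntegral_congr_fun measurableSet_Ioi fun x hx => hW x hx,
    integral_sub i12 i34, integral_sub i1 i2, integral_sub i3 i4,
    integral_const_mul, integral_const_mul, integral_const_mul, ← cylI_eq, ← cylI_eq, ← hmI] at hpos
  have hpos' : 0 < l1 - m * l0 := by linarith
  have hd1 : HasDerivAt (fun a => cylI s (a + 1)) l1 a := by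
    simpa using (hasDerivAt_cylI_right s ha1).comp_add_const a 1
  have hd := ((hd1.div (hasDerivAt_cylI_right s ha) h0.ne').const_mul 2).const_sub (-s)
  refine ⟨_, ?_, hd⟩
  rw [neg_lt_zero, ← hmI, show l1 * cylI s a - m * cylI s a * l0 = (l1 - m * l0) * cylI s a by ring]
  positivity

lemma cylR_strictAnti (s : ℝ) : StrictAntiOn (fun a => cylR s a) (Ioi 0) := by
  refine strictAntiOn_of_deriv_neg (convex_Ioi 0) (fun a ha => ?_) fun a ha => ?_
  · obtain ⟨c, -, h⟩ := exists_hasDerivAt_cylR_right s ha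
    exact h.continuousAt.continuousWithinAt
  · rw [interior_Ioi] at ha
    obtain ⟨c, hc, h⟩ := exists_hasDerivAt_cylR_right s ha
    rwa [h.deriv]

lemma contDiffOn_cylR :
    ContDiffOn ℝ ((⊤ : ℕ∞) : WithTop ℕ∞) (fun p : ℝ × ℝ => cylR p.1 p.2) upperParams := by
  have h1 : ContDiffOn ℝ ((⊤ : ℕ∞) : WithTop ℕ∞) (fun p : ℝ × ℝ => cylI p.1 (p.2 + 1))
      upperParams := by
    refine contDiffOn_cylI.comp (f := fun p : ℝ × ℝ => (p.1, p.2 + 1)) (by fun_prop) ?_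
    intro p hp
    have : 0 < p.2 := hp
    show 0 < p.2 + 1
    linarith
  unfold cylR cylQ
  exact (contDiff_fst.neg.contDiffOn).sub (contDiffOn_const.mul
    (h1.div contDiffOn_cylI fun p hp => (cylI_pos _ hp).ne'))

/-- As a → 0⁺ the quotient `cylQ` tends to 0, so R tends to -s. The recurrence exhibits this limit:
it replaces the singular I(s, a) by a denominator which is continuous at a = 0 with value 1. -/
lemma exists_lt_cylR (s : ℝ) {c : ℝ} (hc : c < -s) : ∃ a > 0, c < cylR s a := by
  have hcont : ContinuousAt (fun a : ℝ => cylI s (a + 1)) 0 := by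
    have := (hasDerivAt_cylI_right s (a := 0 + 1) (by norm_num)).comp_add_const 0 1
    exact this.continuousAt
  have hcont2 : ContinuousAt (fun a : ℝ => cylI s (a + 2)) 0 := by
    have := (hasDerivAt_cylI_right s (a := 0 + 2) (by norm_num)).comp_add_const 0 2
    exact this.continuousAt
  have h1 : ContinuousAt (fun a : ℝ => a * cylI s (a + 1) /
      (2 * s * cylI s (a + 1) + 2 * cylI s (a + 2))) 0 := by
    refine (continuousAt_id.mul hcont).div ((hcont.const_mul _).add (hcont2.const_mul _)) ?_
    have := cylI_recurrence_zero s
    simp only [zero_add]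
    rw [this]; norm_num
  have h2 : Tendsto (fun a : ℝ => -s - 2 * (a * cylI s (a + 1) /
      (2 * s * cylI s (a + 1) + 2 * cylI s (a + 2)))) (𝓝[>] 0) (𝓝 (-s)) := by
    have := ((h1.tendsto.const_mul 2).const_sub (-s)).mono_left (nhdsWithin_le_nhds (s := Ioi 0))
    simpa using this
  obtain ⟨a, ha, ha0⟩ := ((h2.eventually (lt_mem_nhds hc)).and self_mem_nhdsWithin).exists
  refine ⟨a, ha0, ?_⟩
  have ha0' : 0 < a := ha0
  rw [← cylI_recurrence_of_pos s ha0', mul_div_mul_left _ _ ha0'.ne'] at ha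
  exact ha

/-! ### Critical points of the logarithmic derivative -/

/-- A positive multiple of `cylD` with a derivative of constant sign on each half-line. -/
def cylE (s a : ℝ) : ℝ := cylD s a * (Real.exp (-s ^ 2) * cylI s a ^ 2)

lemma cylE_weight_pos (s : ℝ) {a : ℝ} (ha : 0 < a) : 0 < Real.exp (-s ^ 2) * cylI s a ^ 2 := by
  have := cylI_pos s ha
  positivity

lemma hasDerivAt_cylD_left (s : ℝ) {a : ℝ} (ha : 0 < a) :
    HasDerivAt (fun s => cylD s a) (2 * s - 2 * cylR s a * cylD s a) s := by
  have h := (((hasDerivAt_pow 2 s).add_const (2 * a)).sub_const 1).sub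
    ((hasDerivAt_cylR_left s ha).pow 2)
  exact h.congr_deriv (by push_cast; ring)

/-- Differentiating the Riccati equation gives D' = 2s - 2RD, for which the square of the cylinder
function is an integrating factor. -/
lemma hasDerivAt_cylE (s : ℝ) {a : ℝ} (ha : 0 < a) :
    HasDerivAt (fun s => cylE s a) (2 * s * (Real.exp (-s ^ 2) * cylI s a ^ 2)) s := by
  have h1 : HasDerivAt (fun s : ℝ => Real.exp (-s ^ 2)) (Real.exp (-s ^ 2) * -(2 * s)) s :=
    ((hasDerivAt_pow 2 s).neg.exp).congr_deriv (by simp)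
  have h2 := (hasDerivAt_cylI_left s ha).pow 2
  refine ((hasDerivAt_cylD_left s ha).mul (h1.mul h2)).congr_deriv ?_
  have h3 : cylI s (a + 1) = cylQ s a * cylI s a := (div_mul_cancel₀ _ (cylI_pos s ha).ne').symm
  rw [h3]
  simp only [Pi.mul_apply, Pi.pow_apply, cylR]
  push_cast
  ring

lemma cylE_strictMonoOn {a : ℝ} (ha : 0 < a) : StrictMonoOn (fun s => cylE s a) (Ici 0) := by
  refine strictMonoOn_of_deriv_pos (convex_Ici 0)
    (fun s _ => (hasDerivAt_cylE s ha).continuousAt.continuousWithinAt) fun s hs => ?_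
  rw [interior_Ici] at hs
  rw [(hasDerivAt_cylE s ha).deriv]
  exact mul_pos (mul_pos two_pos hs) (cylE_weight_pos s ha)

lemma cylE_strictAntiOn {a : ℝ} (ha : 0 < a) : StrictAntiOn (fun s => cylE s a) (Iic 0) := by
  refine strictAntiOn_of_deriv_neg (convex_Iic 0)
    (fun s _ => (hasDerivAt_cylE s ha).continuousAt.continuousWithinAt) fun s hs => ?_
  rw [interior_Iic] at hs
  rw [(hasDerivAt_cylE s ha).deriv]
  exact mul_neg_of_neg_of_pos (mul_neg_of_pos_of_neg two_pos hs) (cylE_weight_pos s ha)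

lemma cylR_lt_neg (s : ℝ) {a : ℝ} (ha : 0 < a) : cylR s a < -s := by
  have := cylQ_pos s ha
  rw [cylR]; linarith

/-- If D were nonnegative at some s ≥ 0, the growth of `cylE` would keep it so to the right and R
would never fall below R(s, a). This contradicts R(x, a) < -x at x = max(s, -R(s, a)). -/
theorem cylD_neg_of_nonneg {s a : ℝ} (ha : 0 < a) (hs : 0 ≤ s) : cylD s a < 0 := by
  by_contra! hD
  have hE : 0 ≤ cylE s a := mul_nonneg hD (cylE_weight_pos s ha).le
  have hmono : MonotoneOn (fun s => cylR s a) (Ici s) := by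
    refine monotoneOn_of_deriv_nonneg (convex_Ici s)
      (fun x _ => (hasDerivAt_cylR_left x ha).continuousAt.continuousWithinAt)
      (fun x _ => (hasDerivAt_cylR_left x ha).differentiableAt.differentiableWithinAt) fun x hx => ?_
    rw [interior_Ici] at hx
    rw [(hasDerivAt_cylR_left x ha).deriv]
    have hx' : s < x := hx
    have h1 : cylE s a < cylE x a := cylE_strictMonoOn ha hs (hs.trans hx'.le) hx'
    exact (pos_of_mul_pos_left (hE.trans_lt h1) (cylE_weight_pos x ha).le).le
  have h1 := hmono (mem_Ici.2 le_rfl) (mem_Ici.2 (le_max_left s (-cylR s a)))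
    (le_max_left s (-cylR s a))
  have h2 := cylR_lt_neg (max s (-cylR s a)) ha
  have h3 := le_max_right s (-cylR s a)
  simp only at h1
  linarith

/-- Otherwise D < 0 everywhere and R is antitone. With q = `cylQ 0 a`, monotonicity of R and of
`cylQ` confines R(-σ, a) to [-2q, σ - 2q], so that D(-σ) ≥ 4qσ - 4q² + 2a - 1, which is positive for
large σ. -/
theorem exists_cylD_eq_zero {a : ℝ} (ha : 0 < a) : ∃ s, cylD s a = 0 := by
  by_contra! hne
  have hcont : Continuous fun s => cylD s a :=
    continuous_iff_continuousAt.2 fun s => (hasDerivAt_cylD_left s ha).continuousAt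
  have hneg : ∀ s, cylD s a < 0 := by
    intro s
    by_contra! h
    obtain ⟨x, -, hx⟩ := isPreconnected_univ.intermediate_value (mem_univ (0 : ℝ)) (mem_univ s)
      hcont.continuousOn ⟨(cylD_neg_of_nonneg ha le_rfl).le, h⟩
    exact hne x hx
  have hanti : Antitone fun s => cylR s a := by
    refine antitone_of_deriv_nonpos (fun x => (hasDerivAt_cylR_left x ha).differentiableAt)
      fun x => ?_
    rw [(hasDerivAt_cylR_left x ha).deriv]
    exact (hneg x).le
  set q := cylQ 0 a with hq
  have hqpos : 0 < q := cylQ_pos 0 ha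
  -- Large enough for 4qσ > 4q² + 1, and for σ ≥ 4q, so that -2q lies above -(σ - 2q).
  set σ := 4 * q + 2 + (4 * q ^ 2 + 1) / (4 * q) with hσ
  have hσ1 : 4 * q * σ = 16 * q ^ 2 + 8 * q + (4 * q ^ 2 + 1) := by rw [hσ]; field_simp; ring
  have hσ2 : 4 * q + 2 ≤ σ := by
    have : 0 ≤ (4 * q ^ 2 + 1) / (4 * q) := by positivity
    linarith
  have h1 : cylR 0 a ≤ cylR (-σ) a := hanti (by linarith)
  have h2 : q ≤ cylQ (-σ) a := cylQ_antitone ha (by linarith)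
  have h3 := hneg (-σ)
  have h4 : cylR 0 a = -2 * q := by rw [cylR]; ring
  have h5 : cylR (-σ) a ≤ σ - 2 * q := by rw [cylR]; linarith
  rw [h4] at h1
  rw [cylD] at h3
  have h6 : (cylR (-σ) a) ^ 2 ≤ (σ - 2 * q) ^ 2 := sq_le_sq' (by linarith) h5
  nlinarith

lemma lt_zero_of_cylD_eq_zero {s a : ℝ} (ha : 0 < a) (h : cylD s a = 0) : s < 0 := by
  by_contra! hs
  exact (cylD_neg_of_nonneg ha hs).ne h

/-- Since s < 0 and `cylE` decreases strictly on (-∞, 0], D is positive to the left of s and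
negative between s and 0; on [0, ∞) it is negative by `cylD_neg_of_nonneg`. -/
theorem cylR_lt_of_ne {s a x : ℝ} (ha : 0 < a) (h : cylD s a = 0) (hx : x ≠ s) :
    cylR x a < cylR s a := by
  have hs := lt_zero_of_cylD_eq_zero ha h
  have hE : cylE s a = 0 := by rw [cylE, h, zero_mul]
  rcases hx.lt_or_gt with hlt | hlt
  · have : StrictMonoOn (fun s => cylR s a) (Iic s) := by
      refine strictMonoOn_of_deriv_pos (convex_Iic s)
        (fun x _ => (hasDerivAt_cylR_left x ha).continuousAt.continuousWithinAt) fun y hy => ?_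
      rw [interior_Iic] at hy
      have hy' : y < s := hy
      rw [(hasDerivAt_cylR_left y ha).deriv]
      have h1 : cylE s a < cylE y a := cylE_strictAntiOn ha (hy'.le.trans hs.le) hs.le hy'
      exact pos_of_mul_pos_left (hE ▸ h1) (cylE_weight_pos y ha).le
    exact this (mem_Iic.2 hlt.le) (mem_Iic.2 le_rfl) hlt
  · have : StrictAntiOn (fun s => cylR s a) (Ici s) := by
      refine strictAntiOn_of_deriv_neg (convex_Ici s)
        (fun x _ => (hasDerivAt_cylR_left x ha).continuousAt.continuousWithinAt) fun y hy => ?_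
      rw [interior_Ici] at hy
      have hy' : s < y := hy
      rw [(hasDerivAt_cylR_left y ha).deriv]
      rcases le_total 0 y with h0 | h0
      · exact cylD_neg_of_nonneg ha h0
      · have h1 : cylE y a < cylE s a := cylE_strictAntiOn ha hs.le h0 hy'
        rw [hE] at h1
        by_contra! h2
        exact absurd (mul_nonneg h2 (cylE_weight_pos y ha).le) (not_le.2 h1)
    exact this (mem_Ici.2 le_rfl) (mem_Ici.2 hlt.le) hlt

lemma cylR_le_of_cylD_eq_zero {s a : ℝ} (ha : 0 < a) (h : cylD s a = 0) (x : ℝ) :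
    cylR x a ≤ cylR s a := by
  rcases eq_or_ne x s with rfl | hx
  · exact le_rfl
  · exact (cylR_lt_of_ne ha h hx).le

/-! ### Existence, uniqueness and smoothness of the critical pair -/

/-- `(s, a)` is the parameter pair of the bottom of the spectrum for the Robin parameter `γ`. -/
structure IsCrit (γ s a : ℝ) : Prop where
  pos : 0 < a
  robin : cylR s a = γ
  crit : cylD s a = 0

/-- R(s', a') < R(s', a) ≤ R(s, a): monotonicity in a, then maximality of the critical value. -/
lemma IsCrit.lt {γ γ' s s' a a' : ℝ} (h : IsCrit γ s a) (h' : IsCrit γ' s' a') (hlt : a < a') :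
    γ' < γ := by
  rw [← h.robin, ← h'.robin]
  exact (cylR_strictAnti s' h.pos h'.pos hlt).trans_le (cylR_le_of_cylD_eq_zero h.pos h.crit s')

lemma IsCrit.unique {γ s s' a a' : ℝ} (h : IsCrit γ s a) (h' : IsCrit γ s' a') :
    s = s' ∧ a = a' := by
  have ha : a = a' := by
    rcases lt_trichotomy a a' with hlt | heq | hlt
    · exact absurd (h.lt h' hlt) (lt_irrefl _)
    · exact heq
    · exact absurd (h'.lt h hlt) (lt_irrefl _)
  subst ha
  refine ⟨?_, rfl⟩
  by_contra hne
  have := cylR_lt_of_ne h'.pos h'.crit hne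
  rw [h.robin, h'.robin] at this
  exact lt_irrefl _ this

theorem IsCrit.exists_local_inverse {γ₀ s₀ a₀ : ℝ} (h : IsCrit γ₀ s₀ a₀) :
    ∃ f : ℝ → ℝ × ℝ, ContDiffAt ℝ ((⊤ : ℕ∞) : WithTop ℕ∞) f γ₀ ∧
      ∀ᶠ γ in 𝓝 γ₀, IsCrit γ (f γ).1 (f γ).2 := by
  have ha := h.pos
  have hs := lt_zero_of_cylD_eq_zero ha h.crit
  have hmem : upperParams ∈ 𝓝 (s₀, a₀) := isOpen_upperParams.mem_nhds (show 0 < a₀ from ha)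
  have hR : ContDiffAt ℝ ((⊤ : ℕ∞) : WithTop ℕ∞) (fun p : ℝ × ℝ => cylR p.1 p.2) (s₀, a₀) :=
    contDiffOn_cylR.contDiffAt hmem
  obtain ⟨c, hc, hcd⟩ := exists_hasDerivAt_cylR_right s₀ ha
  have hRd : HasFDerivAt (fun p : ℝ × ℝ => cylR p.1 p.2) (pairDeriv 0 c) (s₀, a₀) := by
    have hd := (hR.differentiableAt (by simp)).hasFDerivAt
    refine hd.congr_fderiv ?_
    have h1 : HasDerivAt (fun s : ℝ => (s, a₀)) ((1 : ℝ), (0 : ℝ)) s₀ :=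
      (hasDerivAt_id s₀).prodMk (hasDerivAt_const s₀ a₀)
    have h2 : HasDerivAt (fun a : ℝ => (s₀, a)) ((0 : ℝ), (1 : ℝ)) a₀ :=
      (hasDerivAt_const a₀ s₀).prodMk (hasDerivAt_id a₀)
    have k1 := hd.comp_hasDerivAt s₀ h1
    have k2 := hd.comp_hasDerivAt a₀ h2
    have e1 := k1.unique (hasDerivAt_cylR_left s₀ ha)
    have e2 := k2.unique hcd
    rw [h.crit] at e1
    ext
    · simpa [pairDeriv_apply] using e1
    · simpa [pairDeriv_apply] using e2
  -- Once R = γ, the equation D = 0 reads s² + 2a = 1 + γ², so a polynomial can replace D as second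
  -- component.
  set ψ : ℝ × ℝ → ℝ × ℝ := fun p => (cylR p.1 p.2, p.1 ^ 2 + 2 * p.2) with hψ
  have hψC : ContDiffAt ℝ ((⊤ : ℕ∞) : WithTop ℕ∞) ψ (s₀, a₀) :=
    hR.prodMk (by fun_prop)
  -- Criticality makes ∂ₛR vanish, so the derivative is triangular; it is invertible because c < 0
  -- and s₀ < 0.
  let e : (ℝ × ℝ) ≃L[ℝ] (ℝ × ℝ) := ContinuousLinearEquiv.equivOfInverse
    ((pairDeriv 0 c).prod (pairDeriv (2 * s₀) 2))
    ((pairDeriv (-(1 / (s₀ * c))) (1 / (2 * s₀))).prod (pairDeriv (1 / c) 0))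
    (fun p => by
      have := hc.ne; have := hs.ne
      ext <;> simp [pairDeriv_apply] <;> field_simp <;> ring)
    (fun p => by
      have := hc.ne; have := hs.ne
      ext <;> simp [pairDeriv_apply] <;> field_simp <;> ring)
  have hψd : HasFDerivAt ψ (e : (ℝ × ℝ) →L[ℝ] (ℝ × ℝ)) (s₀, a₀) := by
    have h2 : HasFDerivAt (fun p : ℝ × ℝ => p.1 ^ 2 + 2 * p.2) (pairDeriv (2 * s₀) 2)
        (s₀, a₀) := by
      have h3 : HasFDerivAt (fun p : ℝ × ℝ => p.1) (ContinuousLinearMap.fst ℝ ℝ ℝ) (s₀, a₀) :=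
        hasFDerivAt_fst
      have h4 : HasFDerivAt (fun p : ℝ × ℝ => p.2) (ContinuousLinearMap.snd ℝ ℝ ℝ) (s₀, a₀) :=
        hasFDerivAt_snd
      refine ((h3.pow 2).add (h4.const_mul 2)).congr_fderiv ?_
      ext <;> simp [pairDeriv_apply]
    exact hRd.prodMk h2
  have hn : ((⊤ : ℕ∞) : WithTop ℕ∞) ≠ 0 := by simp
  have hval : ψ (s₀, a₀) = (γ₀, 1 + γ₀ ^ 2) := by
    have h1 := h.crit
    rw [cylD, h.robin] at h1
    simp only [hψ, h.robin]
    congr 1; linarith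
  set g := hψC.localInverse hψd hn with hg
  have hgC : ContDiffAt ℝ ((⊤ : ℕ∞) : WithTop ℕ∞) g (γ₀, 1 + γ₀ ^ 2) :=
    hval ▸ hψC.to_localInverse hψd hn
  have hright : ∀ᶠ y in 𝓝 (γ₀, 1 + γ₀ ^ 2), ψ (g y) = y :=
    hval ▸ (hψC.hasStrictFDerivAt' hψd hn).eventually_right_inverse
  have hg0 : g (γ₀, 1 + γ₀ ^ 2) = (s₀, a₀) := hval ▸ hψC.localInverse_apply_image hψd hn
  have hline : ContDiffAt ℝ ((⊤ : ℕ∞) : WithTop ℕ∞) (fun γ : ℝ => (γ, 1 + γ ^ 2)) γ₀ := by fun_prop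
  have hfC : ContDiffAt ℝ ((⊤ : ℕ∞) : WithTop ℕ∞) (fun γ : ℝ => g (γ, 1 + γ ^ 2)) γ₀ :=
    hgC.comp γ₀ hline
  refine ⟨fun γ => g (γ, 1 + γ ^ 2), hfC, ?_⟩
  have hpos : ∀ᶠ γ in 𝓝 γ₀, g (γ, 1 + γ ^ 2) ∈ upperParams := by
    refine hfC.continuousAt.eventually_mem ?_
    rwa [hg0]
  filter_upwards [hpos, hline.continuousAt.eventually hright] with γ h1 h2
  have h3 := congrArg Prod.fst h2
  have h4 := congrArg Prod.snd h2
  simp only [hψ] at h3 h4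
  refine ⟨h1, h3, ?_⟩
  rw [cylD, h3]
  linarith

/-- The critical value M(a) = maxₛ R(s, a) is strictly decreasing; take b = sup {a > 0 : γ ≤ M(a)}.
Instead of continuity of M, the local inverse at b provides critical pairs with values on either
side of M(b), which excludes both M(b) < γ and M(b) > γ. -/
theorem exists_isCrit (γ : ℝ) : ∃ p : ℝ × ℝ, IsCrit γ p.1 p.2 := by
  choose! S hS using fun (a : ℝ) (ha : 0 < a) => exists_cylD_eq_zero ha
  set M : ℝ → ℝ := fun a => cylR (S a) a with hM
  have hcrit : ∀ a, 0 < a → IsCrit (M a) (S a) a := fun a ha => ⟨ha, rfl, hS a ha⟩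
  have hanti : ∀ a b, 0 < a → a < b → M b < M a := fun a b ha hab =>
    (hcrit a ha).lt (hcrit b (ha.trans hab)) hab
  have hMeq : ∀ {γ' s a}, IsCrit γ' s a → M a = γ' := by
    intro γ' s a h
    have : s = S a := by
      by_contra hne
      have h1 := cylR_lt_of_ne h.pos h.crit (Ne.symm hne)
      have h2 := cylR_lt_of_ne h.pos (hS a h.pos) hne
      exact lt_asymm h1 h2
    rw [hM]; simp only; rw [← this, h.robin]
  set A : Set ℝ := {a | 0 < a ∧ γ ≤ M a} with hA
  have hne : A.Nonempty := by
    obtain ⟨a, ha, h⟩ := exists_lt_cylR (-γ - 1) (c := γ) (by linarith)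
    exact ⟨a, ha, h.le.trans (cylR_le_of_cylD_eq_zero ha (hS a ha) _)⟩
  have hbdd : BddAbove A := by
    -- For a > 1 the value M(a) lies between γ and M(1), while D = 0 gives M(a)² ≥ 2a - 1.
    refine ⟨1 + (|M 1| + |γ|) ^ 2, fun a ha => ?_⟩
    by_contra! hlt
    have h1 : 1 < a := by nlinarith [sq_nonneg (|M 1| + |γ|)]
    have h2 := hanti 1 a one_pos h1
    have h3 := hS a ha.1
    rw [cylD] at h3
    have h4 : (M a) ^ 2 = S a ^ 2 + 2 * a - 1 := by rw [hM]; linarith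
    have h5 : |M a| ≤ |M 1| + |γ| := by
      have := ha.2
      rw [abs_le]
      constructor
      · linarith [neg_abs_le γ, abs_nonneg (M 1)]
      · linarith [le_abs_self (M 1), abs_nonneg γ]
    have h6 := sq_le_sq' (by linarith [neg_abs_le (M a)]) ((le_abs_self (M a)).trans h5)
    nlinarith [sq_nonneg (S a)]
  set b := sSup A with hb
  obtain ⟨a₀, ha₀⟩ := hne
  have hbpos : 0 < b := ha₀.1.trans_le (le_csSup hbdd ha₀)
  obtain ⟨f, -, hf⟩ := (hcrit b hbpos).exists_local_inverse
  have key : M b = γ := by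
    rcases lt_trichotomy (M b) γ with hlt | heq | hlt
    · have h1 : ∀ᶠ y in 𝓝[>] (M b), IsCrit y (f y).1 (f y).2 ∧ M b < y ∧ y < γ :=
        ((hf.filter_mono nhdsWithin_le_nhds).and
          (Eventually.and self_mem_nhdsWithin (nhdsWithin_le_nhds (Iio_mem_nhds hlt))))
      obtain ⟨y, hy, hy1, hy2⟩ := h1.exists
      have hya := hMeq hy
      have hlt2 : (f y).2 < b := by
        by_contra! hge
        rcases hge.eq_or_lt with h | h
        · rw [← h] at hya; linarith
        · have := hanti b _ hbpos h
          linarith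
      obtain ⟨a, ha, hlt3⟩ := exists_lt_of_lt_csSup ⟨a₀, ha₀⟩ hlt2
      have := hanti _ a hy.pos hlt3
      linarith [ha.2]
    · exact heq
    · have h1 : ∀ᶠ y in 𝓝[<] (M b), IsCrit y (f y).1 (f y).2 ∧ y < M b ∧ γ < y :=
        ((hf.filter_mono nhdsWithin_le_nhds).and
          (Eventually.and self_mem_nhdsWithin (nhdsWithin_le_nhds (Ioi_mem_nhds hlt))))
      obtain ⟨y, hy, hy1, hy2⟩ := h1.exists
      have hya := hMeq hy
      have h2 : (f y).2 ≤ b := le_csSup hbdd ⟨hy.pos, by linarith⟩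
      rcases h2.eq_or_lt with h | h
      · rw [h] at hya; linarith
      · have := hanti _ b hy.pos h
        linarith
  exact ⟨(S b, b), key ▸ hcrit b hbpos⟩

/-- The critical parameter pair for the Robin parameter `γ`. -/
def critPair (γ : ℝ) : ℝ × ℝ := (exists_isCrit γ).choose

lemma isCrit_critPair (γ : ℝ) : IsCrit γ (critPair γ).1 (critPair γ).2 := (exists_isCrit γ).choose_spec

lemma critPair_mem (γ : ℝ) : critPair γ ∈ upperParams := (isCrit_critPair γ).pos

theorem contDiff_critPair : ContDiff ℝ ((⊤ : ℕ∞) : WithTop ℕ∞) critPair := by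
  rw [contDiff_iff_contDiffAt]
  intro γ
  obtain ⟨f, hf, hcrit⟩ := (isCrit_critPair γ).exists_local_inverse
  refine hf.congr_of_eventuallyEq ?_
  filter_upwards [hcrit] with γ' h
  have := (isCrit_critPair γ').unique h
  exact Prod.ext this.1 this.2

/-! ### Solutions of the eigenvalue equation on the half-line -/

lemma not_eventually_ge_of_integrableOn {f : ℝ → ℝ} (hf : IntegrableOn f (Ioi 0)) {T c : ℝ}
    (hT : 0 ≤ T) (hc : 0 < c) (h : ∀ t, T ≤ t → c ≤ f t) : False := by
  have h1 : IntegrableOn (fun _ : ℝ => c) (Ioi T) := by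
    refine (hf.mono_set (Ioi_subset_Ioi hT)).mono' aestronglyMeasurable_const ?_
    filter_upwards [ae_restrict_mem measurableSet_Ioi] with t ht
    rw [Real.norm_of_nonneg hc.le]
    exact h t (le_of_lt ht)
  rw [integrableOn_const_iff] at h1
  simp [hc.ne'] at h1

/-- Monotonicity of `cylQ` leaves only linear growth, so R w² is integrable whenever the weighted
norms of w are finite. -/
lemma abs_cylR_add_le (s : ℝ) {a : ℝ} (ha : 0 < a) {t : ℝ} (ht : 0 ≤ t) :
    |cylR (t + s) a| ≤ t + (|s| + 2 * cylQ s a) := by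
  have h1 := cylQ_pos (t + s) ha
  have h2 : cylQ (t + s) a ≤ cylQ s a := cylQ_antitone ha (by linarith)
  rw [cylR, abs_le]
  constructor <;> linarith [le_abs_self s, neg_abs_le s]

lemma continuous_cylR_left {a : ℝ} (ha : 0 < a) : Continuous fun s => cylR s a :=
  continuous_iff_continuousAt.2 fun s => (hasDerivAt_cylR_left s ha).continuousAt

/-- A square integrable real solution of the eigenvalue equation whose Robin parameter is at least
`cylR (-ξ) a` and whose eigenvalue is at most `1 - 2 a` is proportional to the
parabolic cylinder function. -/
theorem ground_state_rigidity {X X₁ : ℝ → ℝ} {γ ξ lam a : ℝ} (ha : 0 < a) (hlam : lam ≤ 1 - 2 * a)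
    (hγ : cylR (-ξ) a ≤ γ) (hX : ContinuousOn X (Ici 0)) (hX₁ : ContinuousOn X₁ (Ici 0))
    (hd : ∀ t, 0 < t → HasDerivAt X (X₁ t) t)
    (hd₁ : ∀ t, 0 < t → HasDerivAt X₁ (((t - ξ) ^ 2 - lam) * X t) t) (h0 : X₁ 0 = γ * X 0)
    (hi : IntegrableOn (fun t => X t ^ 2) (Ioi 0)) (hi₁ : IntegrableOn (fun t => X₁ t ^ 2) (Ioi 0))
    (hi₂ : IntegrableOn (fun t => (t ^ 2 * X t) ^ 2) (Ioi 0)) :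
    ∀ t, 0 < t → X₁ t = cylR (t - ξ) a * X t ∧ (1 - 2 * a - lam) * X t ^ 2 = 0 := by
  -- By the Riccati equation G' = (X₁ - R X)² + (1 - 2a - lam) X² ≥ 0, and G(0) ≥ 0. A nonnegative,
  -- nondecreasing, integrable function on the half-line is zero, so both terms of G' vanish.
  set G : ℝ → ℝ := fun t => X t * X₁ t - cylR (t - ξ) a * X t ^ 2 with hG
  have hRc : Continuous fun t => cylR (t - ξ) a := (continuous_cylR_left ha).comp (by fun_prop)
  have hGc : ContinuousOn G (Ici 0) := (hX.mul hX₁).sub (hRc.continuousOn.mul (hX.pow 2))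
  have hGd : ∀ t, 0 < t → HasDerivAt G
      ((X₁ t - cylR (t - ξ) a * X t) ^ 2 + (1 - 2 * a - lam) * X t ^ 2) t := by
    intro t ht
    have h1 := (hasDerivAt_cylR_left (t - ξ) ha).comp_sub_const t ξ
    refine (((hd t ht).mul (hd₁ t ht)).sub (h1.mul ((hd t ht).pow 2))).congr_deriv ?_
    simp only [cylD, Pi.pow_apply]
    push_cast
    ring
  have hmono : MonotoneOn G (Ici 0) := by
    refine monotoneOn_of_deriv_nonneg (convex_Ici 0) hGc
      (fun t ht => ?_) fun t ht => ?_
    · rw [interior_Ici] at ht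
      exact (hGd t ht).differentiableAt.differentiableWithinAt
    · rw [interior_Ici] at ht
      rw [(hGd t ht).deriv]
      have : 0 ≤ 1 - 2 * a - lam := by linarith
      positivity
  have hG0 : 0 ≤ G 0 := by
    simp only [hG, h0, zero_sub]
    nlinarith [mul_nonneg (sub_nonneg.2 hγ) (sq_nonneg (X 0))]
  have hGi : IntegrableOn G (Ioi 0) := by
    set C := |-ξ| + 2 * cylQ (-ξ) a with hC
    have hCpos : 0 < C := by
      have := cylQ_pos (-ξ) ha
      positivity
    have hdom := (((hi.add hi₁).add (hi.const_mul (C + 1))).add hi₂)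
    refine Integrable.mono' hdom ((hGc.mono Ioi_subset_Ici_self).aestronglyMeasurable
      measurableSet_Ioi) ?_
    filter_upwards [ae_restrict_mem measurableSet_Ioi] with t ht
    have ht' : 0 ≤ t := le_of_lt ht
    have h1 := abs_cylR_add_le (-ξ) ha ht'
    rw [← hC, ← sub_eq_add_neg] at h1
    have h2 : |X t * X₁ t| ≤ X t ^ 2 + X₁ t ^ 2 := by
      rw [abs_le]; constructor <;> nlinarith [sq_nonneg (X t - X₁ t), sq_nonneg (X t + X₁ t)]
    have h3 : |cylR (t - ξ) a * X t ^ 2| ≤ (t + C) * X t ^ 2 := by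
      rw [abs_mul, abs_of_nonneg (sq_nonneg (X t))]
      exact mul_le_mul_of_nonneg_right h1 (sq_nonneg _)
    have h4 : t ≤ 1 + t ^ 4 := by nlinarith [sq_nonneg (t ^ 2 - 1), sq_nonneg (t - 1)]
    have h5 := mul_le_mul_of_nonneg_right h4 (sq_nonneg (X t))
    rw [Real.norm_eq_abs]
    refine (abs_sub _ _).trans ?_
    simp only [Pi.add_apply]
    nlinarith
  have hGz : ∀ t, 0 ≤ t → G t = 0 := by
    intro t ht
    refine le_antisymm ?_ (hG0.trans (hmono self_mem_Ici ht ht))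
    by_contra! hlt
    exact not_eventually_ge_of_integrableOn hGi ht hlt fun x hx => hmono ht (ht.trans hx) hx
  intro t ht
  have h1 : HasDerivAt G 0 t := (hasDerivAt_const t (0 : ℝ)).congr_of_eventuallyEq (by
    filter_upwards [Ioi_mem_nhds ht] with x hx using hGz x (le_of_lt hx))
  have h2 := (hGd t ht).unique h1
  have h3 := sq_nonneg (X₁ t - cylR (t - ξ) a * X t)
  have h4 : 0 ≤ (1 - 2 * a - lam) * X t ^ 2 := mul_nonneg (by linarith) (sq_nonneg _)
  have h5 : (X₁ t - cylR (t - ξ) a * X t) ^ 2 = 0 := by linarith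
  exact ⟨by linarith [pow_eq_zero_iff (two_ne_zero) |>.1 h5], by linarith⟩

lemma HasSobolevDeriv.intervalIntegrable {u v : ℝ → ℂ} (h : HasSobolevDeriv u v) {t : ℝ}
    (ht : 0 ≤ t) : IntervalIntegrable v volume 0 t := by
  rw [intervalIntegrable_iff_integrableOn_Ioc_of_le ht]
  have h1 : MemLp v 2 (volume.restrict (Ioc 0 t)) :=
    h.memLp_deriv.mono_measure (Measure.restrict_mono Ioc_subset_Ioi_self le_rfl)
  exact h1.integrable one_le_two

lemma HasSobolevDeriv.continuousOn {u v : ℝ → ℂ} (h : HasSobolevDeriv u v) :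
    ContinuousOn u (Ici 0) := by
  have key : ∀ T : ℝ, 0 ≤ T → ContinuousOn u (Icc 0 T) := by
    intro T hT
    have h1 := intervalIntegral.continuousOn_primitive_interval' (h.intervalIntegrable hT)
      left_mem_uIcc
    rw [uIcc_of_le hT] at h1
    exact (continuousOn_const.add h1).congr fun t ht => h.eq_integral t ht.1
  intro t ht
  have h1 := key (t + 1) (by linarith [mem_Ici.1 ht]) t ⟨ht, by linarith⟩
  refine h1.mono_of_mem_nhdsWithin ?_
  rw [← Ici_inter_Iic]
  exact inter_mem self_mem_nhdsWithin (nhdsWithin_le_nhds (Iic_mem_nhds (by linarith)))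

lemma hasDerivAt_of_eq_integral {u v : ℝ → ℂ} (hv : ContinuousOn v (Ici 0))
    (h : ∀ t : ℝ, 0 ≤ t → u t = u 0 + ∫ s in (0 : ℝ)..t, v s) {t : ℝ} (ht : 0 < t) :
    HasDerivAt u (v t) t := by
  have hca : ContinuousAt v t := hv.continuousAt (Ici_mem_nhds ht)
  have hint : IntervalIntegrable v volume 0 t :=
    (hv.mono (by rw [uIcc_of_le ht.le]; exact Icc_subset_Ici_self)).intervalIntegrable
  have hmeas : StronglyMeasurableAtFilter v (𝓝 t) :=
    ContinuousOn.stronglyMeasurableAtFilter isOpen_Ioi (hv.mono Ioi_subset_Ici_self) t ht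
  have h1 := (intervalIntegral.integral_hasDerivAt_right hint hmeas hca).const_add (u 0)
  refine h1.congr_of_eventuallyEq ?_
  filter_upwards [Ioi_mem_nhds ht] with x hx using h x (le_of_lt hx)

/-- Classical regularity of the solutions of the eigenvalue equation. -/
theorem SolvesEigenEquation.exists_classical {γ ξ lam : ℝ} {u : ℝ → ℂ}
    (h : SolvesEigenEquation γ ξ lam u) :
    ∃ u₁ : ℝ → ℂ, MemLp u 2 halfLineMeasure ∧ MemLp u₁ 2 halfLineMeasure ∧
      MemLp (fun t : ℝ => (t : ℂ) ^ 2 * u t) 2 halfLineMeasure ∧ ContinuousOn u (Ici 0) ∧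
      ContinuousOn u₁ (Ici 0) ∧ (∀ t, 0 < t → HasDerivAt u (u₁ t) t) ∧
      (∀ t : ℝ, 0 < t → HasDerivAt u₁ ((((t - ξ) ^ 2 - lam : ℝ) : ℂ) * u t) t) ∧
      u₁ 0 = (γ : ℂ) * u 0 := by
  obtain ⟨u₁, u₂, hd, hae⟩ := h
  have hu := hd.deriv_one.continuousOn
  have hu₁ := hd.deriv_two.continuousOn
  refine ⟨u₁, hd.deriv_one.memLp, hd.deriv_one.memLp_deriv, hd.weight, hu, hu₁,
    fun t ht => hasDerivAt_of_eq_integral hu₁ hd.deriv_one.eq_integral ht, fun t ht => ?_,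
    hd.robin⟩
  have hc : ContinuousOn (fun t : ℝ => (((t - ξ) ^ 2 - lam : ℝ) : ℂ) * u t) (Ici 0) :=
    (Continuous.continuousOn (by fun_prop)).mul hu
  refine hasDerivAt_of_eq_integral hc (fun x hx => ?_) ht
  -- The equation identifies the weak second derivative almost everywhere with a continuous
  -- function, which may be put under the integral.
  rw [hd.deriv_two.eq_integral x hx]
  congr 1
  refine intervalIntegral.integral_congr_ae ?_
  rw [uIoc_of_le hx]
  filter_upwards [(ae_restrict_iff' measurableSet_Ioi).1 hae] with y hy hy'
  have := hy hy'.1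
  push_cast
  linear_combination -this

lemma integrableOn_sq_of_memLp {f : ℝ → ℂ} (hf : MemLp f 2 halfLineMeasure) (L : ℂ →L[ℝ] ℝ) :
    IntegrableOn (fun t => L (f t) ^ 2) (Ioi 0) :=
  ((L.comp_memLp' hf)).integrable_sq

/-- The coefficients are real, so the real statement applies to the real and imaginary parts of u.
-/
theorem SolvesEigenEquation.rigidity {γ ξ lam a : ℝ} {u : ℝ → ℂ} (ha : 0 < a)
    (h : SolvesEigenEquation γ ξ lam u) (hlam : lam ≤ 1 - 2 * a) (hγ : cylR (-ξ) a ≤ γ) :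
    (∀ t, 0 < t → HasDerivAt u (((cylR (t - ξ) a : ℝ) : ℂ) * u t) t) ∧
      ∀ t, 0 < t → ((1 - 2 * a - lam : ℝ) : ℂ) * u t = 0 := by
  obtain ⟨u₁, m0, m1, m2, c0, c1, d0, d1, hr⟩ := h.exists_classical
  have key : ∀ L : ℂ →L[ℝ] ℝ, ∀ t, 0 < t → L (u₁ t) = cylR (t - ξ) a * L (u t) ∧
      (1 - 2 * a - lam) * L (u t) ^ 2 = 0 := by
    intro L
    have hmul : ∀ (r : ℝ) (z : ℂ), L ((r : ℂ) * z) = r * L z := by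
      intro r z
      rw [← Complex.real_smul, map_smul, smul_eq_mul]
    refine ground_state_rigidity (X := fun t => L (u t)) (X₁ := fun t => L (u₁ t)) ha hlam hγ
      (L.continuous.comp_continuousOn c0) (L.continuous.comp_continuousOn c1)
      (fun t ht => L.hasFDerivAt.comp_hasDerivAt t (d0 t ht))
      (fun t ht => ?_) ?_ (integrableOn_sq_of_memLp m0 L) (integrableOn_sq_of_memLp m1 L) ?_
    · exact (L.hasFDerivAt.comp_hasDerivAt t (d1 t ht)).congr_deriv (hmul _ _)
    · show L (u₁ 0) = γ * L (u 0)
      rw [hr, hmul]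
    · refine (integrableOn_sq_of_memLp m2 L).congr_fun (fun t _ => ?_) measurableSet_Ioi
      simp only
      rw [← hmul]; push_cast; rfl
  constructor
  · intro t ht
    have e : u₁ t = ((cylR (t - ξ) a : ℝ) : ℂ) * u t := by
      apply Complex.ext
      · simpa using (key Complex.reCLM t ht).1
      · simpa using (key Complex.imCLM t ht).1
    exact e ▸ d0 t ht
  · intro t ht
    have h1 := (key Complex.reCLM t ht).2
    have h2 := (key Complex.imCLM t ht).2
    rcases eq_or_ne (1 - 2 * a - lam) 0 with h0 | h0
    · simp [h0]
    · have h3 : u t = 0 := by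
        apply Complex.ext
        · simpa [h0] using h1
        · simpa [h0] using h2
      rw [h3, mul_zero]

theorem IsRobinEigenvalue.ge {γ ξ lam a : ℝ} (ha : 0 < a) (hγ : cylR (-ξ) a ≤ γ)
    (h : IsRobinEigenvalue γ ξ lam) : 1 - 2 * a ≤ lam := by
  obtain ⟨u, hu, hne⟩ := h
  by_contra! hlt
  refine hne ?_
  filter_upwards [ae_restrict_mem measurableSet_Ioi] with t ht
  have h1 := (hu.rigidity ha hlt.le hγ).2 t ht
  have h2 : ((1 - 2 * a - lam : ℝ) : ℂ) ≠ 0 := by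
    exact_mod_cast (by linarith : (1 - 2 * a - lam : ℝ) ≠ 0)
  exact (mul_eq_zero.1 h1).resolve_left h2

/-! ### Functions of at most exponential growth -/

/-- Continuous functions with at most exponential growth at infinity. -/
def ExpGrowth (f : ℝ → ℝ) : Prop :=
  Continuous f ∧ ∃ c : ℝ, f =O[atTop] fun x => Real.exp (c * x)

lemma isBigO_exp_mul_of_le {c d : ℝ} (h : c ≤ d) :
    (fun x => Real.exp (c * x)) =O[atTop] fun x => Real.exp (d * x) := by
  refine Asymptotics.IsBigO.of_bound 1 ?_
  filter_upwards [eventually_ge_atTop 0] with x hx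
  rw [Real.norm_of_nonneg (Real.exp_pos _).le, Real.norm_of_nonneg (Real.exp_pos _).le, one_mul]
  exact Real.exp_le_exp.2 (mul_le_mul_of_nonneg_right h hx)

lemma ExpGrowth.add {f g : ℝ → ℝ} (hf : ExpGrowth f) (hg : ExpGrowth g) :
    ExpGrowth fun x => f x + g x := by
  obtain ⟨hfc, c, hf⟩ := hf
  obtain ⟨hgc, d, hg⟩ := hg
  exact ⟨hfc.add hgc, max c d, (hf.trans (isBigO_exp_mul_of_le (le_max_left _ _))).add
    (hg.trans (isBigO_exp_mul_of_le (le_max_right _ _)))⟩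

lemma ExpGrowth.mul {f g : ℝ → ℝ} (hf : ExpGrowth f) (hg : ExpGrowth g) :
    ExpGrowth fun x => f x * g x := by
  obtain ⟨hfc, c, hf⟩ := hf
  obtain ⟨hgc, d, hg⟩ := hg
  refine ⟨hfc.mul hgc, c + d, (hf.mul hg).congr_right fun x => ?_⟩
  rw [← Real.exp_add, add_mul]

lemma expGrowth_const (k : ℝ) : ExpGrowth fun _ => k :=
  ⟨continuous_const, 0, by
    simpa using Asymptotics.isBigO_const_const k (one_ne_zero (α := ℝ)) (atTop : Filter ℝ)⟩

lemma expGrowth_id : ExpGrowth fun x => x :=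
  ⟨continuous_id, 1, by simpa using (Real.isLittleO_pow_exp_atTop (n := 1)).isBigO⟩

lemma ExpGrowth.memLp {f : ℝ → ℝ} (hf : ExpGrowth f) (s : ℝ) :
    MemLp (fun t : ℝ => ((Real.exp (-(t + s) ^ 2 / 2) * f (t + s) : ℝ) : ℂ)) 2 halfLineMeasure := by
  obtain ⟨hfc, c, hfO⟩ := hf
  have hcont : Continuous fun t : ℝ => Real.exp (-(t + s) ^ 2 / 2) * f (t + s) := by fun_prop
  suffices h : MemLp (fun t : ℝ => Real.exp (-(t + s) ^ 2 / 2) * f (t + s)) 2 halfLineMeasure from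
    h.ofReal
  rw [memLp_two_iff_integrable_sq hcont.aestronglyMeasurable]
  -- The rate c + 1 leaves a decay exp(-τ) after multiplication by a function of growth exp(cτ).
  have h1 : (fun τ : ℝ => Real.exp (-τ ^ 2 / 2)) =O[atTop] fun τ => Real.exp (-(c + 1) * τ) := by
    refine Asymptotics.IsBigO.of_bound 1 ?_
    filter_upwards [eventually_ge_atTop (2 * (c + 1)), eventually_ge_atTop 0] with x hx hx0
    rw [Real.norm_of_nonneg (Real.exp_pos _).le, Real.norm_of_nonneg (Real.exp_pos _).le, one_mul]
    exact Real.exp_le_exp.2 (by nlinarith)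
  have h2 := (h1.mul hfO).comp_tendsto (tendsto_atTop_add_const_right atTop s tendsto_id)
  have h3 := h2.mul h2
  refine integrable_of_isBigO_exp_neg (b := 2) two_pos (hcont.pow 2).continuousOn ?_
  have h4 : (fun t : ℝ => (Real.exp (-(t + s) ^ 2 / 2) * f (t + s)) ^ 2) =O[atTop]
      fun t => Real.exp (-2 * s) * Real.exp (-2 * t) := by
    refine h3.congr (fun t => ?_) fun t => ?_
    · simp only [Function.comp, id]; ring
    · simp only [Function.comp, id]
      rw [← Real.exp_add, ← Real.exp_add, ← Real.exp_add]
      ring_nf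
  exact h4.trans (Asymptotics.isBigO_const_mul_self _ _ _)

lemma hasSobolevDeriv_of_hasDerivAt {f g : ℝ → ℝ} (hd : ∀ t, HasDerivAt f (g t) t)
    (hg : Continuous g) (hf2 : MemLp (fun t => ((f t : ℝ) : ℂ)) 2 halfLineMeasure)
    (hg2 : MemLp (fun t => ((g t : ℝ) : ℂ)) 2 halfLineMeasure) :
    HasSobolevDeriv (fun t => ((f t : ℝ) : ℂ)) (fun t => ((g t : ℝ) : ℂ)) := by
  refine ⟨hf2, hg2, fun t _ => ?_⟩
  rw [intervalIntegral.integral_ofReal, intervalIntegral.integral_eq_sub_of_hasDerivAt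
    (fun x _ => hd x) (hg.intervalIntegrable _ _)]
  push_cast; ring

/-- Solutions of Hermite's equation give solutions of the eigenvalue equation. -/
theorem solvesEigenEquation_of_hermite {P P₁ : ℝ → ℝ} {γ s lam : ℝ} (hP : ExpGrowth P)
    (hP₁ : ExpGrowth P₁) (hd : ∀ τ, HasDerivAt P (P₁ τ) τ)
    (hd₁ : ∀ τ, HasDerivAt P₁ (2 * τ * P₁ τ + (1 - lam) * P τ) τ)
    (hr : P₁ s - s * P s = γ * P s) :
    SolvesEigenEquation γ (-s) lam
      (fun t => ((Real.exp (-(t + s) ^ 2 / 2) * P (t + s) : ℝ) : ℂ)) := by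
  -- The profiles multiplying the Gaussian in u', u'' and t²u respectively.
  have hG1 : ExpGrowth fun τ => P₁ τ + -1 * τ * P τ :=
    hP₁.add (((expGrowth_const (-1)).mul expGrowth_id).mul hP)
  have hG2 : ExpGrowth fun τ => (τ * τ + -lam) * P τ :=
    ((expGrowth_id.mul expGrowth_id).add (expGrowth_const (-lam))).mul hP
  have hG3 : ExpGrowth fun τ => (τ + -s) * (τ + -s) * P τ :=
    (((expGrowth_id.add (expGrowth_const (-s)))).mul (expGrowth_id.add (expGrowth_const (-s)))).mul hP
  have hexp : ∀ t : ℝ, HasDerivAt (fun t : ℝ => Real.exp (-(t + s) ^ 2 / 2))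
      (Real.exp (-(t + s) ^ 2 / 2) * -(t + s)) t := by
    intro t
    have h1 : HasDerivAt (fun t : ℝ => -(t + s) ^ 2 / 2) (-(t + s)) t := by
      have := ((((hasDerivAt_id t).add_const s).pow 2).neg).div_const 2
      refine this.congr_deriv ?_
      simp; ring
    exact h1.exp
  refine ⟨fun t => ((Real.exp (-(t + s) ^ 2 / 2) * (P₁ (t + s) + -1 * (t + s) * P (t + s)) : ℝ) : ℂ),
    fun t => ((Real.exp (-(t + s) ^ 2 / 2) * (((t + s) * (t + s) + -lam) * P (t + s)) : ℝ) : ℂ),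
    ⟨?_, ?_, ?_, ?_⟩, ?_⟩
  · refine hasSobolevDeriv_of_hasDerivAt (fun t => ?_) ?_ (hP.memLp s) (hG1.memLp s)
    · refine ((hexp t).mul ((hd (t + s)).comp_add_const t s)).congr_deriv ?_
      ring
    · have := hP.1; have := hP₁.1
      fun_prop
  · refine hasSobolevDeriv_of_hasDerivAt (fun t => ?_) ?_ (hG1.memLp s) (hG2.memLp s)
    · have h1 := ((hd₁ (t + s)).comp_add_const t s).add
        ((((hasDerivAt_id t).add_const s).const_mul (-1)).mul ((hd (t + s)).comp_add_const t s))
      refine ((hexp t).mul h1).congr_deriv ?_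
      simp only [Pi.add_apply, Pi.mul_apply, id]
      ring
    · have := hP.1
      fun_prop
  · refine (hG3.memLp s).ae_eq (Eventually.of_forall fun t => ?_)
    simp only
    push_cast
    ring
  · simp only [zero_add]
    have : P₁ s + -1 * s * P s = γ * P s := by linarith
    rw [this]; push_cast; ring
  · refine Eventually.of_forall fun t => ?_
    simp only
    push_cast
    ring

/-! ### The explicit positive eigenfunction for a > 0 -/

lemma expGrowth_cylI {a : ℝ} (ha : 0 < a) : ExpGrowth fun s => cylI s a := by
  refine ⟨continuous_cylI_left ha, 0, ?_⟩
  have hanti : Antitone fun s => cylI s a := by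
    refine antitone_of_deriv_nonpos (fun s => (hasDerivAt_cylI_left s ha).differentiableAt)
      fun s => ?_
    rw [(hasDerivAt_cylI_left s ha).deriv]
    linarith [cylI_pos s (by linarith : 0 < a + 1)]
  refine Asymptotics.IsBigO.of_bound (cylI 0 a) ?_
  filter_upwards [eventually_ge_atTop 0] with x hx
  rw [Real.norm_of_nonneg (cylI_pos x ha).le]
  simpa using hanti hx

/-- The eigenfunction attached to the parameters `(s, a)`. -/
def cylU (s a t : ℝ) : ℝ := Real.exp (-(t + s) ^ 2 / 2) * cylI (t + s) a

lemma cylU_pos (s t : ℝ) {a : ℝ} (ha : 0 < a) : 0 < cylU s a t :=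
  mul_pos (Real.exp_pos _) (cylI_pos _ ha)

lemma hasDerivAt_cylU (s t : ℝ) {a : ℝ} (ha : 0 < a) :
    HasDerivAt (cylU s a) (cylR (t + s) a * cylU s a t) t := by
  have h1 : HasDerivAt (fun t : ℝ => -(t + s) ^ 2 / 2) (-(t + s)) t := by
    have := ((((hasDerivAt_id t).add_const s).pow 2).neg).div_const 2
    refine this.congr_deriv ?_
    simp; ring
  refine (h1.exp.mul ((hasDerivAt_cylI_left (t + s) ha).comp_add_const t s)).congr_deriv ?_
  have h3 : cylI (t + s) (a + 1) = cylQ (t + s) a * cylI (t + s) a :=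
    (div_mul_cancel₀ _ (cylI_pos _ ha).ne').symm
  rw [h3, cylR, cylU]
  ring

theorem solvesEigenEquation_cylU {s a : ℝ} (ha : 0 < a) :
    SolvesEigenEquation (cylR s a) (-s) (1 - 2 * a) (fun t => ((cylU s a t : ℝ) : ℂ)) := by
  have ha1 : 0 < a + 1 := by linarith
  refine solvesEigenEquation_of_hermite (P := fun τ => cylI τ a)
    (P₁ := fun τ => -2 * cylI τ (a + 1)) (expGrowth_cylI ha)
    ((expGrowth_const (-2)).mul (expGrowth_cylI ha1)) (fun τ => hasDerivAt_cylI_left τ ha)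
    (fun τ => ?_) ?_
  · refine ((hasDerivAt_cylI_left τ ha1).const_mul (-2)).congr_deriv ?_
    have := cylI_recurrence_of_pos τ ha
    rw [show a + 1 + 1 = a + 2 by ring]
    linarith
  · have h3 : cylI s (a + 1) = cylQ s a * cylI s a := (div_mul_cancel₀ _ (cylI_pos _ ha).ne').symm
    rw [h3, cylR]
    ring

lemma not_ae_eq_zero_cylU {s a : ℝ} (ha : 0 < a) :
    ¬ ((fun t => ((cylU s a t : ℝ) : ℂ)) =ᵐ[halfLineMeasure] 0) := by
  intro h
  have h2 : ∀ᵐ t ∂halfLineMeasure, False := by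
    filter_upwards [h] with t ht
    have : ((cylU s a t : ℝ) : ℂ) = 0 := ht
    exact (cylU_pos s t ha).ne' (by exact_mod_cast this)
  rw [eventually_false_iff_eq_bot, ae_eq_bot] at h2
  have : halfLineMeasure univ = 0 := by rw [h2]; simp
  simp at this

lemma isRobinEigenvalue_cyl {s a : ℝ} (ha : 0 < a) :
    IsRobinEigenvalue (cylR s a) (-s) (1 - 2 * a) :=
  ⟨_, solvesEigenEquation_cylU ha, not_ae_eq_zero_cylU ha⟩

/-- Completing the square: the smooth family and the eigenfunction differ by a factor free of t,
which normalization removes. -/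
lemma cylFun_eq_cylU (s a t : ℝ) : cylFun 0 0 (s, a) t = Real.exp (s ^ 2 / 2) * cylU s a t := by
  rw [cylU, cylI_eq, ← mul_assoc, ← Real.exp_add, ← integral_const_mul]
  refine setIntegral_congr_fun measurableSet_Ioi fun x hx => ?_
  simp only [cylKernel, cylW, pow_zero, one_mul]
  rw [Real.rpow_def_of_pos hx, ← Real.exp_add, ← Real.exp_add]
  congr 1
  ring

/-! ### Existence of eigenvalues -/

/-- The function `cylI s a / Γ(a)`, continued to `a > -n` by the recurrence relation. -/
def cylJ : ℕ → ℝ → ℝ → ℝ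
  | 0, s, a => cylI s a / Real.Gamma a
  | n + 1, s, a => 2 * s * cylJ n s (a + 1) + 2 * (a + 1) * cylJ n s (a + 2)

lemma cylJ_succ (n : ℕ) (s a : ℝ) :
    cylJ (n + 1) s a = 2 * s * cylJ n s (a + 1) + 2 * (a + 1) * cylJ n s (a + 2) := rfl

/-- Dividing the recurrence of `cylI` by Γ(a + 1) yields exactly the recursive clause, so successive
stages of the continuation agree where the earlier one is meaningful. -/
theorem cylJ_succ_eq (n : ℕ) (s : ℝ) : ∀ {a : ℝ}, -(n : ℝ) < a → cylJ (n + 1) s a = cylJ n s a := by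
  induction n with
  | zero =>
    intro a ha
    have ha' : 0 < a := by simpa using ha
    have h1 := cylI_recurrence_of_pos s ha'
    have hg := (Real.Gamma_pos_of_pos ha').ne'
    have e1 : Real.Gamma (a + 1) = a * Real.Gamma a := Real.Gamma_add_one ha'.ne'
    have e2 : Real.Gamma (a + 2) = (a + 1) * (a * Real.Gamma a) := by
      rw [show a + 2 = a + 1 + 1 by ring, Real.Gamma_add_one (by linarith), e1]
    have h2 : a + 1 ≠ 0 := by linarith
    rw [cylJ_succ, cylJ, cylJ, cylJ, e1, e2]
    field_simp
    linarith
  | succ n ih =>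
    intro a ha
    push_cast at ha
    rw [cylJ_succ (n + 1), ih (by linarith), ih (by linarith), ← cylJ_succ]

lemma cylJ_recurrence {n : ℕ} (s : ℝ) {a : ℝ} (ha : -(n : ℝ) < a) :
    cylJ n s a = 2 * s * cylJ n s (a + 1) + 2 * (a + 1) * cylJ n s (a + 2) := by
  rw [← cylJ_succ, cylJ_succ_eq n s ha]

lemma cylJ_of_le {m n : ℕ} (hmn : m ≤ n) (s : ℝ) {a : ℝ} (ha : -(m : ℝ) < a) :
    cylJ n s a = cylJ m s a := by
  induction n, hmn using Nat.le_induction with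
  | base => rfl
  | succ n hmn ih =>
    rw [cylJ_succ_eq n s, ih]
    have : (m : ℝ) ≤ n := by exact_mod_cast hmn
    linarith

lemma cylJ_pos {n : ℕ} (s : ℝ) {a : ℝ} (ha : 0 < a) : 0 < cylJ n s a := by
  rw [cylJ_of_le (Nat.zero_le n) s (by simpa using ha)]
  exact div_pos (cylI_pos s ha) (Real.Gamma_pos_of_pos ha)

/-- This is the boundary term of the recurrence at a = 0; stage 0 is excluded because it divides by
Γ at its pole. -/
lemma cylJ_zero_right {n : ℕ} (hn : 1 ≤ n) (s : ℝ) : cylJ n s 0 = 1 := by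
  rw [cylJ_of_le hn s (by simp), cylJ_succ, cylJ, cylJ]
  have := cylI_recurrence_zero s
  simp [this]

lemma hasDerivAt_cylJ (n : ℕ) (s : ℝ) : ∀ {a : ℝ}, -(n : ℝ) < a →
    HasDerivAt (fun s => cylJ n s a) (-2 * a * cylJ n s (a + 1)) s := by
  induction n with
  | zero =>
    intro a ha
    have ha' : 0 < a := by simpa using ha
    refine ((hasDerivAt_cylI_left s ha').div_const _).congr_deriv ?_
    have := (Real.Gamma_pos_of_pos ha').ne'
    rw [cylJ, Real.Gamma_add_one ha'.ne']
    field_simp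
  | succ n ih =>
    intro a ha
    push_cast at ha
    have h1 := ((((hasDerivAt_id s).const_mul 2).mul (ih (a := a + 1) (by linarith))).add
      ((ih (a := a + 2) (by linarith)).const_mul (2 * (a + 1))))
    refine h1.congr_deriv ?_
    have h2 := cylJ_recurrence (n := n) s (a := a + 1) (by linarith)
    rw [show a + 1 + 1 = a + 2 by ring, show a + 1 + 2 = a + 3 by ring] at h2
    rw [cylJ_succ, show a + 1 + 1 = a + 2 by ring, show a + 2 + 1 = a + 3 by ring,
      show a + 1 + 2 = a + 3 by ring, h2]
    simp only [id]
    ring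

lemma expGrowth_cylJ (n : ℕ) : ∀ {a : ℝ}, -(n : ℝ) < a → ExpGrowth fun s => cylJ n s a := by
  induction n with
  | zero =>
    intro a ha
    have ha' : 0 < a := by simpa using ha
    simp only [cylJ, div_eq_mul_inv]
    exact (expGrowth_cylI ha').mul (expGrowth_const _)
  | succ n ih =>
    intro a ha
    push_cast at ha
    exact (((expGrowth_const 2).mul expGrowth_id).mul (ih (by linarith))).add
      ((expGrowth_const (2 * (a + 1))).mul (ih (by linarith)))

lemma continuousOn_cylJ (n : ℕ) (s : ℝ) : ContinuousOn (fun a => cylJ n s a) (Ioi (-(n : ℝ))) := by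
  induction n with
  | zero =>
    intro a ha
    have ha' : 0 < a := by simpa using ha
    refine ContinuousAt.continuousWithinAt ?_
    refine (hasDerivAt_cylI_right s ha').continuousAt.div ?_ (Real.Gamma_pos_of_pos ha').ne'
    refine (Real.differentiableAt_Gamma fun m => ?_).continuousAt
    have : (0 : ℝ) ≤ m := Nat.cast_nonneg m
    linarith
  | succ n ih =>
    have h1 : ContinuousOn (fun a => cylJ n s (a + 1)) (Ioi (-((n + 1 : ℕ) : ℝ))) := by
      refine ih.comp (f := fun a : ℝ => a + 1) (by fun_prop) fun a ha => ?_
      have : -((n + 1 : ℕ) : ℝ) < a := ha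
      push_cast at this
      show -(n : ℝ) < a + 1
      linarith
    have h2 : ContinuousOn (fun a => cylJ n s (a + 2)) (Ioi (-((n + 1 : ℕ) : ℝ))) := by
      refine ih.comp (f := fun a : ℝ => a + 2) (by fun_prop) fun a ha => ?_
      have : -((n + 1 : ℕ) : ℝ) < a := ha
      push_cast at this
      show -(n : ℝ) < a + 2
      linarith
    simp only [cylJ_succ]
    fun_prop

/-- If the function vanishes on a ray, so does its derivative, a multiple of the function at a + 1.
Climbing in unit steps reaches either a = 0, where the value is 1, or some a > 0, where it is
positive. -/
lemma not_forall_cylJ_eq_zero (n : ℕ) (s : ℝ) (k : ℕ) : ∀ {a : ℝ}, -(n : ℝ) < a → -(k : ℝ) < a →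
    ¬ ∀ τ, s < τ → cylJ n τ a = 0 := by
  induction k with
  | zero =>
    intro a _ ha h
    exact (cylJ_pos (n := n) (s + 1) (a := a) (by simpa using ha)).ne' (h _ (by linarith))
  | succ k ih =>
    intro a hn hk h
    push_cast at hk
    rcases eq_or_ne a 0 with rfl | ha
    · have hn' : 1 ≤ n := by
        have : (0 : ℝ) < n := by linarith
        exact_mod_cast this
      have := h (s + 1) (by linarith)
      rw [cylJ_zero_right hn'] at this
      exact one_ne_zero this
    · refine ih (a := a + 1) (by linarith) (by linarith) fun τ hτ => ?_
      have h1 : HasDerivAt (fun s => cylJ n s a) 0 τ :=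
        (hasDerivAt_const τ (0 : ℝ)).congr_of_eventuallyEq (by
          filter_upwards [Ioi_mem_nhds hτ] with x hx using h x hx)
      have h2 := (hasDerivAt_cylJ n τ hn).unique h1
      have h3 : -2 * a ≠ 0 := by simpa using ha
      exact (mul_eq_zero.1 h2).resolve_left h3

lemma isRobinEigenvalue_of_cylJ {n : ℕ} {γ s a : ℝ} (ha : -(n : ℝ) < a)
    (h : -2 * a * cylJ n s (a + 1) - (s + γ) * cylJ n s a = 0) :
    IsRobinEigenvalue γ (-s) (1 - 2 * a) := by
  have ha1 : -(n : ℝ) < a + 1 := by linarith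
  refine ⟨_, solvesEigenEquation_of_hermite (P := fun τ => cylJ n τ a)
    (P₁ := fun τ => -2 * a * cylJ n τ (a + 1)) (expGrowth_cylJ n ha)
    ((expGrowth_const (-2 * a)).mul (expGrowth_cylJ n ha1)) (fun τ => hasDerivAt_cylJ n τ ha)
    (fun τ => ?_) (by linarith), fun h0 => ?_⟩
  · refine ((hasDerivAt_cylJ n τ ha1).const_mul (-2 * a)).congr_deriv ?_
    have := cylJ_recurrence τ ha
    rw [show a + 1 + 1 = a + 2 by ring, this]
    ring
  · obtain ⟨k, hk⟩ := exists_nat_gt (-a)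
    refine not_forall_cylJ_eq_zero n s k ha (by linarith) fun τ hτ => ?_
    have hc : Continuous fun t : ℝ =>
        ((Real.exp (-(t + s) ^ 2 / 2) * cylJ n (t + s) a : ℝ) : ℂ) := by
      have := (expGrowth_cylJ n ha).1
      fun_prop
    have h1 := Measure.eqOn_open_of_ae_eq h0 isOpen_Ioi hc.continuousOn continuousOn_const
      (show τ - s ∈ Ioi 0 from sub_pos.2 hτ)
    simp only [sub_add_cancel, Pi.zero_apply] at h1
    have h2 : Real.exp (-τ ^ 2 / 2) * cylJ n τ a = 0 := by exact_mod_cast h1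
    exact (mul_eq_zero.1 h2).resolve_left (Real.exp_pos _).ne'

/-- Here h m is the Hermite polynomial H_m(s). If all the expressions were negative, every h m would
be positive and s > 0; but two steps of the recurrence bound h (m + 3) by (4s² - 2(m + 2)) h (m +
1), which is negative once m > 2s². -/
lemma exists_hermite_sign {s c : ℝ} (hc : 0 ≤ c) {h : ℕ → ℝ} (h0 : h 0 = 1) (h1 : h 1 = 2 * s)
    (hrec : ∀ m : ℕ, h (m + 2) = 2 * s * h (m + 1) - 2 * (m + 1) * h m) :
    ∃ m : ℕ, 0 ≤ 2 * (m + 1) * h m - c * h (m + 1) := by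
  by_contra! hneg
  have hpos : ∀ m, 0 < h m := by
    intro m
    induction m with
    | zero => rw [h0]; exact one_pos
    | succ m ih =>
      have h2 : 0 < 2 * ((m : ℝ) + 1) * h m := by positivity
      have h3 : 0 < c * h (m + 1) := by linarith [hneg m]
      exact pos_of_mul_pos_right h3 hc
  have hs : 0 < s := by have := hpos 1; rw [h1] at this; linarith
  obtain ⟨m, hm⟩ := exists_nat_gt (2 * s ^ 2)
  have e1 := hrec m
  have e2 := hrec (m + 1)
  have p0 := hpos m
  have p1 := hpos (m + 1)
  have p3 := hpos (m + 3)
  push_cast at e2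
  rw [show m + 1 + 2 = m + 3 from rfl, show m + 1 + 1 = m + 2 from rfl] at e2
  have h4 : 0 < 2 * ((m : ℝ) + 1) * h m := by positivity
  have h5 : h (m + 2) ≤ 2 * s * h (m + 1) := by linarith
  have h6 : 2 * s * h (m + 2) ≤ 2 * s * (2 * s * h (m + 1)) :=
    mul_le_mul_of_nonneg_left h5 (by linarith)
  have h7 : 2 * s ^ 2 * h (m + 1) < m * h (m + 1) := mul_lt_mul_of_pos_right hm p1
  nlinarith

/-- Without this the infimum defining the first eigenvalue could be the default value 0 of an empty
set. If γ < -s, the equation R(s, a) = γ is solved with a > 0 by the intermediate value theorem.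
Otherwise a root is sought with a ≤ 0, through the continuation `cylJ` and a sign change between 0
and a negative integer. -/
theorem exists_isRobinEigenvalue (γ ξ : ℝ) : ∃ lam, IsRobinEigenvalue γ ξ lam := by
  obtain ⟨s, rfl⟩ : ∃ s, ξ = -s := ⟨-ξ, by ring⟩
  rcases lt_or_ge γ (-s) with hlt | hge
  · obtain ⟨a, ha, hRa⟩ := exists_lt_cylR s hlt
    -- At this critical pair the maximum of R(·, b) is γ - 1, which puts R(s, b) below γ.
    have hcr := isCrit_critPair (γ - 1)
    set b := (critPair (γ - 1)).2
    have hb : 0 < b := hcr.pos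
    have hRb : cylR s b ≤ γ := by
      have := cylR_le_of_cylD_eq_zero hb hcr.crit s
      rw [hcr.robin] at this
      linarith
    have hcont : ContinuousOn (fun a => cylR s a) (Ioi 0) := fun x hx => by
      obtain ⟨c, -, h⟩ := exists_hasDerivAt_cylR_right s hx
      exact h.continuousAt.continuousWithinAt
    obtain ⟨x, hx, hxγ⟩ := (isPreconnected_Ioi (a := (0 : ℝ))).intermediate_value hb ha hcont
      ⟨hRb, hRa.le⟩
    have hxγ' : cylR s x = γ := hxγ
    exact ⟨_, hxγ' ▸ isRobinEigenvalue_cyl hx⟩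
  -- Stage m + 1 is the first whose range a > -(m + 1) contains -m.
  · set h : ℕ → ℝ := fun m => cylJ (m + 1) s (-(m : ℝ)) with hh
    have h0 : h 0 = 1 := by simp [hh, cylJ_zero_right]
    have hst : ∀ m n : ℕ, m + 1 ≤ n → cylJ n s (-(m : ℝ)) = h m := by
      intro m n hmn
      exact cylJ_of_le hmn s (by push_cast; linarith)
    have h1 : h 1 = 2 * s := by
      have := cylJ_recurrence (n := 2) s (a := -1) (by norm_num)
      have e : h 1 = cylJ 2 s (-1) := by simp [hh]
      rw [e, this]
      norm_num [cylJ_zero_right]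
    have hrec : ∀ m : ℕ, h (m + 2) = 2 * s * h (m + 1) - 2 * (m + 1) * h m := by
      intro m
      have e := cylJ_recurrence (n := m + 3) s (a := -((m + 2 : ℕ) : ℝ)) (by push_cast; linarith)
      rw [show -((m + 2 : ℕ) : ℝ) + 1 = -((m + 1 : ℕ) : ℝ) by push_cast; ring,
        show -((m + 2 : ℕ) : ℝ) + 2 = -(m : ℝ) by push_cast; ring, hst (m + 2) _ le_rfl,
        hst (m + 1) _ (by omega), hst m _ (by omega)] at e
      rw [e]; push_cast; ring
    obtain ⟨m, hm⟩ := exists_hermite_sign (c := s + γ) (by linarith) h0 h1 hrec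
    -- F measures the failure of the Robin condition. F(0) = -(s + γ), while F(-(m + 1)) is the
    -- expression whose sign the Hermite lemma controls.
    set F : ℝ → ℝ := fun a => -2 * a * cylJ (m + 2) s (a + 1) - (s + γ) * cylJ (m + 2) s a with hF
    have hF0 : F 0 ≤ 0 := by
      simp only [hF]
      rw [cylJ_zero_right (by omega)]
      linarith
    have hFm : 0 ≤ F (-((m + 1 : ℕ) : ℝ)) := by
      simp only [hF]
      rw [show -((m + 1 : ℕ) : ℝ) + 1 = -(m : ℝ) by push_cast; ring, hst m _ (by omega),
        hst (m + 1) _ le_rfl]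
      push_cast
      linarith
    have hcont : ContinuousOn F (Ioi (-((m + 2 : ℕ) : ℝ))) := by
      have c1 := continuousOn_cylJ (m + 2) s
      have c2 : ContinuousOn (fun a => cylJ (m + 2) s (a + 1)) (Ioi (-((m + 2 : ℕ) : ℝ))) := by
        refine c1.comp (f := fun a : ℝ => a + 1) (by fun_prop) fun a ha => ?_
        have : -((m + 2 : ℕ) : ℝ) < a := ha
        show -((m + 2 : ℕ) : ℝ) < a + 1
        linarith
      fun_prop
    obtain ⟨a, ha, hFa⟩ := isPreconnected_Ioi.intermediate_value
      (show (0 : ℝ) ∈ Ioi (-((m + 2 : ℕ) : ℝ)) by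
        rw [mem_Ioi, neg_lt_zero]; positivity)
      (show -((m + 1 : ℕ) : ℝ) ∈ Ioi (-((m + 2 : ℕ) : ℝ)) by
        rw [mem_Ioi]; push_cast; linarith) hcont ⟨hF0, hFm⟩
    exact ⟨_, isRobinEigenvalue_of_cylJ ha hFa⟩

/-! ### The first eigenvalue -/

lemma firstEigenvalue_ge {γ ξ a : ℝ} (ha : 0 < a) (hγ : cylR (-ξ) a ≤ γ) :
    1 - 2 * a ≤ firstEigenvalue γ ξ :=
  le_csInf (exists_isRobinEigenvalue γ ξ) fun _ h => IsRobinEigenvalue.ge ha hγ h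

theorem firstEigenvalue_crit {γ s a : ℝ} (h : IsCrit γ s a) :
    firstEigenvalue γ (-s) = 1 - 2 * a := by
  have hle : cylR (- -s) a ≤ γ := by rw [neg_neg, h.robin]
  refine le_antisymm (csInf_le ⟨1 - 2 * a, fun _ h' => IsRobinEigenvalue.ge h.pos hle h'⟩ ?_)
    (firstEigenvalue_ge h.pos hle)
  have := isRobinEigenvalue_cyl (s := s) h.pos
  rwa [h.robin] at this

/-- Away from the maximum R(-ξ, a) < γ strictly, so the lower bound survives with some b < a and
becomes 1 - 2b > 1 - 2a. -/
theorem lt_firstEigenvalue {γ s a ξ : ℝ} (h : IsCrit γ s a) (hne : ξ ≠ -s) :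
    1 - 2 * a < firstEigenvalue γ ξ := by
  have h1 : cylR (-ξ) a < γ := by
    rw [← h.robin]
    exact cylR_lt_of_ne h.pos h.crit fun h2 => hne (by linarith)
  obtain ⟨c, -, hc⟩ := exists_hasDerivAt_cylR_right (-ξ) h.pos
  have h2 : ∀ᶠ b in 𝓝[<] a, cylR (-ξ) b < γ ∧ 0 < b ∧ b < a :=
    ((hc.continuousAt.eventually (gt_mem_nhds h1)).filter_mono nhdsWithin_le_nhds).and
      (Eventually.and (nhdsWithin_le_nhds (Ioi_mem_nhds h.pos)) self_mem_nhdsWithin)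
  obtain ⟨b, hb1, hb2, hb3⟩ := h2.exists
  have := firstEigenvalue_ge hb2 hb1.le
  linarith

theorem firstEigenvalue_minimal_iff {γ s a : ℝ} (h : IsCrit γ s a) (x : ℝ) :
    (∀ y, firstEigenvalue γ x ≤ firstEigenvalue γ y) ↔ x = -s := by
  constructor
  · intro hx
    by_contra hne
    have h1 := lt_firstEigenvalue h hne
    have h2 := hx (-s)
    rw [firstEigenvalue_crit h] at h2
    linarith
  · rintro rfl y
    rw [firstEigenvalue_crit h]
    rcases eq_or_ne y (-s) with rfl | hne
    · exact (firstEigenvalue_crit h).ge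
    · exact (lt_firstEigenvalue h hne).le

/-! ### The normalized ground state -/

lemma SolvesEigenEquation.const_mul {γ ξ lam : ℝ} {u : ℝ → ℂ} (h : SolvesEigenEquation γ ξ lam u)
    (c : ℂ) : SolvesEigenEquation γ ξ lam fun t => c * u t := by
  obtain ⟨u₁, u₂, hd, hae⟩ := h
  have key : ∀ {f g : ℝ → ℂ}, HasSobolevDeriv f g →
      HasSobolevDeriv (fun t => c * f t) fun t => c * g t := by
    intro f g hfg
    refine ⟨hfg.memLp.const_mul c, hfg.memLp_deriv.const_mul c, fun t ht => ?_⟩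
    rw [intervalIntegral.integral_const_mul, hfg.eq_integral t ht, mul_add]
  refine ⟨fun t => c * u₁ t, fun t => c * u₂ t, ⟨key hd.deriv_one, key hd.deriv_two, ?_, ?_⟩, ?_⟩
  · refine (hd.weight.const_mul c).ae_eq (Eventually.of_forall fun t => ?_)
    simp only; ring
  · rw [hd.robin]; ring
  · filter_upwards [hae] with t ht
    linear_combination c * ht

/-- Every square integrable solution at a critical parameter pair is a multiple of `cylU`. -/
theorem SolvesEigenEquation.eq_const_mul_cylU {γ s a : ℝ} (h : IsCrit γ s a) {u : ℝ → ℂ}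
    (hu : SolvesEigenEquation γ (-s) (1 - 2 * a) u) :
    ∀ t, 0 < t → u t = u 1 / ((cylU s a 1 : ℝ) : ℂ) * ((cylU s a t : ℝ) : ℂ) := by
  have hd := (hu.rigidity h.pos le_rfl (by rw [neg_neg, h.robin])).1
  have hne : ∀ t, ((cylU s a t : ℝ) : ℂ) ≠ 0 := fun t => by
    exact_mod_cast (cylU_pos s t h.pos).ne'
  have hq : ∀ t ∈ Ioi (0 : ℝ), HasDerivAt (fun t => u t / ((cylU s a t : ℝ) : ℂ)) 0 t := by
    intro t ht
    have h1 := (hd t ht).div (hasDerivAt_cylU s t h.pos).ofReal_comp (hne t)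
    refine h1.congr_deriv ?_
    rw [sub_neg_eq_add]
    push_cast
    have := hne t
    field_simp
    ring
  intro t ht
  have := isOpen_Ioi.is_const_of_deriv_eq_zero isPreconnected_Ioi
    (fun x hx => (hq x hx).differentiableAt.differentiableWithinAt)
    (fun x hx => (hq x hx).deriv) ht (mem_Ioi.2 (one_pos (α := ℝ)))
  rw [← this, div_mul_cancel₀ _ (hne t)]

/-- The `L²`-valued parabolic cylinder function. -/
def cylLp : ℝ × ℝ → Lp ℂ 2 halfLineMeasure := (exists_contDiffOn_Lp 2 (Or.inl rfl)).choose

lemma cylLp_ae_eq {p : ℝ × ℝ} (hp : p ∈ upperParams) :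
    cylLp p =ᵐ[halfLineMeasure] fun t => ((cylFun 0 0 p t : ℝ) : ℂ) :=
  (exists_contDiffOn_Lp 2 (Or.inl rfl)).choose_spec.1 p hp

lemma contDiffOn_cylLp : ContDiffOn ℝ ((⊤ : ℕ∞) : WithTop ℕ∞) cylLp upperParams :=
  (exists_contDiffOn_Lp 2 (Or.inl rfl)).choose_spec.2

lemma cylLp_ne_zero {p : ℝ × ℝ} (hp : p ∈ upperParams) : cylLp p ≠ 0 := by
  intro h
  have h1 := cylLp_ae_eq hp
  rw [h] at h1
  have ha : 0 < p.2 := hp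
  refine not_ae_eq_zero_cylU (s := p.1) ha ?_
  filter_upwards [h1, Lp.coeFn_zero ℂ 2 halfLineMeasure] with t h2 h3
  rw [h3, Pi.zero_apply, show p = (p.1, p.2) from rfl, cylFun_eq_cylU] at h2
  have h4 : Real.exp (p.1 ^ 2 / 2) * cylU p.1 p.2 t = 0 := by exact_mod_cast h2.symm
  simp [(mul_eq_zero.1 h4).resolve_left (Real.exp_pos _).ne']

/-- The normalized ground state. -/
def groundState (γ : ℝ) : Lp ℂ 2 halfLineMeasure :=
  ‖cylLp (critPair γ)‖⁻¹ • cylLp (critPair γ)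

lemma norm_cylLp_critPair_pos (γ : ℝ) : 0 < ‖cylLp (critPair γ)‖ :=
  norm_pos_iff.2 (cylLp_ne_zero (critPair_mem γ))

lemma contDiff_cylLp_critPair :
    ContDiff ℝ ((⊤ : ℕ∞) : WithTop ℕ∞) fun γ => cylLp (critPair γ) :=
  contDiffOn_univ.1 (contDiffOn_cylLp.comp contDiff_critPair.contDiffOn fun γ _ => critPair_mem γ)

lemma contDiff_inv_norm_cylLp :
    ContDiff ℝ ((⊤ : ℕ∞) : WithTop ℕ∞) fun γ => ‖cylLp (critPair γ)‖⁻¹ :=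
  (contDiff_cylLp_critPair.norm ℂ fun γ => cylLp_ne_zero (critPair_mem γ)).inv
    fun γ => (norm_cylLp_critPair_pos γ).ne'

theorem contDiff_groundState : ContDiff ℝ ((⊤ : ℕ∞) : WithTop ℕ∞) groundState :=
  contDiff_inv_norm_cylLp.smul contDiff_cylLp_critPair

/-- The L^∞-valued family is multiplied by the same scalar, the inverse L² norm; the product is
smooth, hence C¹ and locally Lipschitz. -/
theorem exists_memLp_top_locallyLipschitz :
    ∃ hφ : ∀ γ : ℝ, MemLp (groundState γ) (⊤ : ENNReal) halfLineMeasure,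
      LocallyLipschitz (fun γ : ℝ =>
        ((hφ γ).toLp (groundState γ) : Lp ℂ (⊤ : ENNReal) halfLineMeasure)) := by
  obtain ⟨F, hF, hFC⟩ := exists_contDiffOn_Lp ⊤ (Or.inr rfl)
  set Φ : ℝ → Lp ℂ ⊤ halfLineMeasure := fun γ => ‖cylLp (critPair γ)‖⁻¹ • F (critPair γ) with hΦ
  have hΦC : ContDiff ℝ ((⊤ : ℕ∞) : WithTop ℕ∞) Φ := contDiff_inv_norm_cylLp.smul
    (contDiffOn_univ.1 (hFC.comp contDiff_critPair.contDiffOn fun γ _ => critPair_mem γ))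
  have hae : ∀ γ, Φ γ =ᵐ[halfLineMeasure] groundState γ := by
    intro γ
    filter_upwards [Lp.coeFn_smul ‖cylLp (critPair γ)‖⁻¹ (F (critPair γ)),
      Lp.coeFn_smul ‖cylLp (critPair γ)‖⁻¹ (cylLp (critPair γ)), hF _ (critPair_mem γ),
      cylLp_ae_eq (critPair_mem γ)] with t h1 h2 h3 h4
    rw [h1, groundState, h2, Pi.smul_apply, Pi.smul_apply, h3, h4]
  refine ⟨fun γ => (Lp.memLp (Φ γ)).ae_eq (hae γ), ?_⟩
  have h1 : LocallyLipschitz Φ := (hΦC.of_le (by exact_mod_cast le_top)).locallyLipschitz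
  convert h1 using 2 with γ
  rw [← Lp.toLp_coeFn (Φ γ) (Lp.memLp _)]
  exact MemLp.toLp_congr _ _ (hae γ).symm

/-- Simplicity leaves one complex constant; positivity at t = 1 makes it a positive real and the
norm then fixes it. -/
theorem isPositiveNormalizedEigenfunction_iff (γ : ℝ) (f : Lp ℂ 2 halfLineMeasure) :
    IsPositiveNormalizedEigenfunction γ (-(critPair γ).1) (1 - 2 * (critPair γ).2) f ↔
      f = groundState γ := by
  have hcr := isCrit_critPair γ
  have hN := norm_cylLp_critPair_pos γ
  set s := (critPair γ).1 with hs
  set a := (critPair γ).2 with ha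
  set N := ‖cylLp (critPair γ)‖ with hNdef
  have hae : cylLp (critPair γ) =ᵐ[halfLineMeasure]
      fun t => ((Real.exp (s ^ 2 / 2) * cylU s a t : ℝ) : ℂ) := by
    filter_upwards [cylLp_ae_eq (critPair_mem γ)] with t ht
    rw [ht, ← cylFun_eq_cylU]
  constructor
  · rintro ⟨hnorm, u, hfu, hsol, hpos⟩
    have hform := hsol.eq_const_mul_cylU hcr
    set k := (u 1).re / cylU s a 1 with hk
    have hU1 := cylU_pos s 1 hcr.pos
    have hkpos : 0 < k := div_pos (hpos 1 zero_le_one).1 hU1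
    have hu1 : u 1 = (((u 1).re : ℝ) : ℂ) := by
      apply Complex.ext
      · simp
      · simp [(hpos 1 zero_le_one).2]
    have hkc : u 1 / ((cylU s a 1 : ℝ) : ℂ) = (k : ℂ) := by
      rw [hk, hu1]; push_cast; simp
    have hfk : f = (k * (Real.exp (s ^ 2 / 2))⁻¹) • cylLp (critPair γ) := by
      refine Lp.ext ?_
      filter_upwards [hfu, hae, ae_restrict_mem measurableSet_Ioi,
        Lp.coeFn_smul (k * (Real.exp (s ^ 2 / 2))⁻¹) (cylLp (critPair γ))] with t h1 h2 h3 h4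
      rw [h1, h4, Pi.smul_apply, h2, hform t h3, hkc, Complex.real_smul]
      have : ((Real.exp (s ^ 2 / 2) : ℝ) : ℂ) ≠ 0 := by exact_mod_cast (Real.exp_pos _).ne'
      push_cast at this ⊢
      field_simp
    rw [hfk, norm_smul, Real.norm_of_nonneg (by positivity)] at hnorm
    rw [hfk, groundState, ← hNdef, eq_inv_of_mul_eq_one_left hnorm]
  · rintro rfl
    refine ⟨?_, fun t => ((N⁻¹ * Real.exp (s ^ 2 / 2) : ℝ) : ℂ) * ((cylU s a t : ℝ) : ℂ), ?_, ?_, ?_⟩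
    · rw [groundState, norm_smul, norm_inv, norm_norm, inv_mul_cancel₀ hN.ne']
    · filter_upwards [hae, Lp.coeFn_smul N⁻¹ (cylLp (critPair γ))] with t h1 h2
      rw [groundState, ← hNdef, h2, Pi.smul_apply, h1, Complex.real_smul]
      push_cast
      ring
    · have := solvesEigenEquation_cylU (s := s) hcr.pos
      rw [hcr.robin] at this
      exact this.const_mul _
    · intro t _
      have h1 := cylU_pos s t hcr.pos
      simp only
      rw [← Complex.ofReal_mul, Complex.ofReal_re, Complex.ofReal_im]
      exact ⟨by positivity, rfl⟩

/-! ### The half-plane model: upper bound -/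

lemma halfPlane_eq_prod : halfPlane = univ ×ˢ Ioi (0 : ℝ) := by
  ext x; simp [halfPlane]

lemma halfPlaneMeasure_eq_prod :
    halfPlaneMeasure = (volume : Measure ℝ).prod halfLineMeasure := by
  rw [halfPlaneMeasure, halfPlane_eq_prod, Measure.volume_eq_prod, ← Measure.prod_restrict,
    Measure.restrict_univ]

lemma hasCompactSupport_prodMk_left {W : ℝ × ℝ → ℂ} (hW : HasCompactSupport W) (x : ℝ) :
    HasCompactSupport fun t => W (x, t) := by
  refine HasCompactSupport.intro (hW.isCompact.image continuous_snd) fun t ht => ?_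
  by_contra h
  exact ht ⟨(x, t), subset_tsupport _ h, rfl⟩

lemma hasCompactSupport_prodMk_right {W : ℝ × ℝ → ℂ} (hW : HasCompactSupport W) (t : ℝ) :
    HasCompactSupport fun x => W (x, t) := by
  refine HasCompactSupport.intro (hW.isCompact.image continuous_fst) fun x hx => ?_
  by_contra h
  exact hx ⟨(x, t), subset_tsupport _ h, rfl⟩

theorem integral_halfPlane_deriv_snd {W W₂ : ℝ × ℝ → ℂ} (hW : HasCompactSupport W)
    (hWc : Continuous W) (hW₂ : HasCompactSupport W₂) (hW₂c : Continuous W₂)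
    (hd : ∀ x t, HasDerivAt (fun t => W (x, t)) (W₂ (x, t)) t) :
    ∫ z in halfPlane, W₂ z = -∫ x : ℝ, W (x, 0) := by
  have hint : Integrable W₂ halfPlaneMeasure := (hW₂c.integrable_of_hasCompactSupport hW₂).restrict
  change ∫ z, W₂ z ∂halfPlaneMeasure = _
  rw [halfPlaneMeasure_eq_prod] at hint ⊢
  rw [integral_prod _ hint, ← integral_neg]
  congr 1
  ext x
  have hc : Continuous fun t => W (x, t) := by fun_prop
  have h1 := integral_Ioi_of_hasDerivAt_of_tendsto (a := 0) (m := 0)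
    (hc.continuousAt.continuousWithinAt) (fun t _ => hd x t)
    (Continuous.integrable_of_hasCompactSupport (by fun_prop)
      (hasCompactSupport_prodMk_left hW₂ x)).integrableOn ?_
  · rw [h1, zero_sub]
  · exact ((hasCompactSupport_prodMk_left hW x).is_zero_at_infty).mono_left atTop_le_cocompact

theorem integral_halfPlane_deriv_fst {W W₁ : ℝ × ℝ → ℂ} (hW : HasCompactSupport W)
    (hW₁ : HasCompactSupport W₁) (hW₁c : Continuous W₁)
    (hd : ∀ x t, HasDerivAt (fun x => W (x, t)) (W₁ (x, t)) x) :
    ∫ z in halfPlane, W₁ z = 0 := by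
  have hint : Integrable W₁ halfPlaneMeasure := (hW₁c.integrable_of_hasCompactSupport hW₁).restrict
  change ∫ z, W₁ z ∂halfPlaneMeasure = _
  rw [halfPlaneMeasure_eq_prod] at hint ⊢
  rw [integral_prod_symm _ hint]
  refine integral_eq_zero_of_ae (Eventually.of_forall fun t => ?_)
  have h0 := (hasCompactSupport_prodMk_right hW t).is_zero_at_infty
  have h1 := integral_of_hasDerivAt_of_tendsto (fun x => hd x t)
    (Continuous.integrable_of_hasCompactSupport (by fun_prop)
      (hasCompactSupport_prodMk_right hW₁ t)) (h0.mono_left atBot_le_cocompact)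
      (h0.mono_left atTop_le_cocompact)
  simpa using h1

lemma hasDerivAt_fderiv_snd {ψ : ℝ × ℝ → ℂ} (hψ : ContDiff ℝ ((⊤ : ℕ∞) : WithTop ℕ∞) ψ) (x t : ℝ) :
    HasDerivAt (fun t => ψ (x, t)) (fderiv ℝ ψ (x, t) (0, 1)) t :=
  ((hψ.differentiable (by simp) (x, t)).hasFDerivAt).comp_hasDerivAt t
    ((hasDerivAt_const t x).prodMk (hasDerivAt_id t))

lemma hasDerivAt_fderiv_fst {ψ : ℝ × ℝ → ℂ} (hψ : ContDiff ℝ ((⊤ : ℕ∞) : WithTop ℕ∞) ψ) (x t : ℝ) :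
    HasDerivAt (fun x => ψ (x, t)) (fderiv ℝ ψ (x, t) (1, 0)) x :=
  ((hψ.differentiable (by simp) (x, t)).hasFDerivAt).comp_hasDerivAt x
    ((hasDerivAt_id x).prodMk (hasDerivAt_const x t))

lemma continuous_fderiv_apply_of_smooth {ψ : ℝ × ℝ → ℂ}
    (hψ : ContDiff ℝ ((⊤ : ℕ∞) : WithTop ℕ∞) ψ) (v : ℝ × ℝ) :
    Continuous fun z => fderiv ℝ ψ z v :=
  (hψ.continuous_fderiv (by simp)).clm_apply continuous_const

lemma hasCompactSupport_fderiv_apply {ψ : ℝ × ℝ → ℂ} (h : HasCompactSupport ψ) (v : ℝ × ℝ) :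
    HasCompactSupport fun z => fderiv ℝ ψ z v :=
  h.fderiv_apply ℝ v

theorem green_snd_of_hasDerivAt {u d ψ : ℝ × ℝ → ℂ} (hu : Continuous u) (hdc : Continuous d)
    (hd : ∀ x t, HasDerivAt (fun t => u (x, t)) (d (x, t)) t)
    (hψ : ContDiff ℝ ((⊤ : ℕ∞) : WithTop ℕ∞) ψ) (hψc : HasCompactSupport ψ) :
    ∫ z in halfPlane, u z * fderiv ℝ ψ z (0, 1) =
      -(∫ z in halfPlane, d z * ψ z) - ∫ x : ℝ, u (x, 0) * ψ (x, 0) := by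
  have hψ0 := hψ.continuous
  have hψ1 := continuous_fderiv_apply_of_smooth hψ (0, 1)
  have c1 : HasCompactSupport fun z => u z * fderiv ℝ ψ z (0, 1) :=
    (hasCompactSupport_fderiv_apply hψc (0, 1)).mul_left
  have c2 : HasCompactSupport fun z => d z * ψ z := hψc.mul_left
  have h := integral_halfPlane_deriv_snd (W := fun z => u z * ψ z)
    (W₂ := fun z => d z * ψ z + u z * fderiv ℝ ψ z (0, 1)) (hψc.mul_left (f := u))
    (by fun_prop) (c2.add c1) (by fun_prop)
    (fun x t => (hd x t).mul (hasDerivAt_fderiv_snd hψ x t))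
  have i1 : IntegrableOn (fun z => u z * fderiv ℝ ψ z (0, 1)) halfPlane :=
    ((hu.mul hψ1).integrable_of_hasCompactSupport (μ := volume) c1).restrict
  have i2 : IntegrableOn (fun z => d z * ψ z) halfPlane :=
    ((hdc.mul hψ0).integrable_of_hasCompactSupport (μ := volume) c2).restrict
  rw [integral_add i2 i1] at h
  linear_combination h

theorem green_fst_of_hasDerivAt {u d ψ : ℝ × ℝ → ℂ} (hu : Continuous u) (hdc : Continuous d)
    (hd : ∀ x t, HasDerivAt (fun x => u (x, t)) (d (x, t)) x)
    (hψ : ContDiff ℝ ((⊤ : ℕ∞) : WithTop ℕ∞) ψ) (hψc : HasCompactSupport ψ) :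
    ∫ z in halfPlane, u z * fderiv ℝ ψ z (1, 0) = -(∫ z in halfPlane, d z * ψ z) := by
  have hψ0 := hψ.continuous
  have hψ1 := continuous_fderiv_apply_of_smooth hψ (1, 0)
  have c1 : HasCompactSupport fun z => u z * fderiv ℝ ψ z (1, 0) :=
    (hasCompactSupport_fderiv_apply hψc (1, 0)).mul_left
  have c2 : HasCompactSupport fun z => d z * ψ z := hψc.mul_left
  have h := integral_halfPlane_deriv_fst (W := fun z => u z * ψ z)
    (W₁ := fun z => d z * ψ z + u z * fderiv ℝ ψ z (1, 0)) (hψc.mul_left (f := u))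
    (c2.add c1) (by fun_prop)
    (fun x t => (hd x t).mul (hasDerivAt_fderiv_fst hψ x t))
  have i1 : IntegrableOn (fun z => u z * fderiv ℝ ψ z (1, 0)) halfPlane :=
    ((hu.mul hψ1).integrable_of_hasCompactSupport (μ := volume) c1).restrict
  have i2 : IntegrableOn (fun z => d z * ψ z) halfPlane :=
    ((hdc.mul hψ0).integrable_of_hasCompactSupport (μ := volume) c2).restrict
  rw [integral_add i2 i1] at h
  linear_combination h

/-! #### One-dimensional energy of the ground state -/

lemma ExpGrowth.integrableOn_sq {f : ℝ → ℝ} (hf : ExpGrowth f) (s : ℝ) :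
    IntegrableOn (fun t : ℝ => (Real.exp (-(t + s) ^ 2 / 2) * f (t + s)) ^ 2) (Ioi 0) := by
  have := integrableOn_sq_of_memLp (hf.memLp s) Complex.reCLM
  refine this.congr_fun (fun t _ => ?_) measurableSet_Ioi
  simp only [Complex.reCLM_apply, Complex.ofReal_re]

/-- The derivative of `cylU`. -/
def cylU' (s a t : ℝ) : ℝ := cylR (t + s) a * cylU s a t

lemma hasDerivAt_cylU' (s t : ℝ) {a : ℝ} (ha : 0 < a) :
    HasDerivAt (cylU' s a) (((t + s) ^ 2 - (1 - 2 * a)) * cylU s a t) t := by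
  refine (((hasDerivAt_cylR_left (t + s) ha).comp_add_const t s).mul
    (hasDerivAt_cylU s t ha)).congr_deriv ?_
  rw [cylD]
  ring

lemma continuous_cylU (s : ℝ) {a : ℝ} (ha : 0 < a) : Continuous (cylU s a) :=
  continuous_iff_continuousAt.2 fun t => (hasDerivAt_cylU s t ha).continuousAt

lemma continuous_cylU' (s : ℝ) {a : ℝ} (ha : 0 < a) : Continuous (cylU' s a) :=
  continuous_iff_continuousAt.2 fun t => (hasDerivAt_cylU' s t ha).continuousAt

lemma integrableOn_cylU_sq (s : ℝ) {a : ℝ} (ha : 0 < a) :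
    IntegrableOn (fun t => cylU s a t ^ 2) (Ioi 0) :=
  (expGrowth_cylI ha).integrableOn_sq s

lemma integrableOn_mul_cylU_sq (s : ℝ) {a : ℝ} (ha : 0 < a) :
    IntegrableOn (fun t => ((t + s) * cylU s a t) ^ 2) (Ioi 0) := by
  refine ((expGrowth_id.mul (expGrowth_cylI ha)).integrableOn_sq s).congr_fun (fun t _ => ?_)
    measurableSet_Ioi
  simp only [cylU]
  ring

lemma integrableOn_cylU'_sq (s : ℝ) {a : ℝ} (ha : 0 < a) :
    IntegrableOn (fun t => cylU' s a t ^ 2) (Ioi 0) := by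
  have hG : ExpGrowth fun τ => -1 * τ * cylI τ a + -2 * cylI τ (a + 1) :=
    (((expGrowth_const (-1)).mul expGrowth_id).mul (expGrowth_cylI ha)).add
      ((expGrowth_const (-2)).mul (expGrowth_cylI (by linarith)))
  refine (hG.integrableOn_sq s).congr_fun (fun t _ => ?_) measurableSet_Ioi
  have h3 : cylI (t + s) (a + 1) = cylQ (t + s) a * cylI (t + s) a :=
    (div_mul_cancel₀ _ (cylI_pos _ ha).ne').symm
  simp only [cylU', cylU, cylR, h3]
  ring

/-- Integrate (U U')': the boundary term at 0 is the Robin term, since U'(0) = R(s, a) U(0). -/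
theorem energy_cylU (s : ℝ) {a : ℝ} (ha : 0 < a) :
    (∫ t in Ioi (0 : ℝ), (cylU' s a t ^ 2 + ((t + s) * cylU s a t) ^ 2)) +
      cylR s a * cylU s a 0 ^ 2 = (1 - 2 * a) * ∫ t in Ioi (0 : ℝ), cylU s a t ^ 2 := by
  have i0 := (integrableOn_cylU_sq s ha).const_mul (1 - 2 * a)
  have i1 : IntegrableOn (fun t => cylU' s a t ^ 2 + ((t + s) * cylU s a t) ^ 2) (Ioi 0) :=
    (integrableOn_cylU'_sq s ha).add (integrableOn_mul_cylU_sq s ha)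
  have hd : ∀ t, HasDerivAt (fun t => cylU s a t * cylU' s a t)
      (cylU' s a t ^ 2 + ((t + s) * cylU s a t) ^ 2 - (1 - 2 * a) * cylU s a t ^ 2) t := by
    intro t
    refine ((hasDerivAt_cylU s t ha).mul (hasDerivAt_cylU' s t ha)).congr_deriv ?_
    rw [cylU']
    ring
  have i2 : IntegrableOn (fun t => cylU s a t * cylU' s a t) (Ioi 0) := by
    refine Integrable.mono' ((integrableOn_cylU_sq s ha).add (integrableOn_cylU'_sq s ha))
      ((continuous_cylU s ha).mul (continuous_cylU' s ha)).aestronglyMeasurable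
      (Eventually.of_forall fun t => ?_)
    simp only [Pi.add_apply]
    rw [Real.norm_eq_abs, abs_le]
    constructor <;> nlinarith [sq_nonneg (cylU s a t - cylU' s a t),
      sq_nonneg (cylU s a t + cylU' s a t), sq_nonneg (cylU s a t), sq_nonneg (cylU' s a t)]
  have h1 := integral_Ioi_of_hasDerivAt_of_tendsto (a := 0) (m := 0)
    ((hd 0).continuousAt.continuousWithinAt) (fun t _ => hd t) (i1.sub i0)
    (tendsto_zero_of_hasDerivAt_of_integrableOn_Ioi (fun t _ => hd t) (i1.sub i0) i2)
  rw [integral_sub i1 i0, integral_const_mul] at h1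
  simp only [cylU', zero_add] at h1 ⊢
  linarith

/-! #### Trial states -/

/-- The gauge factor of the trial states. -/
def trialPhase (s : ℝ) (x : ℝ × ℝ) : ℂ := Complex.exp (((x.1 * x.2 / 2 + s * x.1 : ℝ) : ℂ) * Complex.I)

lemma norm_trialPhase (s : ℝ) (x : ℝ × ℝ) : ‖trialPhase s x‖ = 1 :=
  Complex.norm_exp_ofReal_mul_I _

lemma continuous_trialPhase (s : ℝ) : Continuous (trialPhase s) := by
  unfold trialPhase
  fun_prop

lemma hasDerivAt_trialPhase_fst (s x t : ℝ) : HasDerivAt (fun x => trialPhase s (x, t))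
    (trialPhase s (x, t) * (((t / 2 + s : ℝ) : ℂ) * Complex.I)) x := by
  have h1 : HasDerivAt (fun x : ℝ => x * t / 2 + s * x) (t / 2 + s) x := by
    refine ((((hasDerivAt_id x).mul_const t).div_const 2).add
      ((hasDerivAt_id x).const_mul s)).congr_deriv ?_
    ring
  exact (h1.ofReal_comp.mul_const Complex.I).cexp

lemma hasDerivAt_trialPhase_snd (s x t : ℝ) : HasDerivAt (fun t => trialPhase s (x, t))
    (trialPhase s (x, t) * (((x / 2 : ℝ) : ℂ) * Complex.I)) t := by
  have h1 : HasDerivAt (fun t : ℝ => x * t / 2 + s * x) (x / 2) t := by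
    refine ((((hasDerivAt_id t).const_mul x).div_const 2).add_const (s * x)).congr_deriv ?_
    ring
  exact (h1.ofReal_comp.mul_const Complex.I).cexp

section trial

variable {χ χ' φ φ' : ℝ → ℝ} {s : ℝ}

/-- The trial state built from a longitudinal profile `χ` and a transversal profile `φ`. -/
def trialState (s : ℝ) (χ φ : ℝ → ℝ) (x : ℝ × ℝ) : ℂ :=
  trialPhase s x * ((χ x.1 * φ x.2 : ℝ) : ℂ)

/-- The first component of the magnetic gradient of the trial state. -/
def trialGradFst (s : ℝ) (χ χ' φ : ℝ → ℝ) (x : ℝ × ℝ) : ℂ :=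
  trialPhase s x * (((χ' x.1 * φ x.2 : ℝ) : ℂ) + ((χ x.1 * ((x.2 + s) * φ x.2) : ℝ) : ℂ) * Complex.I)

lemma memLp_prod {f g : ℝ → ℝ} (hf : Integrable fun x => f x ^ 2)
    (hg : IntegrableOn (fun t => g t ^ 2) (Ioi 0))
    {v : ℝ × ℝ → ℂ} (hv : Continuous v) (h : ∀ x, ‖v x‖ ^ 2 = f x.1 ^ 2 * g x.2 ^ 2) :
    MemLp v 2 halfPlaneMeasure := by
  rw [memLp_two_iff_integrable_sq_norm hv.aestronglyMeasurable]
  simp only [h]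
  rw [halfPlaneMeasure_eq_prod]
  exact hf.mul_prod hg

lemma norm_trialState_sq (x : ℝ × ℝ) : ‖trialState s χ φ x‖ ^ 2 = χ x.1 ^ 2 * φ x.2 ^ 2 := by
  rw [trialState, norm_mul, norm_trialPhase, one_mul, Complex.norm_real, Real.norm_eq_abs, sq_abs,
    mul_pow]

lemma norm_trialGradFst_sq (x : ℝ × ℝ) : ‖trialGradFst s χ χ' φ x‖ ^ 2 =
    χ' x.1 ^ 2 * φ x.2 ^ 2 + χ x.1 ^ 2 * ((x.2 + s) * φ x.2) ^ 2 := by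
  rw [trialGradFst, norm_mul, norm_trialPhase, one_mul, ← Complex.normSq_eq_norm_sq,
    Complex.normSq_add_mul_I]
  ring

/-- The phase has gradient (x₂/2 + s, x₁/2), which exceeds A₀ by (x₂ + s, 0). Hence only the first
component of the magnetic gradient carries a potential, the one of the half-line operator. -/
lemma hasDerivAt_trialState_fst (hχ : ∀ x, HasDerivAt χ (χ' x) x) (x t : ℝ) :
    HasDerivAt (fun x => trialState s χ φ (x, t)) (trialGradFst s χ χ' φ (x, t) +
      Complex.I * (magA1 (x, t) : ℂ) * trialState s χ φ (x, t)) x := by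
  refine ((hasDerivAt_trialPhase_fst s x t).mul
    ((hχ x).mul_const (φ t)).ofReal_comp).congr_deriv ?_
  simp only [trialGradFst, trialState, magA1]
  push_cast
  ring

lemma hasDerivAt_trialState_snd (hφ : ∀ t, HasDerivAt φ (φ' t) t) (x t : ℝ) :
    HasDerivAt (fun t => trialState s χ φ (x, t)) (trialState s χ φ' (x, t) +
      Complex.I * (magA2 (x, t) : ℂ) * trialState s χ φ (x, t)) t := by
  refine ((hasDerivAt_trialPhase_snd s x t).mul
    ((hφ t).const_mul (χ x)).ofReal_comp).congr_deriv ?_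
  simp only [trialState, magA2]
  push_cast
  ring

lemma continuous_trialState (hχ : Continuous χ) (hφ : Continuous φ) :
    Continuous (trialState s χ φ) := by
  have := continuous_trialPhase s
  unfold trialState
  fun_prop

lemma continuous_trialGradFst (hχ : Continuous χ) (hχ' : Continuous χ') (hφ : Continuous φ) :
    Continuous (trialGradFst s χ χ' φ) := by
  have := continuous_trialPhase s
  unfold trialGradFst
  fun_prop

theorem hasMagneticGradient_trialState (hχ : ∀ x, HasDerivAt χ (χ' x) x) (hχ' : Continuous χ')
    (hφ : ∀ t, HasDerivAt φ (φ' t) t) (hφ' : Continuous φ')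
    (iχ : Integrable fun x => χ x ^ 2) (iχ' : Integrable fun x => χ' x ^ 2)
    (iφ : IntegrableOn (fun t => φ t ^ 2) (Ioi 0)) (iφ' : IntegrableOn (fun t => φ' t ^ 2) (Ioi 0))
    (iw : IntegrableOn (fun t => ((t + s) * φ t) ^ 2) (Ioi 0)) :
    HasMagneticGradient (trialState s χ φ) (trialGradFst s χ χ' φ) (trialState s χ φ') ∧
      IsBoundaryTrace (trialState s χ φ) (trialState s χ φ') fun x => trialState s χ φ (x, 0) := by
  have cχ : Continuous χ := continuous_iff_continuousAt.2 fun x => (hχ x).continuousAt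
  have cφ : Continuous φ := continuous_iff_continuousAt.2 fun x => (hφ x).continuousAt
  have cu : Continuous (trialState s χ φ) := continuous_trialState cχ cφ
  have cu' : Continuous (trialState s χ φ') := continuous_trialState cχ hφ'
  have cp := continuous_trialGradFst (s := s) cχ hχ' cφ
  have cA1 : Continuous magA1 := by unfold magA1; fun_prop
  have cA2 : Continuous magA2 := by unfold magA2; fun_prop
  have cd1 : Continuous fun z => trialGradFst s χ χ' φ z +
      Complex.I * (magA1 z : ℂ) * trialState s χ φ z := by fun_prop
  have cd2 : Continuous fun z => trialState s χ φ' z +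
      Complex.I * (magA2 z : ℂ) * trialState s χ φ z := by fun_prop
  have green : ∀ ψ : ℝ × ℝ → ℂ, ContDiff ℝ ((⊤ : ℕ∞) : WithTop ℕ∞) ψ → HasCompactSupport ψ → _ :=
    fun ψ h1 h2 => green_snd_of_hasDerivAt cu cd2 (hasDerivAt_trialState_snd hφ) h1 h2
  refine ⟨⟨memLp_prod iχ iφ cu norm_trialState_sq, ?_,
    memLp_prod iχ iφ' cu' norm_trialState_sq,
    fun ψ h1 h2 _ => green_fst_of_hasDerivAt cu cd1 (hasDerivAt_trialState_fst hχ) h1 h2,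
    fun ψ h1 h2 h3 => ?_⟩, ⟨?_, green⟩⟩
  · rw [memLp_two_iff_integrable_sq_norm cp.aestronglyMeasurable]
    simp only [norm_trialGradFst_sq]
    rw [halfPlaneMeasure_eq_prod]
    exact (iχ'.mul_prod iφ).add (iχ.mul_prod iw)
  · rw [green ψ h1 h2]
    have : ∀ x : ℝ, ψ (x, 0) = 0 := fun x => by
      refine image_eq_zero_of_notMem_tsupport fun hx => ?_
      have : (0 : ℝ) < 0 := h3 hx
      exact lt_irrefl _ this
    simp [this]
  · have cg : Continuous fun x : ℝ => trialState s χ φ (x, 0) := by fun_prop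
    rw [memLp_two_iff_integrable_sq_norm cg.aestronglyMeasurable]
    simp only [norm_trialState_sq]
    exact iχ.mul_const _

end trial

/-! ### Rayleigh quotients of Gaussian trial states -/

lemma integral_gaussian_deriv_sq {b : ℝ} (hb : 0 < b) :
    Integrable (fun x : ℝ => (-b * x * Real.exp (-b * x ^ 2 / 2)) ^ 2) ∧
    ∫ x : ℝ, (-b * x * Real.exp (-b * x ^ 2 / 2)) ^ 2 = b / 2 * ∫ x : ℝ, Real.exp (-b * x ^ 2) := by
  have hE : ∀ x : ℝ, Real.exp (-b * x ^ 2 / 2) ^ 2 = Real.exp (-b * x ^ 2) := fun x => by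
    rw [← Real.exp_nat_mul]; congr 1; push_cast; ring
  have i2 : Integrable fun x : ℝ => x ^ 2 * Real.exp (-b * x ^ 2) := by
    have := integrable_rpow_mul_exp_neg_mul_sq hb (s := 2) (by norm_num)
    simpa using this
  have i1 := integrable_mul_exp_neg_mul_sq hb
  have i0 := integrable_exp_neg_mul_sq hb
  have hd : ∀ x : ℝ, HasDerivAt (fun x : ℝ => Real.exp (-b * x ^ 2))
      (-2 * b * x * Real.exp (-b * x ^ 2)) x := by
    intro x
    refine ((hasDerivAt_pow 2 x).const_mul (-b)).exp.congr_deriv ?_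
    push_cast; ring
  have h := integral_mul_deriv_eq_deriv_mul_of_integrable (u := fun x : ℝ => x)
    (u' := fun _ => 1) (v := fun x : ℝ => Real.exp (-b * x ^ 2))
    (v' := fun x => -2 * b * x * Real.exp (-b * x ^ 2)) (fun x _ => hasDerivAt_id x)
    (fun x _ => hd x)
    ((i2.const_mul (-2 * b)).congr (Eventually.of_forall fun x => by
      simp only [Pi.mul_apply]; ring))
    (by simpa [Pi.mul_def] using i0) i1
  have e1 : ∀ x : ℝ, x * (-2 * b * x * Real.exp (-b * x ^ 2)) =
      -2 * b * (x ^ 2 * Real.exp (-b * x ^ 2)) := fun x => by ring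
  have e2 : ∀ x : ℝ, (-b * x * Real.exp (-b * x ^ 2 / 2)) ^ 2 =
      b ^ 2 * (x ^ 2 * Real.exp (-b * x ^ 2)) := fun x => by rw [mul_pow, hE]; ring
  simp only [e1, one_mul] at h
  simp only [e2]
  rw [integral_const_mul] at h ⊢
  refine ⟨i2.const_mul _, ?_⟩
  linear_combination (-b / 2) * h

/-- The set of Rayleigh quotients of the half-plane model. -/
def rayleighSet (γ : ℝ) : Set ℝ :=
  {r : ℝ | ∃ (u p₁ p₂ : ℝ × ℝ → ℂ) (g : ℝ → ℂ),
    HasMagneticGradient u p₁ p₂ ∧ IsBoundaryTrace u p₂ g ∧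
    ¬ (u =ᵐ[halfPlaneMeasure] 0) ∧
    r = ((∫ x in halfPlane, (‖p₁ x‖ ^ 2 + ‖p₂ x‖ ^ 2)) + γ * ∫ s : ℝ, ‖g s‖ ^ 2) /
      ∫ x in halfPlane, ‖u x‖ ^ 2}

lemma Theta_eq (γ : ℝ) : Theta γ = sInf (rayleighSet γ) := rfl

/-- With real profiles the term in χ' and the potential term are orthogonal in ℂ, so the energies
add: 1 - 2a from the ground state and b/2 from the Gaussian. -/
theorem add_mem_rayleighSet {γ s a b : ℝ} (h : IsCrit γ s a) (hb : 0 < b) :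
    1 - 2 * a + b / 2 ∈ rayleighSet γ := by
  have ha := h.pos
  set χ : ℝ → ℝ := fun x => Real.exp (-b * x ^ 2 / 2) with hχdef
  set χ' : ℝ → ℝ := fun x => -b * x * Real.exp (-b * x ^ 2 / 2) with hχ'def
  have hχ2 : ∀ x : ℝ, χ x ^ 2 = Real.exp (-b * x ^ 2) := fun x => by
    simp only [hχdef]; rw [← Real.exp_nat_mul]; congr 1; push_cast; ring
  have hχ : ∀ x, HasDerivAt χ (χ' x) x := by
    intro x
    refine (((hasDerivAt_pow 2 x).const_mul (-b)).div_const 2).exp.congr_deriv ?_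
    simp only [hχ'def]; push_cast; ring
  have cχ' : Continuous χ' := by simp only [hχ'def]; fun_prop
  have iχ : Integrable fun x => χ x ^ 2 := by
    simp only [hχ2]; exact integrable_exp_neg_mul_sq hb
  obtain ⟨iχ', hχint⟩ := integral_gaussian_deriv_sq hb
  have iφ := integrableOn_cylU_sq s ha
  have iφ' := integrableOn_cylU'_sq s ha
  have iw := integrableOn_mul_cylU_sq s ha
  obtain ⟨hgrad, htrace⟩ := hasMagneticGradient_trialState (s := s) (φ' := cylU' s a) hχ cχ'
    (fun t => hasDerivAt_cylU s t ha) (continuous_cylU' s ha) iχ iχ' iφ iφ' iw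
  set m := ∫ x : ℝ, χ x ^ 2 with hm
  have hmpos : 0 < m := by
    rw [hm, integral_pos_iff_support_of_nonneg (fun x => sq_nonneg _) iχ]
    have : Function.support (fun x => χ x ^ 2) = univ := by
      ext x; simp [hχ2, Real.exp_ne_zero]
    rw [this]; simp
  set n := ∫ t in Ioi (0 : ℝ), cylU s a t ^ 2 with hn
  have hnpos : 0 < n := by
    rw [hn, setIntegral_pos_iff_support_of_nonneg_ae
      (Eventually.of_forall fun t => sq_nonneg _) iφ]
    have : Function.support (fun t => cylU s a t ^ 2) = univ := by
      ext t; simp [(cylU_pos s t ha).ne']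
    rw [this]; simp
  have hden : ∫ x in halfPlane, ‖trialState s χ (cylU s a) x‖ ^ 2 = m * n := by
    simp only [norm_trialState_sq]
    change ∫ x, _ ∂halfPlaneMeasure = _
    rw [halfPlaneMeasure_eq_prod, integral_prod_mul (fun x => χ x ^ 2) (fun t => cylU s a t ^ 2)]
  have hnum : ∫ x in halfPlane, (‖trialGradFst s χ χ' (cylU s a) x‖ ^ 2 +
      ‖trialState s χ (cylU' s a) x‖ ^ 2) = b / 2 * m * n +
        m * ∫ t in Ioi (0 : ℝ), (cylU' s a t ^ 2 + ((t + s) * cylU s a t) ^ 2) := by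
    have e : ∀ x : ℝ × ℝ, ‖trialGradFst s χ χ' (cylU s a) x‖ ^ 2 +
        ‖trialState s χ (cylU' s a) x‖ ^ 2 = χ' x.1 ^ 2 * cylU s a x.2 ^ 2 +
          χ x.1 ^ 2 * (cylU' s a x.2 ^ 2 + ((x.2 + s) * cylU s a x.2) ^ 2) := fun x => by
      rw [norm_trialGradFst_sq, norm_trialState_sq]; ring
    simp only [e]
    change ∫ x, _ ∂halfPlaneMeasure = _
    have iE : IntegrableOn (fun t => cylU' s a t ^ 2 + ((t + s) * cylU s a t) ^ 2) (Ioi 0) :=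
      iφ'.add iw
    rw [halfPlaneMeasure_eq_prod, integral_add (iχ'.mul_prod iφ) (iχ.mul_prod iE),
      integral_prod_mul (fun x => χ' x ^ 2) (fun t => cylU s a t ^ 2),
      integral_prod_mul (fun x => χ x ^ 2)
        (fun t => cylU' s a t ^ 2 + ((t + s) * cylU s a t) ^ 2)]
    congr 2
    simp only [hχ'def]
    rw [hχint, hm]
    simp only [hχ2]
  have hbd : ∫ x : ℝ, ‖trialState s χ (cylU s a) (x, 0)‖ ^ 2 = m * cylU s a 0 ^ 2 := by
    simp only [norm_trialState_sq]
    rw [integral_mul_const]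
  refine ⟨_, _, _, _, hgrad, htrace, fun hz => ?_, ?_⟩
  · have : ∫ x in halfPlane, ‖trialState s χ (cylU s a) x‖ ^ 2 = 0 := by
      refine integral_eq_zero_of_ae ?_
      filter_upwards [hz] with x hx
      rw [hx]; simp
    rw [hden] at this
    exact (mul_pos hmpos hnpos).ne' this
  · rw [hden, hnum, hbd, eq_div_iff (mul_pos hmpos hnpos).ne']
    have := energy_cylU s ha
    rw [h.robin, ← hn] at this
    linear_combination (-m) * this

/-! ### Weakly differentiable functions on the half-line -/

lemma intervalIntegrable_of_memLp {v : ℝ → ℝ} (hv : MemLp v 2 halfLineMeasure) {T : ℝ}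
    (hT : 0 ≤ T) : IntervalIntegrable v volume 0 T := by
  rw [intervalIntegrable_iff_integrableOn_Ioc_of_le hT]
  have h1 : MemLp v 2 (volume.restrict (Ioc 0 T)) :=
    hv.mono_measure (Measure.restrict_mono Ioc_subset_Ioi_self le_rfl)
  exact h1.integrable one_le_two

lemma absolutelyContinuous_primitive {v : ℝ → ℝ} (hv : MemLp v 2 halfLineMeasure) (c : ℝ) {T : ℝ}
    (hT : 0 ≤ T) : AbsolutelyContinuousOnInterval (fun t => c + ∫ x in (0 : ℝ)..t, v x) 0 T :=
  (contDiffOn_const.absolutelyContinuousOnInterval).fun_add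
    ((intervalIntegrable_of_memLp hv hT).absolutelyContinuousOnInterval_intervalIntegral (by simp))

lemma ae_hasDerivAt_primitive {v : ℝ → ℝ} (hv : MemLp v 2 halfLineMeasure) (c : ℝ) {T : ℝ}
    (hT : 0 ≤ T) :
    ∀ᵐ t, t ∈ uIcc 0 T → HasDerivAt (fun t => c + ∫ x in (0 : ℝ)..t, v x) (v t) t := by
  filter_upwards [(intervalIntegrable_of_memLp hv hT).ae_hasDerivAt_integral] with t ht hmem
  exact (ht hmem 0 (by simp)).const_add c

lemma continuousOn_primitive {v : ℝ → ℝ} (hv : MemLp v 2 halfLineMeasure) (c : ℝ) :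
    ContinuousOn (fun t => c + ∫ x in (0 : ℝ)..t, v x) (Ici 0) := by
  intro t ht
  have h1 := (absolutelyContinuous_primitive hv c
    (show (0 : ℝ) ≤ t + 1 by linarith [mem_Ici.1 ht])).continuousOn
  rw [uIcc_of_le (by linarith [mem_Ici.1 ht])] at h1
  refine (h1 t ⟨ht, by linarith⟩).mono_of_mem_nhdsWithin ?_
  rw [← Ici_inter_Iic]
  exact inter_mem self_mem_nhdsWithin (nhdsWithin_le_nhds (Iic_mem_nhds (by linarith)))

/-- The ground state inequality for weakly differentiable functions on the half-line. -/
theorem energy_ge_of_primitive {v : ℝ → ℝ} (hv : MemLp v 2 halfLineMeasure) {c γ ξ a : ℝ}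
    (ha : 0 < a) (hγ : cylR (-ξ) a ≤ γ)
    (hi : IntegrableOn (fun t => (c + ∫ x in (0 : ℝ)..t, v x) ^ 2) (Ioi 0))
    (hi₁ : IntegrableOn (fun t => ((t - ξ) * (c + ∫ x in (0 : ℝ)..t, v x)) ^ 2) (Ioi 0)) :
    (1 - 2 * a) * ∫ t in Ioi (0 : ℝ), (c + ∫ x in (0 : ℝ)..t, v x) ^ 2 ≤
      (∫ t in Ioi (0 : ℝ), v t ^ 2) +
        (∫ t in Ioi (0 : ℝ), ((t - ξ) * (c + ∫ x in (0 : ℝ)..t, v x)) ^ 2) + γ * c ^ 2 := by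
  set V : ℝ → ℝ := fun t => c + ∫ x in (0 : ℝ)..t, v x with hV
  have hV0 : V 0 = c := by simp [hV]
  have hiv : IntegrableOn (fun t => v t ^ 2) (Ioi 0) := hv.integrable_sq
  set H : ℝ → ℝ := fun t => v t ^ 2 + ((t - ξ) * V t) ^ 2 - (1 - 2 * a) * V t ^ 2 with hH
  have hHi : IntegrableOn H (Ioi 0) := (hiv.add hi₁).sub (hi.const_mul _)
  have hHint : ∫ t in Ioi (0 : ℝ), H t = (∫ t in Ioi (0 : ℝ), v t ^ 2) +
      (∫ t in Ioi (0 : ℝ), ((t - ξ) * V t) ^ 2) - (1 - 2 * a) * ∫ t in Ioi (0 : ℝ), V t ^ 2 := by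
    have h12 : IntegrableOn (fun t => v t ^ 2 + ((t - ξ) * V t) ^ 2) (Ioi 0) := hiv.add hi₁
    simp only [hH]
    rw [integral_sub h12 (hi.const_mul _), integral_add hiv hi₁, integral_const_mul]
  set f : ℝ → ℝ := fun t => cylR (t - ξ) a * (V t * V t) with hf
  have hRd : ∀ t, HasDerivAt (fun t => cylR (t - ξ) a) (cylD (t - ξ) a) t := fun t =>
    (hasDerivAt_cylR_left (t - ξ) ha).comp_sub_const t ξ
  have hRc : ContDiff ℝ 1 fun t => cylR (t - ξ) a := by
    have h1 : ContDiffOn ℝ 1 (fun t : ℝ => cylR (t - ξ) a) univ :=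
      (contDiffOn_cylR.of_le (by exact_mod_cast le_top)).comp
        (f := fun t : ℝ => (t - ξ, a)) (by fun_prop) fun t _ => ha
    exact contDiffOn_univ.1 h1
  -- Almost everywhere H - f' = (v - R V)². Absolute continuity of V suffices to integrate f'.
  have hstep : ∀ T, 0 ≤ T → f T - f 0 ≤ ∫ t in (0 : ℝ)..T, H t := by
    intro T hT
    have acV := absolutelyContinuous_primitive hv c hT
    have acf : AbsolutelyContinuousOnInterval f 0 T :=
      (hRc.contDiffOn.absolutelyContinuousOnInterval).fun_mul (acV.fun_mul acV)
    rw [← acf.integral_deriv_eq_sub]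
    refine intervalIntegral.integral_mono_ae_restrict hT acf.intervalIntegrable_deriv ?_ ?_
    · rw [intervalIntegrable_iff_integrableOn_Ioc_of_le hT]
      exact hHi.mono_set Ioc_subset_Ioi_self
    · filter_upwards [ae_restrict_of_ae (ae_hasDerivAt_primitive hv c hT),
        ae_restrict_mem measurableSet_Icc] with t ht hmem
      rw [uIcc_of_le hT] at ht
      have h1 := ((hRd t).mul ((ht hmem).mul (ht hmem))).deriv
      have h2 : deriv f t = cylD (t - ξ) a * (V t * V t) +
          cylR (t - ξ) a * (v t * V t + V t * v t) := h1
      rw [h2]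
      simp only [hH, cylD]
      nlinarith [sq_nonneg (v t - cylR (t - ξ) a * V t)]
  have hfi : IntegrableOn f (Ioi 0) := by
    set C := |-ξ| + 2 * cylQ (-ξ) a with hC
    have hCpos : 0 < C := by
      have := cylQ_pos (-ξ) ha
      positivity
    refine Integrable.mono' ((hi₁.add (hi.const_mul (1 + |ξ| + C)))) ?_ ?_
    · have h1 : ContinuousOn f (Ioi 0) := hRc.continuous.continuousOn.mul
        (((continuousOn_primitive hv c).mono Ioi_subset_Ici_self).mul
          ((continuousOn_primitive hv c).mono Ioi_subset_Ici_self))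
      exact h1.aestronglyMeasurable measurableSet_Ioi
    filter_upwards [ae_restrict_mem measurableSet_Ioi] with t ht
    have h1 := abs_cylR_add_le (-ξ) ha (le_of_lt ht : (0 : ℝ) ≤ t)
    rw [← hC, ← sub_eq_add_neg] at h1
    have h4 : t + C ≤ (t - ξ) ^ 2 + (1 + |ξ| + C) := by
      nlinarith [le_abs_self ξ, sq_nonneg (t - ξ - 1)]
    have h5 : 0 ≤ V t * V t := mul_self_nonneg _
    rw [Real.norm_eq_abs, hf]
    simp only [Pi.add_apply]
    rw [abs_mul, abs_of_nonneg h5]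
    have := mul_le_mul_of_nonneg_right (h1.trans h4) h5
    nlinarith
  have hf0 : f 0 ≤ γ * c ^ 2 := by
    simp only [hf, hV0, zero_sub]
    nlinarith [mul_nonneg (sub_nonneg.2 hγ) (mul_self_nonneg c)]
  -- If the inequality failed, K + f(0) < 0, and f(T) would eventually lie below (K + f(0))/2 < 0,
  -- against the integrability of f.
  by_contra! hlt
  set K := ∫ t in Ioi (0 : ℝ), H t with hK
  have hKneg : K + f 0 < 0 := by linarith
  have htend := intervalIntegral_tendsto_integral_Ioi 0 hHi tendsto_id
  have hev : ∀ᶠ T in atTop, ∫ t in (0 : ℝ)..T, H t < (K - f 0) / 2 :=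
    htend.eventually (gt_mem_nhds (by linarith))
  obtain ⟨T₀, hT₀⟩ := eventually_atTop.1 hev
  refine not_eventually_ge_of_integrableOn hfi.neg (le_max_right T₀ 0)
    (c := -((K + f 0) / 2)) (by linarith) fun T hT => ?_
  have h1 := hstep T ((le_max_right T₀ 0).trans hT)
  have h2 := hT₀ T ((le_max_left T₀ 0).trans hT)
  simp only [Pi.neg_apply]
  linarith

/-! ### Green's formula determines a function on the half-line -/

/-- No mean-zero condition is needed, since θ may be nonzero at 0. The primitive starts at M, to the
right of the support, so it vanishes beyond M and the cutoff alters it only on the negative side. -/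
lemma exists_primitive_compactSupport {ψ : ℝ → ℝ} (hψ : ContDiff ℝ ((⊤ : ℕ∞) : WithTop ℕ∞) ψ)
    (hc : HasCompactSupport ψ) :
    ∃ θ : ℝ → ℝ, ContDiff ℝ ((⊤ : ℕ∞) : WithTop ℕ∞) θ ∧ HasCompactSupport θ ∧
      ∀ t, 0 < t → deriv θ t = ψ t := by
  obtain ⟨r, hr⟩ := hc.isCompact.isBounded.subset_closedBall 0
  set M := max r 1 with hM
  have hMpos : 0 < M := lt_max_of_lt_right one_pos
  have hψ0 : ∀ t, M < t → ψ t = 0 := by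
    intro t ht
    by_contra h
    have h1 := hr (subset_tsupport _ h)
    rw [Metric.mem_closedBall, Real.dist_eq, sub_zero] at h1
    linarith [le_abs_self t, le_max_left r 1]
  have hint : ∀ a b, IntervalIntegrable ψ volume a b := fun a b =>
    hψ.continuous.intervalIntegrable a b
  have hd : ∀ t, HasDerivAt (fun t => ∫ x in M..t, ψ x) (ψ t) t := fun t =>
    intervalIntegral.integral_hasDerivAt_right (hint _ _)
      (hψ.continuous.stronglyMeasurableAtFilter _ _) hψ.continuous.continuousAt
  have hP : ContDiff ℝ ((⊤ : ℕ∞) : WithTop ℕ∞) fun t => ∫ x in M..t, ψ x := by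
    rw [contDiff_infty_iff_deriv]
    refine ⟨fun t => (hd t).differentiableAt, ?_⟩
    rwa [funext fun t => (hd t).deriv]
  have hP0 : ∀ t, M < t → ∫ x in M..t, ψ x = 0 := by
    intro t ht
    rw [intervalIntegral.integral_of_le ht.le]
    exact setIntegral_eq_zero_of_forall_eq_zero fun x hx => hψ0 x hx.1
  let κ : ContDiffBump (0 : ℝ) := ⟨M + 1, M + 2, by linarith, by linarith⟩
  refine ⟨fun t => κ t * ∫ x in M..t, ψ x, κ.contDiff.mul hP, κ.hasCompactSupport.mul_right,
    fun t ht => ?_⟩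
  rcases lt_or_ge t (M + 1) with h | h
  · have h1 : (fun t => κ t * ∫ x in M..t, ψ x) =ᶠ[𝓝 t] fun t => ∫ x in M..t, ψ x := by
      filter_upwards [Ioo_mem_nhds ht h] with y hy
      rw [κ.one_of_mem_closedBall, one_mul]
      rw [Metric.mem_closedBall, Real.dist_eq, sub_zero, abs_of_pos hy.1]
      exact hy.2.le
    rw [h1.deriv_eq, (hd t).deriv]
  · have h1 : (fun t => κ t * ∫ x in M..t, ψ x) =ᶠ[𝓝 t] fun _ => 0 := by
      filter_upwards [Ioi_mem_nhds (show M < t by linarith)] with y hy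
      rw [hP0 y hy, mul_zero]
    rw [h1.deriv_eq, deriv_const, hψ0 t (by linarith)]

/-- Green's formula on the half-line characterizes the primitives. -/
theorem ae_eq_primitive_of_green {w v : ℝ → ℝ} {c : ℝ} (hw : MemLp w 2 halfLineMeasure)
    (hv : MemLp v 2 halfLineMeasure)
    (h : ∀ θ : ℝ → ℝ, ContDiff ℝ ((⊤ : ℕ∞) : WithTop ℕ∞) θ → HasCompactSupport θ →
      ∫ t in Ioi (0 : ℝ), w t * deriv θ t = -(∫ t in Ioi (0 : ℝ), v t * θ t) - c * θ 0) :
    w =ᵐ[halfLineMeasure] fun t => c + ∫ x in (0 : ℝ)..t, v x := by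
  set V : ℝ → ℝ := fun t => c + ∫ x in (0 : ℝ)..t, v x with hV
  have hV0 : V 0 = c := by simp [hV]
  have hVc : ContinuousOn V (Ici 0) := continuousOn_primitive hv c
  -- The primitive V obeys the same formula, so w - V is orthogonal to every θ', and on the
  -- half-line these exhaust the test functions.
  have green : ∀ θ : ℝ → ℝ, ContDiff ℝ ((⊤ : ℕ∞) : WithTop ℕ∞) θ → HasCompactSupport θ →
      ∫ t in Ioi (0 : ℝ), V t * deriv θ t = -(∫ t in Ioi (0 : ℝ), v t * θ t) - c * θ 0 := by
    intro θ hθ hθc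
    obtain ⟨r, hr⟩ := hθc.isCompact.isBounded.subset_closedBall 0
    set T := max r 0 + 1 with hT
    have hTpos : 0 < T := by have := le_max_right r 0; linarith
    have hout : ∀ t, T ≤ t → t ∉ tsupport θ := by
      intro t ht hmem
      have h1 := hr hmem
      rw [Metric.mem_closedBall, Real.dist_eq, sub_zero] at h1
      linarith [le_abs_self t, le_max_left r 0]
    have hθ0 : ∀ t, T ≤ t → θ t = 0 := fun t ht => image_eq_zero_of_notMem_tsupport (hout t ht)
    have hθ1 : ∀ t, T ≤ t → deriv θ t = 0 := fun t ht =>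
      image_eq_zero_of_notMem_tsupport fun h' => hout t ht (tsupport_deriv_subset h')
    have cut : ∀ g : ℝ → ℝ, (∀ t, T ≤ t → g t = 0) →
        ∫ t in Ioi (0 : ℝ), g t = ∫ t in (0 : ℝ)..T, g t := by
      intro g hg
      rw [intervalIntegral.integral_of_le hTpos.le]
      refine setIntegral_eq_of_subset_of_forall_sdiff_eq_zero measurableSet_Ioi
        Ioc_subset_Ioi_self fun t ht => hg t ?_
      by_contra! hlt
      exact ht.2 ⟨ht.1, hlt.le⟩
    rw [cut _ fun t ht => by rw [hθ1 t ht, mul_zero], cut _ fun t ht => by rw [hθ0 t ht, mul_zero]]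
    have acV := absolutelyContinuous_primitive hv c hTpos.le
    have acθ : AbsolutelyContinuousOnInterval θ 0 T :=
      ((hθ.of_le (by exact_mod_cast le_top)).contDiffOn).absolutelyContinuousOnInterval
    have h1 := acV.integral_mul_deriv_eq_deriv_mul acθ
    have h2 : ∫ t in (0 : ℝ)..T, deriv V t * θ t = ∫ t in (0 : ℝ)..T, v t * θ t := by
      refine intervalIntegral.integral_congr_ae ?_
      filter_upwards [ae_hasDerivAt_primitive hv c hTpos.le] with t ht hmem
      rw [(ht (uIoc_subset_uIcc hmem)).deriv]
    rw [h2, hθ0 T le_rfl, mul_zero] at h1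
    have h3 : V T * 0 - V 0 * θ 0 - ∫ t in (0 : ℝ)..T, v t * θ t =
        -(∫ t in (0 : ℝ)..T, v t * θ t) - c * θ 0 := by
      rw [hV0]; ring
    simp only [hV, mul_zero] at h1 h3 ⊢
    exact h1.trans h3
  have hwl : LocallyIntegrableOn w (Ioi 0) := by
    have : LocallyIntegrable w halfLineMeasure := hw.locallyIntegrable one_le_two
    exact (locallyIntegrableOn_of_locallyIntegrable_restrict this)
  have hVl : LocallyIntegrableOn V (Ioi 0) :=
    (hVc.mono Ioi_subset_Ici_self).locallyIntegrableOn measurableSet_Ioi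
  have key : ∀ᵐ t, t ∈ Ioi (0 : ℝ) → w t - V t = 0 := by
    refine isOpen_Ioi.ae_eq_zero_of_integral_contDiff_smul_eq_zero (hwl.sub hVl) ?_
    intro ψ hψ hψc hψs
    obtain ⟨θ, hθ, hθc, hθd⟩ := exists_primitive_compactSupport hψ hψc
    have hψ0 : ∀ t, t ∉ Ioi (0 : ℝ) → ψ t = 0 := fun t ht =>
      image_eq_zero_of_notMem_tsupport fun h' => ht (hψs h')
    have e1 : ∫ t, ψ t • (w t - V t) = ∫ t in Ioi (0 : ℝ), ψ t • (w t - V t) := by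
      refine (setIntegral_eq_integral_of_forall_compl_eq_zero fun t ht => ?_).symm
      rw [hψ0 t ht, zero_smul]
    have hψint : ∀ g : ℝ → ℝ, LocallyIntegrableOn g (Ioi 0) →
        IntegrableOn (fun t => g t * deriv θ t) (Ioi 0) := by
      intro g hg
      have h1 : IntegrableOn g (tsupport ψ) := hg.integrableOn_compact_subset hψs hψc.isCompact
      have h2 : IntegrableOn (fun t => g t * ψ t) (tsupport ψ) :=
        h1.mul_continuousOn hψ.continuous.continuousOn hψc.isCompact
      have h3 : IntegrableOn (fun t => g t * ψ t) (Ioi 0) :=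
        h2.of_forall_sdiff_eq_zero measurableSet_Ioi fun t ht => by
          rw [image_eq_zero_of_notMem_tsupport ht.2, mul_zero]
      exact h3.congr_fun (fun t ht => by simp only [hθd t ht]) measurableSet_Ioi
    rw [e1, setIntegral_congr_fun (g := fun t => w t * deriv θ t - V t * deriv θ t)
      measurableSet_Ioi fun t ht => ?_, integral_sub (hψint w hwl) (hψint V hVl), h θ hθ hθc,
      green θ hθ hθc, sub_self]
    simp only [hθd t ht, smul_eq_mul]
    ring
  refine (ae_restrict_iff' measurableSet_Ioi).2 ?_
  filter_upwards [key] with t ht hmem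
  exact sub_eq_zero.1 (ht hmem)

/-- The ground state inequality for functions satisfying Green's formula on the half-line. -/
theorem energy_ge_of_green {w v : ℝ → ℝ} {c γ ξ a : ℝ} (ha : 0 < a) (hγ : cylR (-ξ) a ≤ γ)
    (hw : MemLp w 2 halfLineMeasure) (hv : MemLp v 2 halfLineMeasure)
    (hi₁ : IntegrableOn (fun t => ((t - ξ) * w t) ^ 2) (Ioi 0))
    (h : ∀ θ : ℝ → ℝ, ContDiff ℝ ((⊤ : ℕ∞) : WithTop ℕ∞) θ → HasCompactSupport θ →
      ∫ t in Ioi (0 : ℝ), w t * deriv θ t = -(∫ t in Ioi (0 : ℝ), v t * θ t) - c * θ 0) :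
    (1 - 2 * a) * ∫ t in Ioi (0 : ℝ), w t ^ 2 ≤
      (∫ t in Ioi (0 : ℝ), v t ^ 2) + (∫ t in Ioi (0 : ℝ), ((t - ξ) * w t) ^ 2) + γ * c ^ 2 := by
  have hae := ae_eq_primitive_of_green hw hv h
  have e1 : (fun t => w t ^ 2) =ᵐ[halfLineMeasure] fun t => (c + ∫ x in (0 : ℝ)..t, v x) ^ 2 := by
    filter_upwards [hae] with t ht
    rw [ht]
  have e2 : (fun t => ((t - ξ) * w t) ^ 2) =ᵐ[halfLineMeasure]
      fun t => ((t - ξ) * (c + ∫ x in (0 : ℝ)..t, v x)) ^ 2 := by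
    filter_upwards [hae] with t ht
    rw [ht]
  rw [integral_congr_ae e1, integral_congr_ae e2]
  exact energy_ge_of_primitive hv ha hγ (hw.integrable_sq.congr e1) (hi₁.congr e2)

/-! ### Longitudinal Fourier series -/

/-- The unimodular number `exp (i y)`. -/
def phase (y : ℝ) : ℂ := Complex.exp ((y : ℂ) * Complex.I)

lemma norm_phase (y : ℝ) : ‖phase y‖ = 1 := Complex.norm_exp_ofReal_mul_I y

lemma continuous_phase : Continuous phase := by unfold phase; fun_prop

lemma contDiff_phase : ContDiff ℝ ((⊤ : ℕ∞) : WithTop ℕ∞) phase := by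
  unfold phase
  exact (Complex.ofRealCLM.contDiff.mul contDiff_const).cexp

lemma hasDerivAt_phase {f : ℝ → ℝ} {f' x : ℝ} (hf : HasDerivAt f f' x) :
    HasDerivAt (fun x => phase (f x)) (phase (f x) * ((f' : ℂ) * Complex.I)) x :=
  (hf.ofReal_comp.mul_const Complex.I).cexp

/-- The `k`-th frequency of functions of period `2 ρ`. -/
def modeFreq (ρ : ℝ) (k : ℤ) : ℝ := Real.pi * k / ρ

/-- Parseval on an interval of length 2ρ containing the support, multiplied by (2ρ)² because the
coefficients here are not averaged. -/
theorem hasSum_sq_integral_phase {ρ : ℝ} (hρ : 0 < ρ) {f : ℝ → ℂ} (hf : MemLp f 2 volume)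
    (h0 : ∀ x, ρ ≤ |x| → f x = 0) :
    HasSum (fun k : ℤ => ‖∫ x, phase (-(modeFreq ρ k * x)) * f x‖ ^ 2)
      (2 * ρ * ∫ x, ‖f x‖ ^ 2) := by
  have hab : -ρ < ρ := by linarith
  have hcut : ∀ {E : Type} [NormedAddCommGroup E] [NormedSpace ℝ E] (g : ℝ → E),
      (∀ x, ρ ≤ |x| → g x = 0) → ∫ x in (-ρ)..ρ, g x = ∫ x, g x := by
    intro E _ _ g hg
    rw [intervalIntegral.integral_of_le hab.le]
    refine setIntegral_eq_integral_of_forall_compl_eq_zero fun x hx => hg x ?_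
    by_contra! h
    rw [abs_lt] at h
    exact hx ⟨h.1, h.2.le⟩
  have h1 := hasSum_sq_fourierCoeffOn hab (hf.restrict _)
  rw [hcut (fun x => ‖f x‖ ^ 2) fun x hx => by rw [h0 x hx]; simp] at h1
  have h2 := h1.mul_left ((2 * ρ) ^ 2)
  have e1 : ∀ k : ℤ, (2 * ρ) ^ 2 * ‖fourierCoeffOn hab f k‖ ^ 2 =
      ‖∫ x, phase (-(modeFreq ρ k * x)) * f x‖ ^ 2 := by
    intro k
    rw [fourierCoeffOn_eq_integral, hcut _ fun x hx => by rw [h0 x hx, smul_zero], norm_smul,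
      Real.norm_of_nonneg (by rw [sub_neg_eq_add]; positivity)]
    have e3 : ∀ x : ℝ, (fourier (-k) (x : AddCircle (ρ - -ρ)) : ℂ) • f x =
        phase (-(modeFreq ρ k * x)) * f x := by
      intro x
      rw [fourier_coe_apply, phase, modeFreq, smul_eq_mul]
      congr 2
      push_cast
      have : (ρ : ℂ) ≠ 0 := by exact_mod_cast hρ.ne'
      field_simp
      ring
    simp only [e3]
    field_simp
    ring
  simp only [e1] at h2
  have e2 : (2 * ρ) ^ 2 * (ρ - -ρ)⁻¹ • ∫ x, ‖f x‖ ^ 2 = 2 * ρ * ∫ x, ‖f x‖ ^ 2 := by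
    rw [smul_eq_mul, sub_neg_eq_add, ← two_mul]
    field_simp
  rwa [e2] at h2

lemma ae_memLp_slice {F : ℝ × ℝ → ℂ} (hF : MemLp F 2 halfPlaneMeasure) :
    ∀ᵐ t ∂halfLineMeasure, MemLp (fun x => F (x, t)) 2 volume := by
  rw [halfPlaneMeasure_eq_prod] at hF
  have hI := (memLp_two_iff_integrable_sq_norm hF.1).1 hF
  filter_upwards [hF.1.prod_swap.prodMk_left, hI.prod_left_ae] with t h1 h2
  exact (memLp_two_iff_integrable_sq_norm h1).2 h2

/-- Parseval on almost every line x₂ = t, then integration of the series in t; its terms are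
nonnegative, so its sum is the dominating function. -/
theorem hasSum_integral_sq_slices {ρ : ℝ} (hρ : 0 < ρ) {F : ℝ × ℝ → ℂ}
    (hF : MemLp F 2 halfPlaneMeasure) (h0 : ∀ x t, ρ ≤ |x| → F (x, t) = 0) :
    (∀ k : ℤ, MemLp (fun t => ∫ x, phase (-(modeFreq ρ k * x)) * F (x, t)) 2 halfLineMeasure) ∧
    HasSum (fun k : ℤ => ∫ t in Ioi (0 : ℝ), ‖∫ x, phase (-(modeFreq ρ k * x)) * F (x, t)‖ ^ 2)
      (2 * ρ * ∫ z in halfPlane, ‖F z‖ ^ 2) := by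
  have hslice := ae_memLp_slice hF
  rw [halfPlaneMeasure_eq_prod] at hF
  have hI := (memLp_two_iff_integrable_sq_norm hF.1).1 hF
  have hsum : ∀ᵐ t ∂halfLineMeasure,
      HasSum (fun k : ℤ => ‖∫ x, phase (-(modeFreq ρ k * x)) * F (x, t)‖ ^ 2)
        (2 * ρ * ∫ x, ‖F (x, t)‖ ^ 2) := by
    filter_upwards [hslice] with t ht
    exact hasSum_sq_integral_phase hρ ht fun x => h0 x t
  have hmeas : ∀ k : ℤ, AEStronglyMeasurable
      (fun t => ∫ x, phase (-(modeFreq ρ k * x)) * F (x, t)) halfLineMeasure := by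
    intro k
    have hc : Continuous fun z : ℝ × ℝ => phase (-(modeFreq ρ k * z.2)) :=
      continuous_phase.comp (by fun_prop)
    exact (hc.aestronglyMeasurable.mul hF.1.prod_swap).integral_prod_right'
  have hIr := hI.integral_prod_right.const_mul (2 * ρ)
  have hint : ∀ k : ℤ, Integrable
      (fun t => ‖∫ x, phase (-(modeFreq ρ k * x)) * F (x, t)‖ ^ 2) halfLineMeasure := by
    intro k
    refine hIr.mono' ((hmeas k).norm.pow 2) ?_
    filter_upwards [hsum] with t ht
    rw [Real.norm_of_nonneg (sq_nonneg _)]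
    exact le_hasSum ht k fun j _ => sq_nonneg _
  refine ⟨fun k => (memLp_two_iff_integrable_sq_norm (hmeas k)).2 (hint k), ?_⟩
  have h1 := hasSum_integral_of_dominated_convergence (μ := halfLineMeasure)
    (fun (k : ℤ) t => ‖∫ x, phase (-(modeFreq ρ k * x)) * F (x, t)‖ ^ 2)
    (fun k => (hint k).aestronglyMeasurable)
    (fun k => Eventually.of_forall fun t => (Real.norm_of_nonneg (sq_nonneg _)).le)
    (hsum.mono fun t ht => ht.summable)
    (hIr.congr (hsum.mono fun t ht => ht.tsum_eq.symm)) hsum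
  rw [integral_const_mul, ← integral_prod_symm _ hI, ← halfPlaneMeasure_eq_prod] at h1
  exact h1

/-! ### The energy of slices -/

/-- The complex form of the ground state inequality on the half-line. -/
theorem energy_ge_of_green_complex {w v : ℝ → ℂ} {c : ℂ} {γ ξ a : ℝ} (ha : 0 < a)
    (hγ : cylR (-ξ) a ≤ γ) (hw : MemLp w 2 halfLineMeasure) (hv : MemLp v 2 halfLineMeasure)
    (hi : IntegrableOn (fun t => ‖((t - ξ : ℝ) : ℂ) * w t‖ ^ 2) (Ioi 0))
    (h : ∀ θ : ℝ → ℝ, ContDiff ℝ ((⊤ : ℕ∞) : WithTop ℕ∞) θ → HasCompactSupport θ →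
      ∫ t in Ioi (0 : ℝ), w t * ((deriv θ t : ℝ) : ℂ) =
        -(∫ t in Ioi (0 : ℝ), v t * (θ t : ℂ)) - c * (θ 0 : ℂ)) :
    (1 - 2 * a) * ∫ t in Ioi (0 : ℝ), ‖w t‖ ^ 2 ≤
      (∫ t in Ioi (0 : ℝ), ‖v t‖ ^ 2) + (∫ t in Ioi (0 : ℝ), ‖((t - ξ : ℝ) : ℂ) * w t‖ ^ 2) +
        γ * ‖c‖ ^ 2 := by
  have hint : ∀ {f : ℝ → ℂ} {θ : ℝ → ℝ}, MemLp f 2 halfLineMeasure → Continuous θ →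
      HasCompactSupport θ → Integrable (fun t => f t * (θ t : ℂ)) halfLineMeasure := by
    intro f θ hf hθ hθc
    have h1 : MemLp (fun t => (θ t : ℂ)) 2 halfLineMeasure :=
      ((hθ.memLp_of_hasCompactSupport hθc).restrict _).ofReal
    exact hf.integrable_mul h1
  have nsq : ∀ z : ℂ, ‖z‖ ^ 2 = z.re ^ 2 + z.im ^ 2 := fun z => by
    rw [← Complex.normSq_eq_norm_sq, Complex.normSq_apply]; ring
  have nsq' : ∀ t : ℝ, ‖((t - ξ : ℝ) : ℂ) * w t‖ ^ 2 =
      ((t - ξ) * (w t).re) ^ 2 + ((t - ξ) * (w t).im) ^ 2 := fun t => by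
    rw [norm_mul, mul_pow, nsq (w t), Complex.norm_real, Real.norm_eq_abs, sq_abs]; ring
  have hm : AEStronglyMeasurable (fun t : ℝ => t - ξ) halfLineMeasure :=
    (continuous_id.sub continuous_const).aestronglyMeasurable
  have ire : IntegrableOn (fun t => ((t - ξ) * (w t).re) ^ 2) (Ioi 0) := by
    refine hi.mono' ((hm.mul hw.re.1).pow 2) (Eventually.of_forall fun t => ?_)
    rw [Real.norm_of_nonneg (sq_nonneg _), nsq' t]
    exact le_add_of_nonneg_right (sq_nonneg _)
  have iim : IntegrableOn (fun t => ((t - ξ) * (w t).im) ^ 2) (Ioi 0) := by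
    refine hi.mono' ((hm.mul hw.im.1).pow 2) (Eventually.of_forall fun t => ?_)
    rw [Real.norm_of_nonneg (sq_nonneg _), nsq' t]
    exact le_add_of_nonneg_left (sq_nonneg _)
  have h1 := energy_ge_of_green (w := fun t => (w t).re) (v := fun t => (v t).re) (c := c.re)
    ha hγ hw.re hv.re ire fun θ hθ hθc => by
      have e := congrArg Complex.re (h θ hθ hθc)
      have j1 := Complex.reCLM.integral_comp_comm (hint hw (hθ.continuous_deriv (by simp)) hθc.deriv)
      have j2 := Complex.reCLM.integral_comp_comm (hint hv hθ.continuous hθc)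
      simp only [Complex.sub_re, Complex.neg_re, Complex.re_mul_ofReal,
        Complex.reCLM_apply] at e j1 j2
      rw [← j1, ← j2] at e
      exact e
  have h2 := energy_ge_of_green (w := fun t => (w t).im) (v := fun t => (v t).im) (c := c.im)
    ha hγ hw.im hv.im iim fun θ hθ hθc => by
      have e := congrArg Complex.im (h θ hθ hθc)
      have j1 := Complex.imCLM.integral_comp_comm (hint hw (hθ.continuous_deriv (by simp)) hθc.deriv)
      have j2 := Complex.imCLM.integral_comp_comm (hint hv hθ.continuous hθc)
      simp only [Complex.sub_im, Complex.neg_im, Complex.im_mul_ofReal,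
        Complex.imCLM_apply] at e j1 j2
      rw [← j1, ← j2] at e
      exact e
  simp only [nsq', nsq]
  have iw₁ : IntegrableOn (fun t => (w t).re ^ 2) (Ioi 0) := hw.re.integrable_sq
  have iw₂ : IntegrableOn (fun t => (w t).im ^ 2) (Ioi 0) := hw.im.integrable_sq
  have iv₁ : IntegrableOn (fun t => (v t).re ^ 2) (Ioi 0) := hv.re.integrable_sq
  have iv₂ : IntegrableOn (fun t => (v t).im ^ 2) (Ioi 0) := hv.im.integrable_sq
  rw [integral_add ire iim, integral_add iw₁ iw₂, integral_add iv₁ iv₂]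
  linarith

/-- Localization in the longitudinal variable and change of gauge. -/
def gaugeCut (χ : ℝ → ℝ) (f : ℝ × ℝ → ℂ) (z : ℝ × ℝ) : ℂ :=
  phase (-(z.1 * z.2 / 2)) * (χ z.1 : ℂ) * f z

lemma norm_gaugeCut (χ : ℝ → ℝ) (f : ℝ × ℝ → ℂ) (z : ℝ × ℝ) :
    ‖gaugeCut χ f z‖ = ‖(χ z.1 : ℂ) * f z‖ := by
  rw [gaugeCut, mul_assoc, norm_mul, norm_phase, one_mul]

lemma memLp_gaugeCut {χ : ℝ → ℝ} (hχ : Continuous χ) (hχc : HasCompactSupport χ)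
    {f : ℝ × ℝ → ℂ} (hf : MemLp f 2 halfPlaneMeasure) :
    MemLp (gaugeCut χ f) 2 halfPlaneMeasure := by
  obtain ⟨C, hC⟩ := hχ.bounded_above_of_compact_support hχc
  have hc : Continuous fun z : ℝ × ℝ => phase (-(z.1 * z.2 / 2)) * (χ z.1 : ℂ) := by
    have := continuous_phase
    fun_prop
  refine MemLp.of_le_mul (c := C) hf (hc.aestronglyMeasurable.mul hf.1)
    (Eventually.of_forall fun z => ?_)
  rw [norm_gaugeCut, norm_mul, Complex.norm_real]
  exact mul_le_mul_of_nonneg_right (hC _) (norm_nonneg _)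

/-- The longitudinal Fourier coefficient at frequency `η`. -/
def slice (η : ℝ) (F : ℝ × ℝ → ℂ) (t : ℝ) : ℂ := ∫ x, phase (-(η * x)) * F (x, t)

theorem integral_slice_mul {f : ℝ × ℝ → ℂ} (hf : MemLp f 2 halfPlaneMeasure) {χ θ : ℝ → ℝ}
    (hχ : Continuous χ) (hχc : HasCompactSupport χ) (hθ : Continuous θ) (hθc : HasCompactSupport θ)
    (η : ℝ) :
    Integrable (fun z => phase (-(η * z.1)) * gaugeCut χ f z * (θ z.2 : ℂ)) halfPlaneMeasure ∧
      ∫ z in halfPlane, phase (-(η * z.1)) * gaugeCut χ f z * (θ z.2 : ℂ) =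
        ∫ t in Ioi (0 : ℝ), slice η (gaugeCut χ f) t * (θ t : ℂ) := by
  have hc : Continuous fun z : ℝ × ℝ =>
      phase (-(η * z.1)) * (phase (-(z.1 * z.2 / 2)) * (χ z.1 : ℂ)) * (θ z.2 : ℂ) := by
    have := continuous_phase
    fun_prop
  have hcs : HasCompactSupport fun z : ℝ × ℝ =>
      phase (-(η * z.1)) * (phase (-(z.1 * z.2 / 2)) * (χ z.1 : ℂ)) * (θ z.2 : ℂ) := by
    refine HasCompactSupport.intro (hχc.isCompact.prod hθc.isCompact) fun z hz => ?_
    rw [mem_prod, not_and_or] at hz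
    rcases hz with hz | hz <;> simp [image_eq_zero_of_notMem_tsupport hz]
  have hi : Integrable (fun z => phase (-(η * z.1)) * gaugeCut χ f z * (θ z.2 : ℂ))
      halfPlaneMeasure := by
    refine (hf.integrable_mul ((hc.memLp_of_hasCompactSupport (p := 2) hcs).restrict _)).congr
      (Eventually.of_forall fun z => ?_)
    simp only [gaugeCut, Pi.mul_apply]
    ring
  refine ⟨hi, ?_⟩
  change ∫ z, _ ∂halfPlaneMeasure = _
  rw [halfPlaneMeasure_eq_prod] at hi ⊢
  rw [integral_prod_symm _ hi]
  simp only [slice, integral_mul_const]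

section slices

variable {χ : ℝ → ℝ} (η : ℝ)

/-- The test functions used to isolate one Fourier mode. -/
def modeTest (η : ℝ) (χ θ : ℝ → ℝ) (z : ℝ × ℝ) : ℂ :=
  phase (-(η * z.1)) * (phase (-(z.1 * z.2 / 2)) * (χ z.1 : ℂ)) * (θ z.2 : ℂ)

lemma contDiff_modeTest {θ : ℝ → ℝ} (hχ : ContDiff ℝ ((⊤ : ℕ∞) : WithTop ℕ∞) χ)
    (hθ : ContDiff ℝ ((⊤ : ℕ∞) : WithTop ℕ∞) θ) :
    ContDiff ℝ ((⊤ : ℕ∞) : WithTop ℕ∞) (modeTest η χ θ) := by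
  have h1 : ContDiff ℝ ((⊤ : ℕ∞) : WithTop ℕ∞) fun z : ℝ × ℝ => -(η * z.1) := by fun_prop
  have h2 : ContDiff ℝ ((⊤ : ℕ∞) : WithTop ℕ∞) fun z : ℝ × ℝ => -(z.1 * z.2 / 2) := by fun_prop
  exact ((contDiff_phase.comp h1).mul ((contDiff_phase.comp h2).mul
    (Complex.ofRealCLM.contDiff.comp (hχ.comp contDiff_fst)))).mul
    (Complex.ofRealCLM.contDiff.comp (hθ.comp contDiff_snd))

lemma hasCompactSupport_modeTest {θ : ℝ → ℝ} (hχc : HasCompactSupport χ)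
    (hθc : HasCompactSupport θ) : HasCompactSupport (modeTest η χ θ) := by
  refine HasCompactSupport.intro (hχc.isCompact.prod hθc.isCompact) fun z hz => ?_
  rw [mem_prod, not_and_or] at hz
  rcases hz with hz | hz <;> simp [modeTest, image_eq_zero_of_notMem_tsupport hz]

lemma tsupport_modeTest_subset {θ : ℝ → ℝ} (hθ : tsupport θ ⊆ Ioi 0) :
    tsupport (modeTest η χ θ) ⊆ halfPlane := by
  have h1 : tsupport (modeTest η χ θ) ⊆ Prod.snd ⁻¹' tsupport θ := by
    refine closure_minimal (fun z hz => ?_) ((isClosed_tsupport θ).preimage continuous_snd)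
    by_contra h
    exact hz (by simp [modeTest, image_eq_zero_of_notMem_tsupport h])
  exact fun z hz => hθ (h1 hz)

lemma fderiv_modeTest_snd {θ : ℝ → ℝ} (hχ : ContDiff ℝ ((⊤ : ℕ∞) : WithTop ℕ∞) χ)
    (hθ : ContDiff ℝ ((⊤ : ℕ∞) : WithTop ℕ∞) θ) (z : ℝ × ℝ) :
    fderiv ℝ (modeTest η χ θ) z (0, 1) =
      modeTest η χ (deriv θ) z - Complex.I * (magA2 z : ℂ) * modeTest η χ θ z := by
  refine (hasDerivAt_fderiv_snd (contDiff_modeTest η hχ hθ) z.1 z.2).unique ?_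
  have h1 : HasDerivAt (fun t => -(z.1 * t / 2)) (-(z.1 / 2)) z.2 := by
    refine (((hasDerivAt_id z.2).const_mul z.1).div_const 2).neg.congr_deriv ?_
    ring
  have h2 : HasDerivAt θ (deriv θ z.2) z.2 := (hθ.differentiable (by simp) z.2).hasDerivAt
  refine ((((hasDerivAt_phase h1).mul_const (χ z.1 : ℂ)).const_mul (phase (-(η * z.1)))).mul
    h2.ofReal_comp).congr_deriv ?_
  simp only [modeTest, magA2]
  push_cast
  ring

lemma fderiv_modeTest_fst {θ : ℝ → ℝ} (hχ : ContDiff ℝ ((⊤ : ℕ∞) : WithTop ℕ∞) χ)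
    (hθ : ContDiff ℝ ((⊤ : ℕ∞) : WithTop ℕ∞) θ) (z : ℝ × ℝ) :
    fderiv ℝ (modeTest η χ θ) z (1, 0) =
      modeTest η (deriv χ) θ z - Complex.I * ((η + z.2 / 2 : ℝ) : ℂ) * modeTest η χ θ z := by
  refine (hasDerivAt_fderiv_fst (contDiff_modeTest η hχ hθ) z.1 z.2).unique ?_
  have h0 : HasDerivAt (fun x => -(η * x)) (-η) z.1 := by
    refine ((hasDerivAt_id z.1).const_mul η).neg.congr_deriv ?_
    ring
  have h1 : HasDerivAt (fun x => -(x * z.2 / 2)) (-(z.2 / 2)) z.1 := by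
    refine (((hasDerivAt_id z.1).mul_const z.2).div_const 2).neg.congr_deriv ?_
    ring
  have h2 : HasDerivAt χ (deriv χ z.1) z.1 := (hχ.differentiable (by simp) z.1).hasDerivAt
  refine (((hasDerivAt_phase h0).mul ((hasDerivAt_phase h1).mul h2.ofReal_comp)).mul_const
    (θ z.2 : ℂ)).congr_deriv ?_
  simp only [modeTest, Pi.mul_apply]
  push_cast
  ring

lemma mul_modeTest (f : ℝ × ℝ → ℂ) (χ θ : ℝ → ℝ) (z : ℝ × ℝ) :
    f z * modeTest η χ θ z = phase (-(η * z.1)) * gaugeCut χ f z * (θ z.2 : ℂ) := by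
  simp only [modeTest, gaugeCut]
  ring

/-- The gauge phase in the test function has x₂-derivative -i x₁/2 times itself, cancelling the
second component of the potential. The slice of p₂ thus plays the role of v, and the Fourier
coefficient of χ g that of the boundary value c, in `energy_ge_of_green_complex`. -/
theorem green_slice {u p₁ p₂ : ℝ × ℝ → ℂ} {g : ℝ → ℂ} (hu : HasMagneticGradient u p₁ p₂)
    (hg : IsBoundaryTrace u p₂ g) (hχ : ContDiff ℝ ((⊤ : ℕ∞) : WithTop ℕ∞) χ)
    (hχc : HasCompactSupport χ) {θ : ℝ → ℝ} (hθ : ContDiff ℝ ((⊤ : ℕ∞) : WithTop ℕ∞) θ)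
    (hθc : HasCompactSupport θ) :
    ∫ t in Ioi (0 : ℝ), slice η (gaugeCut χ u) t * ((deriv θ t : ℝ) : ℂ) =
      -(∫ t in Ioi (0 : ℝ), slice η (gaugeCut χ p₂) t * (θ t : ℂ)) -
        (∫ x, phase (-(η * x)) * ((χ x : ℂ) * g x)) * (θ 0 : ℂ) := by
  have hθ' : Continuous (deriv θ) := hθ.continuous_deriv (by simp)
  obtain ⟨i1, e1⟩ := integral_slice_mul hu.memLp hχ.continuous hχc hθ' hθc.deriv η
  obtain ⟨i2, e2⟩ := integral_slice_mul hu.memLp_snd hχ.continuous hχc hθ.continuous hθc η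
  have h := hg.green _ (contDiff_modeTest η hχ hθ) (hasCompactSupport_modeTest η hχc hθc)
  have cm : Continuous fun z => Complex.I * (magA2 z : ℂ) * modeTest η χ θ z := by
    have := (contDiff_modeTest η hχ hθ).continuous
    unfold magA2
    fun_prop
  have i3 : Integrable (fun z => u z * (Complex.I * (magA2 z : ℂ) * modeTest η χ θ z))
      halfPlaneMeasure := hu.memLp.integrable_mul ((cm.memLp_of_hasCompactSupport (p := 2)
        ((hasCompactSupport_modeTest η hχc hθc).mul_left)).restrict _)
  have el : ∫ z in halfPlane, u z * fderiv ℝ (modeTest η χ θ) z (0, 1) =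
      (∫ z in halfPlane, phase (-(η * z.1)) * gaugeCut χ u z * ((deriv θ z.2 : ℝ) : ℂ)) -
        ∫ z in halfPlane, u z * (Complex.I * (magA2 z : ℂ) * modeTest η χ θ z) := by
    rw [← integral_sub i1 i3]
    congr 1
    ext z
    rw [fderiv_modeTest_snd η hχ hθ, mul_sub, mul_modeTest]
  have er : ∫ z in halfPlane, (p₂ z + Complex.I * (magA2 z : ℂ) * u z) * modeTest η χ θ z =
      (∫ z in halfPlane, phase (-(η * z.1)) * gaugeCut χ p₂ z * (θ z.2 : ℂ)) +
        ∫ z in halfPlane, u z * (Complex.I * (magA2 z : ℂ) * modeTest η χ θ z) := by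
    rw [← integral_add i2 i3]
    congr 1
    ext z
    rw [add_mul, mul_modeTest]
    ring
  have eb : ∫ x : ℝ, g x * modeTest η χ θ (x, 0) =
      (∫ x, phase (-(η * x)) * ((χ x : ℂ) * g x)) * (θ 0 : ℂ) := by
    rw [← integral_mul_const]
    congr 1
    ext x
    have : phase (-(x * 0 / 2)) = 1 := by simp [phase]
    simp only [modeTest, this]
    ring
  rw [el, er, eb, e1, e2] at h
  linear_combination h

/-- Integration by parts in x₁ brings η + t/2 from the phases and t/2 from the potential, so the
first magnetic derivative acts on the mode as multiplication by i(t + η). -/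
theorem slice_gaugeCut_fst {u p₁ p₂ : ℝ × ℝ → ℂ} (hu : HasMagneticGradient u p₁ p₂)
    (hχ : ContDiff ℝ ((⊤ : ℕ∞) : WithTop ℕ∞) χ) (hχc : HasCompactSupport χ) {θ : ℝ → ℝ}
    (hθ : ContDiff ℝ ((⊤ : ℕ∞) : WithTop ℕ∞) θ) (hθc : HasCompactSupport θ)
    (hθs : tsupport θ ⊆ Ioi 0) :
    (∫ t in Ioi (0 : ℝ), slice η (gaugeCut (deriv χ) u) t * (θ t : ℂ)) +
      ∫ t in Ioi (0 : ℝ), slice η (gaugeCut χ p₁) t * (θ t : ℂ) =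
    Complex.I * ∫ t in Ioi (0 : ℝ), slice η (gaugeCut χ u) t * (((t + η) * θ t : ℝ) : ℂ) := by
  have hχ' : Continuous (deriv χ) := hχ.continuous_deriv (by simp)
  have cθ := hθ.continuous
  obtain ⟨i1, e1⟩ := integral_slice_mul hu.memLp hχ' hχc.deriv hθ.continuous hθc η
  obtain ⟨i2, e2⟩ := integral_slice_mul hu.memLp_fst hχ.continuous hχc hθ.continuous hθc η
  obtain ⟨i3, e3⟩ := integral_slice_mul hu.memLp hχ.continuous hχc
    (θ := fun t => (t + η) * θ t) (by fun_prop) hθc.mul_left η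
  have h := hu.weak_fst _ (contDiff_modeTest η hχ hθ) (hasCompactSupport_modeTest η hχc hθc)
    (tsupport_modeTest_subset η hθs)
  have cm : Continuous fun z => Complex.I * (magA1 z : ℂ) * modeTest η χ θ z := by
    have := (contDiff_modeTest η hχ hθ).continuous
    unfold magA1
    fun_prop
  have i4 : Integrable (fun z => u z * (Complex.I * (magA1 z : ℂ) * modeTest η χ θ z))
      halfPlaneMeasure := hu.memLp.integrable_mul ((cm.memLp_of_hasCompactSupport (p := 2)
        ((hasCompactSupport_modeTest η hχc hθc).mul_left)).restrict _)
  have el : ∫ z in halfPlane, u z * fderiv ℝ (modeTest η χ θ) z (1, 0) =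
      (∫ z in halfPlane, phase (-(η * z.1)) * gaugeCut (deriv χ) u z * (θ z.2 : ℂ)) -
        (Complex.I * (∫ z in halfPlane,
          phase (-(η * z.1)) * gaugeCut χ u z * (((z.2 + η) * θ z.2 : ℝ) : ℂ)) +
        ∫ z in halfPlane, u z * (Complex.I * (magA1 z : ℂ) * modeTest η χ θ z)) := by
    have i5 : Integrable (fun z => Complex.I * (phase (-(η * z.1)) * gaugeCut χ u z *
        (((z.2 + η) * θ z.2 : ℝ) : ℂ)) + u z * (Complex.I * (magA1 z : ℂ) * modeTest η χ θ z))
        halfPlaneMeasure := (i3.const_mul _).add i4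
    rw [← integral_const_mul, ← integral_add (i3.const_mul _) i4, ← integral_sub i1 i5]
    congr 1
    ext z
    rw [fderiv_modeTest_fst η hχ hθ, mul_sub, mul_modeTest]
    simp only [gaugeCut, modeTest, magA1]
    push_cast
    ring
  have er : ∫ z in halfPlane, (p₁ z + Complex.I * (magA1 z : ℂ) * u z) * modeTest η χ θ z =
      (∫ z in halfPlane, phase (-(η * z.1)) * gaugeCut χ p₁ z * (θ z.2 : ℂ)) +
        ∫ z in halfPlane, u z * (Complex.I * (magA1 z : ℂ) * modeTest η χ θ z) := by
    rw [← integral_add i2 i4]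
    congr 1
    ext z
    rw [add_mul, mul_modeTest]
    ring
  rw [el, er, e1, e2, e3] at h
  linear_combination h

end slices

/-! ### The lower bound for localized functions -/

lemma ae_integrable_slice {ρ : ℝ} {F : ℝ × ℝ → ℂ} (hF : MemLp F 2 halfPlaneMeasure)
    (h0 : ∀ x t, ρ ≤ |x| → F (x, t) = 0) (η : ℝ) :
    ∀ᵐ t ∂halfLineMeasure, Integrable fun x => phase (-(η * x)) * F (x, t) := by
  filter_upwards [ae_memLp_slice hF] with t ht
  have h1 : IntegrableOn (fun x => F (x, t)) (Ioo (-ρ) ρ) :=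
    (ht.restrict (Ioo (-ρ) ρ)).integrable one_le_two
  have h2 : Integrable fun x => F (x, t) := by
    refine h1.integrable_of_forall_notMem_eq_zero fun x hx => h0 x t ?_
    by_contra! h
    exact hx (abs_lt.1 h)
  have hc : Continuous fun x : ℝ => phase (-(η * x)) := continuous_phase.comp (by fun_prop)
  exact h2.bdd_mul (c := 1) hc.aestronglyMeasurable
    (Eventually.of_forall fun x => (norm_phase _).le)

lemma ae_slice_add {ρ : ℝ} {F₁ F₂ : ℝ × ℝ → ℂ} (hF₁ : MemLp F₁ 2 halfPlaneMeasure)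
    (h₁ : ∀ x t, ρ ≤ |x| → F₁ (x, t) = 0) (hF₂ : MemLp F₂ 2 halfPlaneMeasure)
    (h₂ : ∀ x t, ρ ≤ |x| → F₂ (x, t) = 0) (η : ℝ) :
    ∀ᵐ t ∂halfLineMeasure, slice η (fun z => F₁ z + F₂ z) t = slice η F₁ t + slice η F₂ t := by
  filter_upwards [ae_integrable_slice hF₁ h₁ η, ae_integrable_slice hF₂ h₂ η] with t i₁ i₂
  simp only [slice]
  rw [← integral_add i₁ i₂]
  simp only [mul_add]

theorem ae_slice_eq {u p₁ p₂ : ℝ × ℝ → ℂ} (hu : HasMagneticGradient u p₁ p₂) {χ : ℝ → ℝ}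
    (hχ : ContDiff ℝ ((⊤ : ℕ∞) : WithTop ℕ∞) χ) (hχc : HasCompactSupport χ) {η : ℝ}
    (m₀ : MemLp (slice η (gaugeCut χ u)) 2 halfLineMeasure)
    (m₁ : MemLp (slice η (gaugeCut (deriv χ) u)) 2 halfLineMeasure)
    (m₂ : MemLp (slice η (gaugeCut χ p₁)) 2 halfLineMeasure) :
    ∀ᵐ t ∂halfLineMeasure, slice η (gaugeCut (deriv χ) u) t + slice η (gaugeCut χ p₁) t =
      Complex.I * (((t + η : ℝ) : ℂ) * slice η (gaugeCut χ u) t) := by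
  have loc : ∀ {f : ℝ → ℂ}, MemLp f 2 halfLineMeasure → LocallyIntegrableOn f (Ioi 0) :=
    fun hf => locallyIntegrableOn_of_locallyIntegrable_restrict (hf.locallyIntegrable one_le_two)
  set f : ℝ → ℂ := fun t => slice η (gaugeCut (deriv χ) u) t + slice η (gaugeCut χ p₁) t with hf
  set g : ℝ → ℂ := fun t => Complex.I * (((t + η : ℝ) : ℂ) * slice η (gaugeCut χ u) t) with hg
  have hfl : LocallyIntegrableOn f (Ioi 0) := (loc m₁).add (loc m₂)
  have hgl : LocallyIntegrableOn g (Ioi 0) := by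
    have hc : ContinuousOn (fun t : ℝ => Complex.I * ((t + η : ℝ) : ℂ)) (Ioi 0) :=
      Continuous.continuousOn (by fun_prop)
    have := (loc m₀).continuousOn_mul hc isOpen_Ioi.isLocallyClosed
    refine this.congr (Eventually.of_forall fun t => ?_)
    simp only [hg, mul_assoc]
  have key : ∀ᵐ t, t ∈ Ioi (0 : ℝ) → f t - g t = 0 := by
    refine isOpen_Ioi.ae_eq_zero_of_integral_contDiff_smul_eq_zero (hfl.sub hgl) ?_
    intro θ hθ hθc hθs
    have cθ := hθ.continuous
    have e1 : ∫ t, θ t • (f t - g t) = ∫ t in Ioi (0 : ℝ), θ t • (f t - g t) := by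
      refine (setIntegral_eq_integral_of_forall_compl_eq_zero fun t ht => ?_).symm
      rw [image_eq_zero_of_notMem_tsupport fun h' => ht (hθs h'), zero_smul]
    have int : ∀ {h : ℝ → ℂ} {τ : ℝ → ℝ}, MemLp h 2 halfLineMeasure → Continuous τ →
        HasCompactSupport τ → Integrable (fun t => h t * (τ t : ℂ)) halfLineMeasure := by
      intro h τ hh hτ hτc
      have h1 : MemLp (fun t => (τ t : ℂ)) 2 halfLineMeasure :=
        ((hτ.memLp_of_hasCompactSupport hτc).restrict _).ofReal
      exact hh.integrable_mul h1
    have j1 := int m₁ cθ hθc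
    have j2 := int m₂ cθ hθc
    have j0 := int m₀ (τ := fun t => (t + η) * θ t) (by fun_prop) hθc.mul_left
    have h := slice_gaugeCut_fst η hu hχ hχc hθ hθc hθs
    have j12 : Integrable (fun t => slice η (gaugeCut (deriv χ) u) t * (θ t : ℂ) +
        slice η (gaugeCut χ p₁) t * (θ t : ℂ)) halfLineMeasure := j1.add j2
    rw [← integral_const_mul, ← integral_add j1 j2, ← sub_eq_zero,
      ← integral_sub j12 (j0.const_mul _)] at h
    rw [e1, ← h]
    congr 1
    ext t
    simp only [hf, hg, Complex.real_smul]
    push_cast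
    ring
  refine (ae_restrict_iff' measurableSet_Ioi).2 ?_
  filter_upwards [key] with t ht hmem
  exact sub_eq_zero.1 (ht hmem)

/-- Each Fourier mode satisfies the half-line inequality with ξ = -`modeFreq ρ k`; its hypothesis
R(-ξ, a) ≤ γ holds for every ξ because γ is the maximum of R(·, a). Parseval sums the modes, and the
common factor 2ρ cancels. -/
theorem localized_energy_ge {γ s a : ℝ} (hcr : IsCrit γ s a) {u p₁ p₂ : ℝ × ℝ → ℂ} {g : ℝ → ℂ}
    (hu : HasMagneticGradient u p₁ p₂) (hg : IsBoundaryTrace u p₂ g) {χ : ℝ → ℝ}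
    (hχ : ContDiff ℝ ((⊤ : ℕ∞) : WithTop ℕ∞) χ) (hχc : HasCompactSupport χ) :
    (1 - 2 * a) * ∫ z in halfPlane, ‖(χ z.1 : ℂ) * u z‖ ^ 2 ≤
      (∫ z in halfPlane, ‖(χ z.1 : ℂ) * p₂ z‖ ^ 2) +
      (∫ z in halfPlane, ‖((deriv χ z.1 : ℝ) : ℂ) * u z + (χ z.1 : ℂ) * p₁ z‖ ^ 2) +
      γ * ∫ x, ‖(χ x : ℂ) * g x‖ ^ 2 := by
  obtain ⟨r, hr⟩ := hχc.isCompact.isBounded.subset_closedBall 0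
  set ρ := max r 0 + 1 with hρ
  have hρpos : 0 < ρ := by have := le_max_right r 0; linarith
  have hout : ∀ x, ρ ≤ |x| → x ∉ tsupport χ := by
    intro x hx hmem
    have h1 := hr hmem
    rw [Metric.mem_closedBall, Real.dist_eq, sub_zero] at h1
    linarith [le_max_left r 0]
  have hχ0 : ∀ x, ρ ≤ |x| → χ x = 0 := fun x hx => image_eq_zero_of_notMem_tsupport (hout x hx)
  have hχ1 : ∀ x, ρ ≤ |x| → deriv χ x = 0 := fun x hx =>
    image_eq_zero_of_notMem_tsupport fun h' => hout x hx (tsupport_deriv_subset h')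
  have cut0 : ∀ {τ : ℝ → ℝ} (f : ℝ × ℝ → ℂ), (∀ x, ρ ≤ |x| → τ x = 0) →
      ∀ x t, ρ ≤ |x| → gaugeCut τ f (x, t) = 0 := fun f hτ x t hx => by
    simp [gaugeCut, hτ x hx]
  have hχ' : Continuous (deriv χ) := hχ.continuous_deriv (by simp)
  have M0 := memLp_gaugeCut hχ.continuous hχc hu.memLp
  have M1 := memLp_gaugeCut hχ' hχc.deriv hu.memLp
  have M2 := memLp_gaugeCut hχ.continuous hχc hu.memLp_fst
  have M3 := memLp_gaugeCut hχ.continuous hχc hu.memLp_snd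
  set F₁ : ℝ × ℝ → ℂ := fun z => gaugeCut (deriv χ) u z + gaugeCut χ p₁ z with hF₁
  have M12 : MemLp F₁ 2 halfPlaneMeasure := M1.add M2
  have Mg : MemLp (fun x => (χ x : ℂ) * g x) 2 volume := by
    obtain ⟨C, hC⟩ := hχ.continuous.bounded_above_of_compact_support hχc
    refine MemLp.of_le_mul (c := C) hg.memLp ((Complex.continuous_ofReal.comp
      hχ.continuous).aestronglyMeasurable.mul hg.memLp.1) (Eventually.of_forall fun x => ?_)
    rw [norm_mul, Complex.norm_real]
    exact mul_le_mul_of_nonneg_right (hC _) (norm_nonneg _)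
  obtain ⟨m0, s0⟩ := hasSum_integral_sq_slices hρpos M0 (cut0 u hχ0)
  obtain ⟨m1, -⟩ := hasSum_integral_sq_slices hρpos M1 (cut0 u hχ1)
  obtain ⟨m2, -⟩ := hasSum_integral_sq_slices hρpos M2 (cut0 p₁ hχ0)
  obtain ⟨m3, s3⟩ := hasSum_integral_sq_slices hρpos M3 (cut0 p₂ hχ0)
  obtain ⟨m12, s12⟩ := hasSum_integral_sq_slices hρpos M12 fun x t hx => by
    simp only [hF₁, cut0 u hχ1 x t hx, cut0 p₁ hχ0 x t hx, add_zero]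
  have sg := hasSum_sq_integral_phase hρpos Mg fun x hx => by simp [hχ0 x hx]
  have step : ∀ k : ℤ, (1 - 2 * a) * ∫ t in Ioi (0 : ℝ),
        ‖slice (modeFreq ρ k) (gaugeCut χ u) t‖ ^ 2 ≤
      (∫ t in Ioi (0 : ℝ), ‖slice (modeFreq ρ k) (gaugeCut χ p₂) t‖ ^ 2) +
      (∫ t in Ioi (0 : ℝ), ‖slice (modeFreq ρ k) F₁ t‖ ^ 2) +
      γ * ‖∫ x, phase (-(modeFreq ρ k * x)) * ((χ x : ℂ) * g x)‖ ^ 2 := by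
    intro k
    have hae : ∀ᵐ t ∂halfLineMeasure, ‖slice (modeFreq ρ k) F₁ t‖ ^ 2 =
        ‖((t - -modeFreq ρ k : ℝ) : ℂ) * slice (modeFreq ρ k) (gaugeCut χ u) t‖ ^ 2 := by
      filter_upwards [ae_slice_eq hu hχ hχc (m0 k) (m1 k) (m2 k),
        ae_slice_add M1 (cut0 u hχ1) M2 (cut0 p₁ hχ0) (modeFreq ρ k)] with t h1 h2
      rw [h2, h1, norm_mul, Complex.norm_I, one_mul, sub_neg_eq_add]
    have hi := (m12 k).integrable_norm_pow (p := 2) (by norm_num)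
    have h := energy_ge_of_green_complex (γ := γ) (ξ := -modeFreq ρ k) hcr.pos ?_ (m0 k) (m3 k)
      (hi.congr hae) fun θ hθ hθc => green_slice (modeFreq ρ k) hu hg hχ hχc hθ hθc
    · rw [integral_congr_ae hae]
      exact h
    · rw [neg_neg, ← hcr.robin]
      exact cylR_le_of_cylD_eq_zero hcr.pos hcr.crit _
  have h := hasSum_le step (s0.mul_left (1 - 2 * a)) ((s3.add s12).add (sg.mul_left γ))
  simp only [hF₁, norm_gaugeCut] at h
  have e : ∀ z : ℝ × ℝ, ‖gaugeCut (deriv χ) u z + gaugeCut χ p₁ z‖ =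
      ‖((deriv χ z.1 : ℝ) : ℂ) * u z + (χ z.1 : ℂ) * p₁ z‖ := by
    intro z
    rw [gaugeCut, gaugeCut, mul_assoc, mul_assoc, ← mul_add, norm_mul, norm_phase, one_mul]
  simp only [e] at h
  refine le_of_mul_le_mul_left ?_ (mul_pos two_pos hρpos)
  linarith

/-! ### The bottom of the spectrum of the half-plane model -/

lemma exists_cutoff_sequence : ∃ (χ : ℕ → ℝ → ℝ) (C : ℝ),
    (∀ n, ContDiff ℝ ((⊤ : ℕ∞) : WithTop ℕ∞) (χ n)) ∧ (∀ n, HasCompactSupport (χ n)) ∧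
    (∀ n x, |χ n x| ≤ 1) ∧ (∀ n x, |deriv (χ n) x| ≤ C / (n + 1)) ∧
    ∀ x, Tendsto (fun n => χ n x) atTop (𝓝 1) := by
  let b : ContDiffBump (0 : ℝ) := ⟨1, 2, one_pos, one_lt_two⟩
  have hb : ContDiff ℝ ((⊤ : ℕ∞) : WithTop ℕ∞) b := b.contDiff
  obtain ⟨C, hC⟩ := (hb.continuous_deriv (by simp)).bounded_above_of_compact_support
    b.hasCompactSupport.deriv
  have hpos : ∀ n : ℕ, (0 : ℝ) < ((n : ℝ) + 1)⁻¹ := fun n => by positivity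
  refine ⟨fun n x => b (((n : ℝ) + 1)⁻¹ * x), C, fun n => ?_, fun n => ?_, fun n x => ?_,
    fun n x => ?_, fun x => ?_⟩
  · exact hb.comp (contDiff_const.mul contDiff_id)
  · exact b.hasCompactSupport.comp_homeomorph (Homeomorph.mulLeft₀ _ (hpos n).ne')
  · rw [abs_of_nonneg b.nonneg]
    exact b.le_one
  · have h1 : HasDerivAt (fun x : ℝ => ((n : ℝ) + 1)⁻¹ * x) ((n : ℝ) + 1)⁻¹ x := by
      simpa using (hasDerivAt_id x).const_mul ((n : ℝ) + 1)⁻¹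
    have h2 := ((hb.differentiable (by simp) (((n : ℝ) + 1)⁻¹ * x)).hasDerivAt).comp x h1
    have h3 : deriv (fun x : ℝ => b (((n : ℝ) + 1)⁻¹ * x)) x = _ := h2.deriv
    rw [h3, abs_mul, abs_of_pos (hpos n), div_eq_mul_inv]
    exact mul_le_mul_of_nonneg_right (hC _) (hpos n).le
  · refine tendsto_const_nhds.congr' ?_
    filter_upwards [eventually_ge_atTop ⌈|x|⌉₊] with n hn
    refine (b.one_of_mem_closedBall ?_).symm
    rw [Metric.mem_closedBall, Real.dist_eq, sub_zero, abs_mul, abs_of_pos (hpos n),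
      inv_mul_le_iff₀ (by positivity)]
    change |x| ≤ ((n : ℝ) + 1) * 1
    have := (Nat.ceil_le.1 hn)
    linarith

/-- The localization error χₙ' u tends to zero, since χₙ' is of order 1/n; dominated convergence
gives the other limits. -/
theorem half_plane_energy_ge {γ s a : ℝ} (hcr : IsCrit γ s a) {u p₁ p₂ : ℝ × ℝ → ℂ} {g : ℝ → ℂ}
    (hu : HasMagneticGradient u p₁ p₂) (hg : IsBoundaryTrace u p₂ g) :
    (1 - 2 * a) * ∫ z in halfPlane, ‖u z‖ ^ 2 ≤
      (∫ z in halfPlane, (‖p₁ z‖ ^ 2 + ‖p₂ z‖ ^ 2)) + γ * ∫ x, ‖g x‖ ^ 2 := by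
  obtain ⟨χ, C, hχ, hχc, hχ1, hχ', hχt⟩ := exists_cutoff_sequence
  have hC : 0 ≤ C := by
    have := (abs_nonneg _).trans (hχ' 0 0)
    simpa using this
  have cχ : ∀ n, Continuous (χ n) := fun n => (hχ n).continuous
  have cχ' : ∀ n, Continuous (deriv (χ n)) := fun n => (hχ n).continuous_deriv (by simp)
  have iu := hu.memLp.integrable_norm_pow (p := 2) (by norm_num)
  have i1 := hu.memLp_fst.integrable_norm_pow (p := 2) (by norm_num)
  have i2 := hu.memLp_snd.integrable_norm_pow (p := 2) (by norm_num)
  have ig := hg.memLp.integrable_norm_pow (p := 2) (by norm_num)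
  have lim : ∀ {f : ℝ × ℝ → ℂ}, MemLp f 2 halfPlaneMeasure →
      Tendsto (fun n => ∫ z in halfPlane, ‖(χ n z.1 : ℂ) * f z‖ ^ 2) atTop
        (𝓝 (∫ z in halfPlane, ‖f z‖ ^ 2)) := by
    intro f hf
    refine tendsto_integral_of_dominated_convergence (fun z => ‖f z‖ ^ 2) (fun n => ?_)
      (hf.integrable_norm_pow (p := 2) (by norm_num)) (fun n => Eventually.of_forall fun z => ?_)
      (Eventually.of_forall fun z => ?_)
    · have c : Continuous fun z : ℝ × ℝ => (χ n z.1 : ℂ) := by have := cχ n; fun_prop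
      exact (c.aestronglyMeasurable.mul hf.1).norm.pow 2
    · rw [Real.norm_of_nonneg (sq_nonneg _), norm_mul, Complex.norm_real]
      gcongr
      exact mul_le_of_le_one_left (norm_nonneg _) (hχ1 n _)
    · have h := (((Complex.continuous_ofReal.tendsto _).comp (hχt z.1)).mul_const (f z)).norm.pow 2
      simpa using h
  have limg : Tendsto (fun n => ∫ x, ‖(χ n x : ℂ) * g x‖ ^ 2) atTop (𝓝 (∫ x, ‖g x‖ ^ 2)) := by
    refine tendsto_integral_of_dominated_convergence (fun x => ‖g x‖ ^ 2) (fun n => ?_) ig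
      (fun n => Eventually.of_forall fun z => ?_) (Eventually.of_forall fun z => ?_)
    · have c : Continuous fun x : ℝ => (χ n x : ℂ) := by have := cχ n; fun_prop
      exact (c.aestronglyMeasurable.mul hg.memLp.1).norm.pow 2
    · rw [Real.norm_of_nonneg (sq_nonneg _), norm_mul, Complex.norm_real]
      gcongr
      exact mul_le_of_le_one_left (norm_nonneg _) (hχ1 n _)
    · have h := (((Complex.continuous_ofReal.tendsto _).comp (hχt z)).mul_const (g z)).norm.pow 2
      simpa using h
  have lim1 : Tendsto (fun n => ∫ z in halfPlane,
      ‖((deriv (χ n) z.1 : ℝ) : ℂ) * u z + (χ n z.1 : ℂ) * p₁ z‖ ^ 2) atTop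
        (𝓝 (∫ z in halfPlane, ‖p₁ z‖ ^ 2)) := by
    refine tendsto_integral_of_dominated_convergence
      (fun z => 2 * C ^ 2 * ‖u z‖ ^ 2 + 2 * ‖p₁ z‖ ^ 2) (fun n => ?_)
      ((iu.const_mul _).add (i1.const_mul _)) (fun n => Eventually.of_forall fun z => ?_)
      (Eventually.of_forall fun z => ?_)
    · have c : Continuous fun z : ℝ × ℝ => (χ n z.1 : ℂ) := by have := cχ n; fun_prop
      have c' : Continuous fun z : ℝ × ℝ => ((deriv (χ n) z.1 : ℝ) : ℂ) := by
        have := cχ' n; fun_prop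
      exact ((c'.aestronglyMeasurable.mul hu.memLp.1).add
        (c.aestronglyMeasurable.mul hu.memLp_fst.1)).norm.pow 2
    · rw [Real.norm_of_nonneg (sq_nonneg _)]
      have h1 : ‖((deriv (χ n) z.1 : ℝ) : ℂ) * u z‖ ≤ C * ‖u z‖ := by
        rw [norm_mul, Complex.norm_real]
        refine mul_le_mul_of_nonneg_right ((hχ' n _).trans (div_le_self hC ?_)) (norm_nonneg _)
        have : (0 : ℝ) ≤ n := n.cast_nonneg
        linarith
      have h2 : ‖(χ n z.1 : ℂ) * p₁ z‖ ≤ ‖p₁ z‖ := by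
        rw [norm_mul, Complex.norm_real]
        exact mul_le_of_le_one_left (norm_nonneg _) (hχ1 n _)
      have h3 := (norm_add_le _ _).trans (add_le_add h1 h2)
      have h4 := pow_le_pow_left₀ (norm_nonneg _) h3 2
      nlinarith [sq_nonneg (C * ‖u z‖ - ‖p₁ z‖)]
    · have h0 : Tendsto (fun n => deriv (χ n) z.1) atTop (𝓝 0) := by
        refine squeeze_zero_norm (fun n => hχ' n z.1) ?_
        have := (tendsto_one_div_add_atTop_nhds_zero_nat (𝕜 := ℝ)).const_mul C
        simpa [div_eq_mul_inv] using this
      have h := ((((Complex.continuous_ofReal.tendsto _).comp h0).mul_const (u z)).add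
        (((Complex.continuous_ofReal.tendsto _).comp (hχt z.1)).mul_const (p₁ z))).norm.pow 2
      simpa using h
  have h := le_of_tendsto_of_tendsto' ((lim hu.memLp).const_mul (1 - 2 * a))
    (((lim hu.memLp_snd).add lim1).add (limg.const_mul γ))
    fun n => localized_energy_ge hcr hu hg (hχ n) (hχc n)
  rw [integral_add i1 i2]
  linarith

lemma le_of_mem_rayleighSet {γ s a r : ℝ} (hcr : IsCrit γ s a) (hr : r ∈ rayleighSet γ) :
    1 - 2 * a ≤ r := by
  obtain ⟨u, p₁, p₂, g, hu, hg, hne, rfl⟩ := hr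
  have iu : IntegrableOn (fun z => ‖u z‖ ^ 2) halfPlane :=
    hu.memLp.integrable_norm_pow (p := 2) (by norm_num)
  have hpos : 0 < ∫ z in halfPlane, ‖u z‖ ^ 2 := by
    refine lt_of_le_of_ne (integral_nonneg fun z => sq_nonneg _) fun h => hne ?_
    have h1 := (integral_eq_zero_iff_of_nonneg (fun z => sq_nonneg ‖u z‖) iu).1 h.symm
    filter_upwards [h1] with z hz
    simpa using hz
  rw [le_div_iff₀ hpos]
  exact half_plane_energy_ge hcr hu hg

/-- The bottom of the spectrum of the half-plane model is the minimum of the band function. -/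
theorem Theta_eq_critPair (γ : ℝ) : Theta γ = 1 - 2 * (critPair γ).2 := by
  have hcr := isCrit_critPair γ
  have hlb : 1 - 2 * (critPair γ).2 ∈ lowerBounds (rayleighSet γ) :=
    fun r hr => le_of_mem_rayleighSet hcr hr
  rw [Theta_eq]
  refine le_antisymm (le_of_forall_pos_le_add fun ε hε => ?_)
    (le_csInf ⟨_, add_mem_rayleighSet hcr one_pos⟩ hlb)
  -- The trial state of width parameter b has excess b/2, so b = 2ε gives excess exactly ε.
  have h := csInf_le ⟨_, hlb⟩ (add_mem_rayleighSet hcr (b := 2 * ε) (by linarith))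
  linarith

end

theorem mainTheorem8 :
    ∃ (ξ : ℝ → ℝ) (φ : ℝ → MeasureTheory.Lp ℂ 2 halfLineMeasure),
      (∀ γ x : ℝ, (∀ y : ℝ, firstEigenvalue γ x ≤ firstEigenvalue γ y) ↔ x = ξ γ) ∧
      (∀ (γ : ℝ) (f : MeasureTheory.Lp ℂ 2 halfLineMeasure),
        IsPositiveNormalizedEigenfunction γ (ξ γ) (Theta γ) f ↔ f = φ γ) ∧
      ContDiff ℝ ((⊤ : ℕ∞) : WithTop ℕ∞) Theta ∧
      ContDiff ℝ ((⊤ : ℕ∞) : WithTop ℕ∞) φ ∧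
      ∃ hφ : ∀ γ : ℝ, MeasureTheory.MemLp (φ γ) (⊤ : ENNReal) halfLineMeasure,
        LocallyLipschitz
          (fun γ : ℝ => ((hφ γ).toLp (φ γ) : MeasureTheory.Lp ℂ (⊤ : ENNReal) halfLineMeasure)) := by
  refine ⟨fun γ => -(critPair γ).1, groundState,
    fun γ x => firstEigenvalue_minimal_iff (isCrit_critPair γ) x, fun γ f => ?_, ?_,
    contDiff_groundState, exists_memLp_top_locallyLipschitz⟩
  · rw [Theta_eq_critPair]
    exact isPositiveNormalizedEigenfunction_iff γ f
  · have h : Theta = fun γ => 1 - 2 * (critPair γ).2 := funext Theta_eq_critPair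
    rw [h]
    exact contDiff_const.sub (contDiff_const.mul contDiff_critPair.snd)
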